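/- Let $M$ be a compact surface without boundary with a fixed Riemannian metric, let $|\xi|$ be the induced norm of covectors, and let $p\in C^\infty(T^*M\setminus 0;\mathbb R)$ be homogeneous of order $0$ in the fibers. Let $H_f=\partial_\xi f\cdot\partial_x-\partial_x f\cdot\partial_\xi$ denote the Hamiltonian vector field of $f$, and $\xi\partial_\xi$ the generator of fiber dilations. (a) Let $\Lambda\subset T^*M\setminus 0$ be a conic hypersurface such that $dp|_{T\Lambda}\neq 0$ everywhere and $H_p$ is tangent to $\Lambda$. Then there is a unique function $\Phi$ on $\Lambda$ such that for every local defining function $G$ of $\Lambda$ one has $$\xi\partial_\xi=\Phi H_p+\Theta H_G\quad\text{on }\Lambda$$ with some function $\Theta$. Put $\Lambda_\omega:=\Lambda\cap p^{-1}(\omega)$. Assume that, in some local coordinate system on $M$ and in some open subset of $T^*M$, for $\omega$ in a nondegenerate interval $J$, $$\Lambda_\omega=\{(x,\xi)\colon x=\partial_\xi F(\omega,\xi),\ \xi\in\Gamma_0\},$$ where $\Gamma_0\subset\mathbb R^2\setminus 0$ is an open cone and $F$ is smooth on $J\times\Gamma_0$ and homogeneous of order $1$ in $\xi$. Then for $\omega\in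 J$, $\xi\in\Gamma_0$ (with one-sided derivatives at endpoints of $J$) $$\partial_\omega F(\omega,\xi)=-\Phi(\partial_\xi F(\omega,\xi),\xi).$$ (b) Assume in addition that $0$ is a regular value of $p$. Let $\kappa$ be the quotient map of $T^*M\setminus 0$ by the positive dilations, $\Sigma(\omega)=\kappa(p^{-1}(\omega))$ and $X=\kappa_*(|\xi|H_p)$, and assume that the flow of $X$ on $\Sigma(0)$ is a Morse--Smale flow without fixed points. (That is, $X$ does not vanish on $\Sigma(0)$; it has finitely many hyperbolic closed trajectories there; and every other trajectory has one of them as its $\alpha$-limit set and one of them as its $\omega$-limit set.) Let $L^+_\omega$, respectively $L^-_\omega$, be the union of the attractive, respectively repulsive, hyperbolic closed trajectories of $X$ on $\Sigma(\omega)$, and put $\Lambda^\pm=\bigcup_{|\omega|<2\delta}\kappa^{-1}(L^\pm_\omega)$. Then for all sufficiently small $\delta>0$: the sets $\Lambda^\pm$ satisfy the assumptions on $\Lambda$ in (a); there is a constant $c>0$ such that the corresponding functions $\Phi^\pm$ satisfy $$\pm\Phi^\pm(x,\xi)\geq c|\xi|\quad\text{on }\Lambda^\pm;$$ and whenever $\Lambda^\pm_\omega=\Lambda^\pm\cap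 p^{-1}(\omega)$ are locally given by a generating function $F$ as in (a), with $J\subset(-2\delta,2\delta)$, one has $$\pm\partial_\omega F(\omega,\xi)<0,\qquad \omega\in J,\ \xi\in\Gamma_0.$$ -/

import Mathlib

open Set Filter Topology Bundle
open scoped Manifold ContDiff InnerProductSpace

set_option linter.unusedSectionVars false

noncomputable section

/-- The model space `ℝ²` of a surface. -/
abbrev Plane : Type := EuclideanSpace ℝ (Fin 2)

/-- The dual of the model space. -/
abbrev DualPlane : Type := Plane →L[ℝ] ℝ

section CotangentBundle

variable (M : Type*) [TopologicalSpace M] [ChartedSpace Plane M] [IsManifold 𝓘(ℝ, Plane) ∞ M]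

/-- The total space of the cotangent bundle `T*M` of a surface `M`; its points are pairs
`ζ = ⟨x, ξ⟩` with `ξ` a covector at `x`. It carries Mathlib's topology and smooth structure of the
hom-bundle from the tangent bundle to the trivial line bundle. The tangent space at `ζ` is
`Plane × DualPlane`, read in the canonical coordinates `(x, ξ)` induced by the preferred chart of
`M` at the base point. -/
abbrev Cotangent : Type _ :=
  TotalSpace DualPlane
    (fun x : M => TangentSpace 𝓘(ℝ, Plane) x →L[ℝ] Bundle.Trivial M ℝ x)

/-- The model with corners of `T*M`. -/
abbrev cotangentModel : ModelWithCorners ℝ (Plane × DualPlane) (ModelProd Plane DualPlane) :=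
  𝓘(ℝ, Plane).prod 𝓘(ℝ, DualPlane)

/-- `T*M ∖ 0`, as a subset of `T*M`. -/
def puncturedCotangent : Set (Cotangent M) := {ζ | ζ.2 ≠ 0}

variable {M}

/-- The dilation `(x, ξ) ↦ (x, t ξ)`. -/
def dilate (t : ℝ) (ζ : Cotangent M) : Cotangent M := ⟨ζ.1, t • ζ.2⟩

theorem dilate_one (ζ : Cotangent M) : dilate 1 ζ = ζ := by
  unfold dilate
  congr 1
  exact one_smul ℝ ζ.2

theorem dilate_dilate (s t : ℝ) (ζ : Cotangent M) :
    dilate s (dilate t ζ) = dilate (s * t) ζ := by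
  unfold dilate
  congr 1
  exact smul_smul s t ζ.2

/-- A subset of `T*M` is conic if it is invariant under the positive dilations. -/
def IsConic (Λ : Set (Cotangent M)) : Prop := ∀ ζ ∈ Λ, ∀ t : ℝ, 0 < t → dilate t ζ ∈ Λ

/-- The radial vector field `ξ ∂_ξ` (generator of the dilations). -/
def radialField (ζ : Cotangent M) : Plane × DualPlane := (0, ζ.2)

/-- The differential of a function on `T*M`, in the canonical coordinates at `ζ`. -/
def cotangentDiff (f : Cotangent M → ℝ) (ζ : Cotangent M) : Plane × DualPlane →L[ℝ] ℝ :=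
  mfderiv cotangentModel 𝓘(ℝ, ℝ) f ζ

/-- The Hamiltonian vector field `H_f = ∂_ξ f · ∂_x - ∂_x f · ∂_ξ`. In the first component, the
element `∂_ξ f` of the bidual of `Plane` is turned into a vector `∑ᵢ (∂f/∂ξᵢ) eᵢ`. -/
def hamiltonianField (f : Cotangent M → ℝ) (ζ : Cotangent M) : Plane × DualPlane :=
  (∑ i : Fin 2, cotangentDiff f ζ (0, EuclideanSpace.proj i) • EuclideanSpace.single i (1 : ℝ),
    -((cotangentDiff f ζ).comp (ContinuousLinearMap.inl ℝ Plane DualPlane)))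

/-- The norm `|ξ|` of a covector with respect to a Riemannian metric `g` on `M`, dual to the norm
of tangent vectors. -/
def covectorNorm
    (g : ContMDiffRiemannianMetric 𝓘(ℝ, Plane) ∞ Plane
      (fun x : M => TangentSpace 𝓘(ℝ, Plane) x)) (ζ : Cotangent M) : ℝ :=
  sSup {r : ℝ | ∃ v : TangentSpace 𝓘(ℝ, Plane) ζ.1, g.inner ζ.1 v v ≤ 1 ∧ r = ζ.2 v}

/-- A smooth function `p : T*M ∖ 0 → ℝ`, homogeneous of order `0` (values of `p` on the zero
section are irrelevant). -/
structure IsSymbolOrderZero (p : Cotangent M → ℝ) : Prop where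
  smooth : ContMDiffOn cotangentModel 𝓘(ℝ, ℝ) ∞ p (puncturedCotangent M)
  homogeneous : ∀ ζ ∈ puncturedCotangent M, ∀ t : ℝ, 0 < t → p (dilate t ζ) = p ζ

/-! ### Hypersurfaces of `T*M ∖ 0` -/

/-- `G` is a smooth defining function of `Λ` in the open set `U ⊆ T*M ∖ 0`. -/
structure IsDefiningFunction (Λ U : Set (Cotangent M)) (G : Cotangent M → ℝ) : Prop where
  isOpen : IsOpen U
  subset : U ⊆ puncturedCotangent M
  smooth : ContMDiffOn cotangentModel 𝓘(ℝ, ℝ) ∞ G U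
  zero_iff : ∀ ζ ∈ U, ζ ∈ Λ ↔ G ζ = 0
  diff_ne_zero : ∀ ζ ∈ U, ζ ∈ Λ → cotangentDiff G ζ ≠ 0

/-- The assumptions on a family of Lagrangians `Λ_w = Λ ∩ p⁻¹(w)`: `Λ ⊆ T*M ∖ 0` is a conic
(embedded, smooth) hypersurface, `dp` does not vanish on the tangent spaces of `Λ`, and `H_p` is
tangent to `Λ`. -/
structure IsLagrangianFamily (p : Cotangent M → ℝ) (Λ : Set (Cotangent M)) : Prop where
  subset : Λ ⊆ puncturedCotangent M
  conic : IsConic Λ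
  hypersurface : ∀ ζ ∈ Λ, ∃ U G, ζ ∈ U ∧ IsDefiningFunction Λ U G
  diff_ne_zero : ∀ ζ ∈ Λ, ∀ U G, ζ ∈ U → IsDefiningFunction Λ U G →
    ∃ v : Plane × DualPlane, cotangentDiff G ζ v = 0 ∧ cotangentDiff p ζ v ≠ 0
  tangent : ∀ ζ ∈ Λ, ∀ U G, ζ ∈ U → IsDefiningFunction Λ U G →
    cotangentDiff G ζ (hamiltonianField p ζ) = 0

/-- The function `Φ` on `Λ` satisfies `ξ ∂_ξ = Φ H_p + Θ H_G` on `Λ`, with some function `Θ`, for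
every local defining function `G` of `Λ`. -/
def IsPhi (p : Cotangent M → ℝ) (Λ : Set (Cotangent M)) (Φ : Cotangent M → ℝ) : Prop :=
  ∀ U G, IsDefiningFunction Λ U G → ∃ Θ : Cotangent M → ℝ, ∀ ζ ∈ Λ ∩ U,
    radialField ζ = Φ ζ • hamiltonianField p ζ + Θ ζ • hamiltonianField G ζ

/-! ### Generating functions -/

/-- The point of `T*M` with coordinates `(x, ξ) ∈ ℝ² × ℝ²` in the coordinate system `e` on `M`:
the covector `⟨ξ, de(·)⟩` at the point `e⁻¹(x)`. -/
def ofCoordinates (e : OpenPartialHomeomorph M Plane) (x ξ : Plane) : Cotangent M :=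
  ⟨e.symm x, (innerSL ℝ ξ).comp (mfderiv 𝓘(ℝ, Plane) 𝓘(ℝ, Plane) e (e.symm x))⟩

/-- In the coordinate system `e` on `M`, the Lagrangians `Λ_w = Λ ∩ p⁻¹(w)`, `w ∈ J`, are given in
the open set `U` by `x = ∂_ξ F(w, ξ)`, `ξ ∈ Γ₀`. Here `J` is a nondegenerate interval of any type,
`Γ₀ ⊆ ℝ² ∖ 0` is an open cone, and `F` is smooth on `J × Γ₀` and homogeneous of order `1` in `ξ`. -/
structure IsGeneratingFunction (p : Cotangent M → ℝ) (Λ U : Set (Cotangent M))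
    (e : OpenPartialHomeomorph M Plane) (J : Set ℝ) (Γ₀ : Set Plane)
    (F : ℝ → Plane → ℝ) : Prop where
  chart : e ∈ IsManifold.maximalAtlas 𝓘(ℝ, Plane) ∞ M
  isOpen : IsOpen U
  interval : J.OrdConnected
  nondegenerate : (interior J).Nonempty
  cone_isOpen : IsOpen Γ₀
  cone_ne_zero : (0 : Plane) ∉ Γ₀
  cone : ∀ ξ ∈ Γ₀, ∀ t : ℝ, 0 < t → t • ξ ∈ Γ₀
  smooth : ContDiffOn ℝ ∞ (fun q : ℝ × Plane => F q.1 q.2) (J ×ˢ Γ₀)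
  homogeneous : ∀ w ∈ J, ∀ ξ ∈ Γ₀, ∀ t : ℝ, 0 < t → F w (t • ξ) = t * F w ξ
  mem_target : ∀ w ∈ J, ∀ ξ ∈ Γ₀, gradient (F w) ξ ∈ e.target
  eq_graph : ∀ w ∈ J, Λ ∩ p ⁻¹' {w} ∩ U =
    (fun ξ => ofCoordinates e (gradient (F w) ξ) ξ) '' Γ₀

/-! ### Fiber infinity and the rescaled Hamiltonian flow -/

/-- Two nonzero covectors are equivalent if they are on the same ray. -/
def raySetoid (M : Type*) [TopologicalSpace M] [ChartedSpace Plane M]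
    [IsManifold 𝓘(ℝ, Plane) ∞ M] : Setoid (puncturedCotangent M) where
  r ζ ζ' := ∃ t : ℝ, 0 < t ∧ ζ'.1 = dilate t ζ.1
  iseqv :=
    { refl := fun ζ => ⟨1, one_pos, (dilate_one ζ.1).symm⟩
      symm := by
        rintro ζ ζ' ⟨t, ht, h⟩
        refine ⟨t⁻¹, inv_pos.2 ht, ?_⟩
        rw [h, dilate_dilate, inv_mul_cancel₀ ht.ne', dilate_one]
      trans := by
        rintro ζ ζ' ζ'' ⟨t, ht, h⟩ ⟨s, hs, h'⟩
        refine ⟨s * t, mul_pos hs ht, ?_⟩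
        rw [h', h, dilate_dilate] }

/-- The fiber infinity `∂T̄*M`, that is, the quotient of `T*M ∖ 0` by the positive dilations, with
the quotient topology. -/
def FiberInfinity (M : Type*) [TopologicalSpace M] [ChartedSpace Plane M]
    [IsManifold 𝓘(ℝ, Plane) ∞ M] : Type _ := Quotient (raySetoid M)

instance : TopologicalSpace (FiberInfinity M) :=
  inferInstanceAs (TopologicalSpace (Quotient (raySetoid M)))

/-- The quotient map `κ : T*M ∖ 0 → ∂T̄*M`. -/
def kappa (ζ : puncturedCotangent M) : FiberInfinity M := Quotient.mk (raySetoid M) ζ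

variable (g : ContMDiffRiemannianMetric 𝓘(ℝ, Plane) ∞ Plane
  (fun x : M => TangentSpace 𝓘(ℝ, Plane) x)) (p : Cotangent M → ℝ)

/-- The rescaled Hamiltonian vector field `|ξ| H_p`. -/
def rescaledField (ζ : Cotangent M) : TangentSpace cotangentModel ζ :=
  (covectorNorm g ζ • hamiltonianField p ζ : Plane × DualPlane)

/-- The flow `e^{t|ξ|H_p}` on `T*M ∖ 0`. It descends by `κ` to the flow of `X = κ_*(|ξ|H_p)`. -/
structure RescaledFlow where
  /-- the flow map -/
  toFun : ℝ → Cotangent M → Cotangent M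
  mem : ∀ t, ∀ ζ ∈ puncturedCotangent M, toFun t ζ ∈ puncturedCotangent M
  zero : ∀ ζ ∈ puncturedCotangent M, toFun 0 ζ = ζ
  integral : ∀ ζ ∈ puncturedCotangent M,
    IsMIntegralCurve (I := cotangentModel) (fun t => toFun t ζ) (rescaledField g p)

variable {g p}

/-- The trajectory `t ↦ e^{tX} κ(ζ)` of `X` at fiber infinity. -/
def RescaledFlow.trajectory (φ : RescaledFlow g p) (ζ : puncturedCotangent M) (t : ℝ) :
    FiberInfinity M :=
  kappa ⟨φ.toFun t ζ.1, φ.mem t ζ.1 ζ.2⟩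

variable (p) in
/-- The vector field `X = κ_*(|ξ| H_p)` vanishes at `κ(ζ)`: `H_p` is a multiple of `ξ ∂_ξ`. -/
def IsFixedAtInfinity (ζ : Cotangent M) : Prop :=
  ∃ a : ℝ, hamiltonianField p ζ = a • radialField ζ

/-- `C ⊆ Σ(w) = κ(p⁻¹(w))` is a closed trajectory of `X`, and `m` is the multiplier of a return
map. That is: `C` is the trajectory of some `κ(ζ)`, which is not a fixed point of `X` and which has
a (not necessarily minimal) period `T`, so that `e^{T|ξ|H_p} ζ = s ζ` for some `s > 0`; and the
linearization of `e^{TX}` at `κ(ζ)` acts as multiplication by `m` on the line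
`T_{κ(ζ)} Σ(w) / ℝ X`. The latter is computed upstairs: `κ` identifies this line with
`ker dp(ζ) / span(ξ ∂_ξ, H_p)`, and `e^{TX}` lifts to the map `ζ' ↦ s⁻¹ e^{T|ξ|H_p} ζ'`, which
fixes `ζ`. -/
def RescaledFlow.IsClosedTrajectory (φ : RescaledFlow g p) (w : ℝ) (C : Set (FiberInfinity M))
    (m : ℝ) : Prop :=
  ∃ (ζ : puncturedCotangent M) (T s : ℝ) (A : Plane × DualPlane →L[ℝ] Plane × DualPlane),
    p ζ.1 = w ∧ ¬ IsFixedAtInfinity p ζ.1 ∧ 0 < T ∧ 0 < s ∧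
    φ.toFun T ζ.1 = dilate s ζ.1 ∧ C = range (φ.trajectory ζ) ∧
    HasMFDerivAt cotangentModel cotangentModel (fun ζ' => dilate s⁻¹ (φ.toFun T ζ')) ζ.1 A ∧
    ∀ v : Plane × DualPlane, cotangentDiff p ζ.1 v = 0 →
      ∃ a b : ℝ, A v = m • v + a • radialField ζ.1 + b • hamiltonianField p ζ.1

/-- `C` is a hyperbolic closed trajectory of `X` on `Σ(w)`. -/
def RescaledFlow.IsHyperbolicCycle (φ : RescaledFlow g p) (w : ℝ)
    (C : Set (FiberInfinity M)) : Prop :=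
  ∃ m : ℝ, |m| ≠ 1 ∧ φ.IsClosedTrajectory w C m

variable (g p) in
/-- The flow of `X` on `Σ(w)` is a Morse-Smale flow without fixed points: there are no fixed
points, there are finitely many hyperbolic cycles, and every other trajectory has one of them as
its `α`-limit set and one as its `ω`-limit set. (The conditions on fixed points and saddle
connections are void.) -/
def IsMorseSmaleWithoutFixedPoints (w : ℝ) : Prop :=
  (∀ ζ ∈ puncturedCotangent M, p ζ = w → ¬ IsFixedAtInfinity p ζ) ∧
  ∃ φ : RescaledFlow g p,
    {C | φ.IsHyperbolicCycle w C}.Finite ∧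
    ∀ ζ : puncturedCotangent M, p ζ.1 = w →
      φ.IsHyperbolicCycle w (range (φ.trajectory ζ)) ∨
      (φ.IsHyperbolicCycle w {z | MapClusterPt z atBot (φ.trajectory ζ)} ∧
        φ.IsHyperbolicCycle w {z | MapClusterPt z atTop (φ.trajectory ζ)})

variable (g p)

/-- `L⁺_w ⊆ Σ(w)`: the union of the attractive hyperbolic cycles. -/
def attractingSet (w : ℝ) : Set (FiberInfinity M) :=
  {z | ∃ (φ : RescaledFlow g p) (C : Set (FiberInfinity M)) (m : ℝ),
    |m| < 1 ∧ φ.IsClosedTrajectory w C m ∧ z ∈ C}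

/-- `L⁻_w ⊆ Σ(w)`: the union of the repulsive hyperbolic cycles. -/
def repellingSet (w : ℝ) : Set (FiberInfinity M) :=
  {z | ∃ (φ : RescaledFlow g p) (C : Set (FiberInfinity M)) (m : ℝ),
    1 < |m| ∧ φ.IsClosedTrajectory w C m ∧ z ∈ C}

/-- `Λ⁺ = ⋃_{|w| < 2δ} κ⁻¹(L⁺_w)`. -/
def lambdaPlus (δ : ℝ) : Set (Cotangent M) :=
  {ζ | ∃ w : ℝ, |w| < 2 * δ ∧ ∃ hζ : ζ ∈ puncturedCotangent M, kappa ⟨ζ, hζ⟩ ∈ attractingSet g p w}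

/-- `Λ⁻ = ⋃_{|w| < 2δ} κ⁻¹(L⁻_w)`. -/
def lambdaMinus (δ : ℝ) : Set (Cotangent M) :=
  {ζ | ∃ w : ℝ, |w| < 2 * δ ∧ ∃ hζ : ζ ∈ puncturedCotangent M, kappa ⟨ζ, hζ⟩ ∈ repellingSet g p w}

end CotangentBundle

end

/-!
The proof rests on the Liouville form `α = ξ dx`, that is, `v ↦ ζ.2 v.1`, whose exterior derivative
is the symplectic form and for which `ω(ξ∂_ξ, v) = α(v)`.

*The function `Φ`.* If `Λ` is a conic hypersurface to which `H_p` is tangent, then the plane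
`ker dp ∩ TΛ` is Lagrangian: it is its own symplectic complement, hence it is the span of `H_p` and
`H_G`, and it contains `ξ∂_ξ` (`IsLagrangianFamily.exists_radialField_eq`). Pairing
`ξ∂_ξ = Φ H_p + Θ H_G` with a vector `v` tangent to `Λ` gives `α(v) = -Φ dp(v)`
(`IsPhi.liouville_eq`), which determines `Φ`, since `dp ≠ 0` on `TΛ`. For the velocity `v` of the
curve `w ↦ (∂_ξ F(w, ξ), ξ)` in `Λ` one has `dp(v) = 1`, and by Euler's identity `α(v)` is the
derivative of `⟨ξ, ∂_ξ F(w, ξ)⟩ = F(w, ξ)`; this is the formula for `∂_w F`.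

*The sign of `Φ`.* Let `φ_t` be the flow of `|ξ| H_p`. As `α(H_p) = 0`, Cartan's formula gives
`φ_t^* α = α - (∫₀ᵗ |φ_τ(ζ)| dτ) dp` (`RescaledFlow.liouville_flowDeriv`). So `φ_t` preserves `α` on
`ker dp`, and a closed trajectory of `X` with `φ_T(ζ) = s ζ` has the multiplier `1/s`
(`RescaledFlow.multiplier_eq`). Hence `Λ⁺` and `Λ⁻` consist of the points with `φ_T(ζ) = s ζ` for
some `s > 1` and some `T` of the sign `±` (`RescaledFlow.returnSet`). The same formula gives
`Φ(φ_t(ζ)) = Φ(ζ) + ∫₀ᵗ |φ_τ(ζ)| dτ`, and `Φ(s ζ) = s Φ(ζ)`; thus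
`(s - 1) Φ(ζ) = ∫₀ᵀ |φ_τ(ζ)| dτ`, which has the sign of `T` (`IsPhi.pos_of_isReturning`). Applied
to `φ_{∓1}(ζ)`, positivity improves to `±Φ(ζ) ≥ ∫ |φ_τ(ζ)| dτ` over an interval of length one, and
compactness of `M` bounds this from below by `c |ζ|` (`IsPhi.exists_le`).

*`Λ^±` is a hypersurface.* The flow and the dilations form an action of `ℝ²`. In a slice
transversal to its orbits, with the derivatives of the two slice coordinates equal to `dp` and `α`,
the return map of a point with `φ_T(ζ) = s ζ` preserves the levels of `p` and has the derivative
`1/s < 1` along them. So it contracts each nearby level, and its fixed points are the zeros of one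
function with a nonzero differential (`exists_fixedPoint_of_level_contraction`). A point of the
slice that returns at some other time is fixed as well: its iterates converge to a fixed point and
stay in its orbit, which is closed in `T*M ∖ 0`
(`RescaledFlow.IsSliceCoordinates.eventually_isReturning_iff`). Since `1/s ≠ 1`, the tangent space
of the fixed point set contains a vector with `dp ≠ 0`.

The smooth dependence of the flow on its initial point is derived from the implicit function theorem
in a space of continuous curves (`exists_contDiffAt_rescaled_solution`).
-/

/-! ### Substitution operators on continuous functions -/

section SubstitutionOperator

universe u

variable {K : Type*} [TopologicalSpace K] [CompactSpace K]
  {E F : Type u} {G : Type*} [NormedAddCommGroup E] [NormedSpace ℝ E] [NormedAddCommGroup F]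
  [NormedSpace ℝ F] [NormedAddCommGroup G] [NormedSpace ℝ G]

/-- A bounded bilinear map, applied pointwise to continuous functions on a compact space. -/
noncomputable def ContinuousMap.bilinearComp (K : Type*) [TopologicalSpace K] [CompactSpace K]
    (B : G →L[ℝ] E →L[ℝ] F) : C(K, G) →L[ℝ] C(K, E) →L[ℝ] C(K, F) :=
  LinearMap.mkContinuous₂
    (LinearMap.mk₂ ℝ (fun (A : C(K, G)) (h : C(K, E)) =>
        (⟨fun x => B (A x) (h x), (B.continuous.comp A.continuous).clm_apply h.continuous⟩ :
          C(K, F)))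
      (fun _ _ _ => by ext; simp) (fun _ _ _ => by ext; simp)
      (fun _ _ _ => by ext; simp) (fun _ _ _ => by ext; simp)) ‖B‖
    (fun A h => by
      refine (ContinuousMap.norm_le _ (by positivity)).2 fun x => ?_
      refine (B.le_opNorm₂ _ _).trans ?_
      gcongr
      · exact A.norm_coe_le_norm x
      · exact h.norm_coe_le_norm x)

/-- The substitution operator `γ ↦ f ∘ γ` of a `C¹` function is differentiable in the uniform
norm. The derivative of `f` is given as `B ∘ f'`. -/
theorem hasFDerivAt_continuousMap_comp (f : C(E, F)) (f' : C(E, G)) (B : G →L[ℝ] E →L[ℝ] F)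
    (hf : ∀ x, HasFDerivAt f (B (f' x)) x) (γ : C(K, E)) :
    HasFDerivAt (fun γ : C(K, E) => f.comp γ) (ContinuousMap.bilinearComp K B (f'.comp γ)) γ := by
  rw [hasFDerivAt_iff_isLittleO_nhds_zero, Asymptotics.isLittleO_iff]
  intro c hc
  have hcont : Continuous (fun η : C(K, E) => f'.comp η) := f'.continuous_postcomp
  have hB : 0 < c / (‖B‖ + 1) := by positivity
  obtain ⟨δ, hδ, hball⟩ := Metric.continuousAt_iff.1 (hcont.continuousAt (x := γ)) _ hB
  filter_upwards [Metric.ball_mem_nhds (0 : C(K, E)) hδ] with h hh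
  rw [mem_ball_zero_iff] at hh
  refine (ContinuousMap.norm_le _ (by positivity)).2 fun x => ?_
  have key : ‖f (γ x + h x) - f (γ x) - B (f' (γ x)) (γ x + h x - γ x)‖
      ≤ c * ‖γ x + h x - γ x‖ := by
    refine (convex_segment (γ x) (γ x + h x)).norm_image_sub_le_of_norm_hasFDerivWithin_le'
      (f := f) (f' := fun y => B (f' y)) (fun y _ => (hf y).hasFDerivWithinAt) (fun y hy => ?_)
      (left_mem_segment _ _ _) (right_mem_segment _ _ _)
    rw [segment_eq_image'] at hy
    obtain ⟨θ, hθ, rfl⟩ := hy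
    have h1 : dist (γ + θ • h) γ < δ := by
      rw [dist_eq_norm, add_sub_cancel_left, norm_smul, Real.norm_of_nonneg hθ.1]
      exact (mul_le_of_le_one_left (norm_nonneg _) hθ.2).trans_lt hh
    have h2 := (ContinuousMap.dist_apply_le_dist x).trans (hball h1).le
    rw [dist_eq_norm] at h2
    have h3 : ‖f' (γ x + θ • (γ x + h x - γ x)) - f' (γ x)‖ ≤ c / (‖B‖ + 1) := by simpa using h2
    rw [← map_sub]
    calc _ ≤ ‖B‖ * (c / (‖B‖ + 1)) := B.le_of_opNorm_le_of_le le_rfl h3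
      _ ≤ (‖B‖ + 1) * (c / (‖B‖ + 1)) := by gcongr; simp
      _ = c := by field_simp
  simp only [add_sub_cancel_left] at key
  refine key.trans ?_
  exact mul_le_mul_of_nonneg_left (h.norm_coe_le_norm x) hc.le

theorem contDiff_bilinearComp (B : G →L[ℝ] E →L[ℝ] F) {n : WithTop ℕ∞} {g : C(K, E) → C(K, G)}
    (hg : ContDiff ℝ n g) : ContDiff ℝ n (fun γ => ContinuousMap.bilinearComp K B (g γ)) :=
  (ContinuousMap.bilinearComp K B).contDiff.comp hg

set_option synthInstance.maxHeartbeats 200000 in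
/-- The substitution operator `γ ↦ f ∘ γ` of a smooth function is smooth in the uniform norm. -/
theorem contDiff_continuousMap_comp (f : C(E, F)) (hf : ContDiff ℝ ∞ f) :
    ContDiff ℝ ∞ (fun γ : C(K, E) => f.comp γ) := by
  rw [contDiff_infty]
  intro n
  -- Induction on the order: the derivative is the substitution operator of `fderiv ℝ f`, composed
  -- with a bounded linear map. The codomain changes in each step.
  induction n generalizing F with
  | zero => exact contDiff_zero.2 f.continuous_postcomp
  | succ n ih =>
    have hd : ContDiff ℝ ∞ (fderiv ℝ f) := hf.fderiv_right (by simp)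
    let f' : C(E, E →L[ℝ] F) := ⟨fderiv ℝ f, hd.continuous⟩
    have hder := hasFDerivAt_continuousMap_comp (K := K) f f' (ContinuousLinearMap.id ℝ _)
      (fun x => (hf.differentiable (by simp) x).hasFDerivAt)
    push_cast
    refine contDiff_succ_iff_hasFDerivAt.2 ⟨_, ?_, hder⟩
    exact contDiff_bilinearComp _ (ih f' hd)

end SubstitutionOperator

/-! ### Smooth dependence of solutions on initial data -/

section LocalFlow

/-- The primitive `s ↦ ∫ σ in 0..s, γ σ` of a continuous curve on `[-2, 2]`. -/
noncomputable def curvePrimitive (E : Type*) [NormedAddCommGroup E] [NormedSpace ℝ E] :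
    C(Icc (-2 : ℝ) 2, E) →L[ℝ] C(Icc (-2 : ℝ) 2, E) :=
  have h2 : (-2 : ℝ) ≤ 2 := by norm_num
  have hint (γ : C(Icc (-2 : ℝ) 2, E)) (a b : ℝ) :
      IntervalIntegrable (fun σ => γ (projIcc (-2) 2 h2 σ)) MeasureTheory.volume a b :=
    (γ.continuous.comp continuous_projIcc).intervalIntegrable _ _
  LinearMap.mkContinuous
    { toFun := fun γ => ⟨fun s => ∫ σ in (0 : ℝ)..s, γ (projIcc (-2) 2 h2 σ),
        (intervalIntegral.continuous_primitive (hint γ) 0).comp continuous_subtype_val⟩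
      map_add' := fun γ η => by
        ext s
        exact intervalIntegral.integral_add (hint γ _ _) (hint η _ _)
      map_smul' := fun c γ => by
        ext s
        exact intervalIntegral.integral_smul _ _ } 2
    (fun γ => by
      refine (ContinuousMap.norm_le _ (by positivity)).2 fun s => ?_
      have := intervalIntegral.norm_integral_le_of_norm_le_const (a := 0) (b := (s : ℝ))
        (fun σ _ => γ.norm_coe_le_norm (projIcc (-2) 2 h2 σ))
      refine this.trans ?_
      rw [mul_comm, sub_zero]
      exact mul_le_mul_of_nonneg_right (abs_le.2 ⟨s.2.1, s.2.2⟩) (norm_nonneg _))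

theorem curvePrimitive_apply {E : Type*} [NormedAddCommGroup E] [NormedSpace ℝ E]
    (γ : C(Icc (-2 : ℝ) 2, E)) (s : Icc (-2 : ℝ) 2) :
    curvePrimitive E γ s = ∫ σ in (0 : ℝ)..s, γ (projIcc (-2) 2 (by norm_num) σ) := rfl

/-- Smooth dependence on initial data, in the rescaled form `γ' = t f(γ)`: for small `t` the
solutions exist on a fixed interval and depend smoothly on `(t, γ 0)`, by the implicit function
theorem in the space of continuous curves. -/
theorem exists_contDiffAt_rescaled_solution {E : Type*} [NormedAddCommGroup E] [NormedSpace ℝ E]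
    [CompleteSpace E] [HasContDiffBump E] {f : E → E} {z₀ : E}
    (hf : ∀ᶠ z in 𝓝 z₀, ContDiffAt ℝ ∞ f z) {W : Set E} (hW : W ∈ 𝓝 z₀) :
    ∃ Γ : ℝ × E → ℝ → E, ContDiffAt ℝ ∞ (fun q => Γ q 1) (0, z₀) ∧
      ∀ᶠ q in 𝓝 ((0 : ℝ), z₀), Γ q 0 = q.2 ∧
        ∀ s ∈ Ioo (-2 : ℝ) 2, Γ q s ∈ W ∧ HasDerivAt (Γ q) (q.1 • f (Γ q s)) s := by
  -- Cut the field off outside of a ball `B(z₀, r)` in `W` where it is smooth.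
  obtain ⟨r, hr, hball⟩ := Metric.eventually_nhds_iff_ball.1 (hf.and (eventually_mem_set.2 hW))
  let χ : ContDiffBump z₀ := ⟨r / 3, r / 2, by positivity, by linarith⟩
  let h : E → E := fun z => χ z • f z
  have hh : ContDiff ℝ ∞ h := by
    rw [contDiff_iff_contDiffAt]
    intro z
    by_cases hz : z ∈ Metric.ball z₀ r
    · exact χ.contDiffAt.smul (hball z hz).1
    · have : h =ᶠ[𝓝 z] fun _ => 0 := by
        have hz' : z ∈ (Metric.closedBall z₀ (r / 2))ᶜ := by
          simp only [mem_compl_iff, Metric.mem_closedBall, not_le]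
          simp only [Metric.mem_ball, not_lt] at hz
          linarith
        filter_upwards [Metric.isClosed_closedBall.isOpen_compl.mem_nhds hz'] with y hy
        have : χ y = 0 := χ.zero_of_le_dist
          (not_le.1 (fun hle => hy (Metric.mem_closedBall.2 hle))).le
        simp [h, this]
      exact contDiffAt_const.congr_of_eventuallyEq this
  let hc : C(E, E) := ⟨h, hh.continuous⟩
  let X := C(Icc (-2 : ℝ) 2, E)
  let cst : E →L[ℝ] X := ContinuousLinearMap.const ℝ (Icc (-2 : ℝ) 2)
  let 𝓕 : (ℝ × E) × X → X := fun u => u.2 - cst u.1.2 - u.1.1 • curvePrimitive E (hc.comp u.2)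
  have hsub : ContDiff ℝ ∞ (fun γ : X => curvePrimitive E (hc.comp γ)) :=
    (curvePrimitive E).contDiff.comp (contDiff_continuousMap_comp hc hh)
  have h𝓕 : ContDiff ℝ ∞ 𝓕 :=
    (contDiff_snd.sub (cst.contDiff.comp (contDiff_snd.comp contDiff_fst))).sub
      ((contDiff_fst.comp contDiff_fst).smul (hsub.comp contDiff_snd))
  let u₀ : (ℝ × E) × X := ((0, z₀), cst z₀)
  have hu₀ : 𝓕 u₀ = 0 := by simp [𝓕, u₀]
  have hpart : fderiv ℝ 𝓕 u₀ ∘L .inr ℝ (ℝ × E) X = ContinuousLinearMap.id ℝ X := by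
    have h1 : HasFDerivAt (fun γ : X => 𝓕 (u₀.1, γ)) (fderiv ℝ 𝓕 u₀ ∘L .inr ℝ (ℝ × E) X) u₀.2 :=
      HasFDerivAt.comp (g := 𝓕) u₀.2 (h𝓕.differentiable (by simp) u₀).hasFDerivAt
        (hasFDerivAt_prodMk_right _ _)
    have h2 : HasFDerivAt (fun γ : X => 𝓕 (u₀.1, γ)) (ContinuousLinearMap.id ℝ X) u₀.2 := by
      have : (fun γ : X => 𝓕 (u₀.1, γ)) = fun γ => γ - cst z₀ := by
        funext γ
        simp [𝓕, u₀]
      rw [this]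
      exact (hasFDerivAt_id _).sub_const _
    exact h1.unique h2
  have hinv : (fderiv ℝ 𝓕 u₀ ∘L .inr ℝ (ℝ × E) X).IsInvertible := by
    rw [hpart]
    exact ⟨ContinuousLinearEquiv.refl ℝ X, rfl⟩
  have hat : ContDiffAt ℝ ∞ 𝓕 u₀ := h𝓕.contDiffAt
  have hn : (∞ : WithTop ℕ∞) ≠ 0 := by simp
  let ψ := hat.implicitFunction hn hinv
  have hψ : ContDiffAt ℝ ∞ ψ (0, z₀) := hat.contDiffAt_implicitFunction hn hinv
  have hψ₀ : ψ (0, z₀) = cst z₀ := hat.implicitFunction_apply_self hn hinv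
  have hψF : ∀ᶠ q in 𝓝 ((0 : ℝ), z₀), 𝓕 (q, ψ q) = 0 := by
    rw [← hu₀]
    exact hat.eventually_apply_implicitFunction hn hinv
  have hψr : ∀ᶠ q in 𝓝 ((0 : ℝ), z₀), dist (ψ q) (cst z₀) < r / 3 := by
    rw [← hψ₀]
    exact Metric.tendsto_nhds.1 hψ.continuousAt _ (by positivity)
  have hle : (-2 : ℝ) ≤ 2 := by norm_num
  let Γ : ℝ × E → ℝ → E := fun q s => q.2 + q.1 • ∫ σ in (0 : ℝ)..s, h (ψ q (projIcc (-2) 2 hle σ))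
  have hΓ (q : ℝ × E) (hq : 𝓕 (q, ψ q) = 0) (s : Icc (-2 : ℝ) 2) : Γ q s = ψ q s := by
    have h1 := congrArg (fun γ : X => γ s) hq
    have h2 : ψ q s - q.2 - q.1 • curvePrimitive E (hc.comp (ψ q)) s = 0 := h1
    rw [curvePrimitive_apply, sub_sub, sub_eq_zero] at h2
    exact h2.symm
  refine ⟨Γ, ?_, ?_⟩
  · have h1 : ContDiffAt ℝ ∞ (fun q => ψ q ⟨1, by norm_num⟩) (0, z₀) :=
      (ContinuousMap.evalCLM (M := E) ℝ
        (⟨1, by norm_num⟩ : Icc (-2 : ℝ) 2)).contDiff.contDiffAt.comp (0, z₀) hψ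
    refine h1.congr_of_eventuallyEq ?_
    filter_upwards [hψF] with q hq
    exact hΓ q hq ⟨1, by norm_num⟩
  · filter_upwards [hψF, hψr] with q hq hqr
    refine ⟨by simp [Γ], fun s hs => ?_⟩
    have hs' : s ∈ Icc (-2 : ℝ) 2 := Ioo_subset_Icc_self hs
    have hmem : Γ q s ∈ Metric.ball z₀ (r / 3) := by
      rw [show Γ q s = ψ q ⟨s, hs'⟩ from hΓ q hq ⟨s, hs'⟩]
      exact (ContinuousMap.dist_apply_le_dist (f := ψ q) (g := cst z₀) ⟨s, hs'⟩).trans_lt hqr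
    refine ⟨(hball _ (Metric.ball_subset_ball (by linarith) hmem)).2, ?_⟩
    have hcut : h (Γ q s) = f (Γ q s) := by
      have : χ (Γ q s) = 1 := χ.one_of_mem_closedBall (Metric.ball_subset_closedBall hmem)
      simp [h, this]
    have hcont : Continuous fun σ => h (ψ q (projIcc (-2) 2 hle σ)) :=
      hh.continuous.comp ((ψ q).continuous.comp continuous_projIcc)
    have hder := (intervalIntegral.integral_hasDerivAt_right (hcont.intervalIntegrable 0 s)
      (hcont.stronglyMeasurableAtFilter _ _) hcont.continuousAt).const_smul q.1
    have heq : ψ q (projIcc (-2) 2 hle s) = Γ q s := by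
      rw [projIcc_of_mem hle hs']
      exact (hΓ q hq ⟨s, hs'⟩).symm
    rw [heq, hcut] at hder
    exact hder.const_add q.2

end LocalFlow

/-! ### Flows of vector fields on manifolds -/

section ManifoldFlow

variable {E : Type*} [NormedAddCommGroup E] [NormedSpace ℝ E] [FiniteDimensional ℝ E]
  {H : Type*} [TopologicalSpace H] {I : ModelWithCorners ℝ E H} [I.Boundaryless]
  {X : Type*} [TopologicalSpace X] [ChartedSpace H X] [IsManifold I ∞ X]
  {v : ∀ x : X, TangentSpace I x} {N : Set X} {φ : ℝ → X → X}

theorem TangentBundle.trivializationAt_snd {x₀ x : X} (hx : x ∈ (chartAt H x₀).source)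
    (w : TangentSpace I x) :
    (trivializationAt E (TangentSpace I) x₀ ⟨x, w⟩).2 =
      mfderiv I 𝓘(ℝ, E) (extChartAt I x₀) x w := by
  have h1 : (trivializationAt E (TangentSpace I) x₀).continuousLinearMapAt ℝ x w =
      (trivializationAt E (TangentSpace I) x₀ ⟨x, w⟩).2 := by
    rw [Trivialization.continuousLinearMapAt_apply, Trivialization.linearMapAt_apply,
      if_pos (by rwa [TangentBundle.trivializationAt_baseSet])]
  exact h1.symm.trans (congrArg (fun A : TangentSpace I x →L[ℝ] E => A w)
    (TangentBundle.continuousLinearMapAt_trivializationAt hx))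

/-- Uniqueness of integral curves of a vector field which is `C¹` along one of them. -/
theorem IsMIntegralCurveOn.eqOn_Ioo [T2Space X] {γ γ' : ℝ → X} {a b t₀ : ℝ} (ht₀ : t₀ ∈ Ioo a b)
    (hv : ∀ t ∈ Ioo a b, ContMDiffAt I I.tangent 1 (fun x => (⟨x, v x⟩ : TangentBundle I X)) (γ t))
    (hγ : IsMIntegralCurveOn γ v (Ioo a b)) (hγ' : IsMIntegralCurveOn γ' v (Ioo a b))
    (h : γ t₀ = γ' t₀) : EqOn γ γ' (Ioo a b) := by
  set s := {t | γ t = γ' t} ∩ Ioo a b with hs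
  suffices hsub : Ioo a b ⊆ s from fun t ht => (hsub ht).1
  refine isPreconnected_Ioo.subset_of_closure_inter_subset (s := Ioo a b) (u := s) ?_
    ⟨t₀, ht₀, h, ht₀⟩ ?_
  · rw [isOpen_iff_mem_nhds]
    intro t₁ ht₁
    have hmem := Ioo_mem_nhds ht₁.2.1 ht₁.2.2
    have heq : γ =ᶠ[𝓝 t₁] γ' := isMIntegralCurveAt_eventuallyEq_of_contMDiffAt_boundaryless
      (hv _ ht₁.2) (hγ.isMIntegralCurveAt hmem) (hγ'.isMIntegralCurveAt hmem) ht₁.1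
    filter_upwards [heq, hmem] with t h1 h2 using ⟨h1, h2⟩
  · rintro t ⟨htc, ht⟩
    refine ⟨?_, ht⟩
    have hmem := Ioo_mem_nhds ht.1 ht.2
    have : (𝓝[s] t).NeBot := mem_closure_iff_nhdsWithin_neBot.1 htc
    have h1 : Tendsto γ (𝓝[s] t) (𝓝 (γ t)) :=
      ((hγ.isMIntegralCurveAt hmem).continuousAt.tendsto).mono_left nhdsWithin_le_nhds
    have h2 : Tendsto γ' (𝓝[s] t) (𝓝 (γ' t)) :=
      ((hγ'.isMIntegralCurveAt hmem).continuousAt.tendsto).mono_left nhdsWithin_le_nhds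
    refine tendsto_nhds_unique h1 (h2.congr' ?_)
    filter_upwards [self_mem_nhdsWithin] with u hu using hu.1.symm

variable (v N φ) in
/-- `φ` is a (complete) flow of the vector field `v` on the set `N`. -/
structure IsFlowOn : Prop where
  mem : ∀ t, ∀ x ∈ N, φ t x ∈ N
  zero : ∀ x ∈ N, φ 0 x = x
  integral : ∀ x ∈ N, IsMIntegralCurve (fun t => φ t x) v

variable [T2Space X]

theorem IsMIntegralCurve.eq_of_mem (hN : IsOpen N)
    (hv : ContMDiffOn I I.tangent ∞ (fun x => (⟨x, v x⟩ : TangentBundle I X)) N)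
    {γ γ' : ℝ → X} (hγ : IsMIntegralCurve γ v)
    (hγ' : IsMIntegralCurve γ' v) (hmem : ∀ t, γ t ∈ N) (h : γ 0 = γ' 0) : γ = γ' := by
  funext t
  have ht : t ∈ Ioo (-(|t| + 1)) (|t| + 1) := by
    exact abs_lt.1 (by linarith)
  refine IsMIntegralCurveOn.eqOn_Ioo (t₀ := 0) ⟨?_, ?_⟩ (fun s _ => ?_)
    (hγ.isMIntegralCurveOn _) (hγ'.isMIntegralCurveOn _) h ht
  · linarith [abs_nonneg t]
  · linarith [abs_nonneg t]
  · exact ((hv _ (hmem s)).contMDiffAt (hN.mem_nhds (hmem s))).of_le (by simp)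

theorem IsFlowOn.add (h : IsFlowOn v N φ) (hN : IsOpen N)
    (hv : ContMDiffOn I I.tangent ∞ (fun x => (⟨x, v x⟩ : TangentBundle I X)) N)
    (s t : ℝ) {x : X} (hx : x ∈ N) :
    φ (s + t) x = φ s (φ t x) := by
  have h1 : IsMIntegralCurve (fun u => φ (u + t) x) v := (h.integral x hx).comp_add t
  have h2 := IsMIntegralCurve.eq_of_mem hN hv h1 (h.integral _ (h.mem t x hx))
    (fun u => h.mem _ x hx) (by simp [h.zero _ (h.mem t x hx)])
  exact congrFun h2 s

/-- The flow of a smooth vector field is smooth near time `0`. -/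
theorem IsFlowOn.contMDiffAt_zero (h : IsFlowOn v N φ) (hN : IsOpen N)
    (hv : ContMDiffOn I I.tangent ∞ (fun x => (⟨x, v x⟩ : TangentBundle I X)) N)
    {x₀ : X} (hx₀ : x₀ ∈ N) :
    ContMDiffAt (𝓘(ℝ, ℝ).prod I) I ∞ (fun q : ℝ × X => φ q.1 q.2) (0, x₀) := by
  set c := extChartAt I x₀ with hc
  set e := trivializationAt E (TangentSpace I) x₀ with he
  -- the vector field in the chart at `x₀`
  let f : E → E := fun z => (e ⟨c.symm z, v (c.symm z)⟩).2
  have hct : IsOpen c.target := isOpen_extChartAt_target x₀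
  have hcs : ContinuousOn c.symm c.target := continuousOn_extChartAt_symm x₀
  have hW : IsOpen (c.target ∩ c.symm ⁻¹' N) := hcs.isOpen_inter_preimage hct hN
  have hz₀ : c x₀ ∈ c.target ∩ c.symm ⁻¹' N := by
    refine ⟨mem_extChartAt_target x₀, ?_⟩
    rw [mem_preimage, hc, extChartAt_to_inv]
    exact hx₀
  have hf : ∀ z ∈ c.target ∩ c.symm ⁻¹' N, ContDiffAt ℝ ∞ f z := by
    rintro z ⟨hz, hzN⟩
    have h1 : ContMDiffAt I 𝓘(ℝ, E) ∞ (fun x => (e ⟨x, v x⟩).2) (c.symm z) := by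
      have hb : c.symm z ∈ e.baseSet := by
        rw [he, TangentBundle.trivializationAt_baseSet, ← extChartAt_source I]
        exact c.map_target hz
      exact (e.contMDiffAt_section_iff hb).1 ((hv _ hzN).contMDiffAt (hN.mem_nhds hzN))
    have h2 : ContMDiffAt 𝓘(ℝ, E) I ∞ c.symm z :=
      (contMDiffOn_extChartAt_symm x₀).contMDiffAt (hct.mem_nhds hz)
    exact (h1.comp z h2).contDiffAt
  obtain ⟨Γ, hΓ₁, hΓ⟩ := exists_contDiffAt_rescaled_solution (z₀ := c x₀) (f := f)
    (eventually_of_mem (hW.mem_nhds hz₀) hf) (hW.mem_nhds hz₀)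
  have hcx : ContMDiffAt I 𝓘(ℝ, E) ∞ c x₀ := contMDiffAt_extChartAt
  have hcq : ContMDiffAt (𝓘(ℝ, ℝ).prod I) 𝓘(ℝ, ℝ × E) ∞ (fun q : ℝ × X => (q.1, c q.2))
      (0, x₀) :=
    contMDiffAt_fst.prodMk_space (hcx.comp (0, x₀) contMDiffAt_snd)
  have hsrc : ∀ᶠ q : ℝ × X in 𝓝 (0, x₀), q.2 ∈ c.source ∩ N :=
    continuousAt_snd.eventually (((isOpen_extChartAt_source x₀).inter hN).mem_nhds
      ⟨mem_extChartAt_source x₀, hx₀⟩)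
  have heq : ∀ᶠ q : ℝ × X in 𝓝 (0, x₀), φ q.1 q.2 = c.symm (Γ (q.1, c q.2) 1) := by
    filter_upwards [hcq.continuousAt.eventually hΓ, hsrc]
    rintro ⟨t, x⟩ ⟨h0, hs⟩ ⟨hxs, hxN⟩
    simp only at h0 hs hxs hxN ⊢
    have hγ : IsMIntegralCurveOn (fun s => c.symm (Γ (t, c x) s)) (t • v) (Ioo (-2) 2) := by
      intro s hs'
      obtain ⟨⟨hzt, hzN⟩, hder⟩ := hs s hs'
      set z := Γ (t, c x) s with hz
      have hm : MDifferentiableAt 𝓘(ℝ, E) I c.symm z :=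
        ((contMDiffOn_extChartAt_symm (n := ∞) x₀).contMDiffAt
          (hct.mem_nhds hzt)).mdifferentiableAt (by simp)
      have hz' : c.symm z ∈ (chartAt H x₀).source := by
        rw [← extChartAt_source I]
        exact c.map_target hzt
      have hfz : mfderiv 𝓘(ℝ, E) I c.symm z (f z) = v (c.symm z) := by
        have h1 : f z = mfderiv I 𝓘(ℝ, E) c (c.symm z) (v (c.symm z)) :=
          TangentBundle.trivializationAt_snd hz' _
        have h2 := mfderivWithin_extChartAt_symm_comp_mfderiv_extChartAt (I := I) hzt
        rw [I.range_eq_univ, mfderivWithin_univ] at h2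
        rw [h1]
        exact congrArg (fun A : TangentSpace I (c.symm z) →L[ℝ] TangentSpace I (c.symm z) =>
          A (v (c.symm z))) h2
      have h3 := hm.hasMFDerivAt.comp s hder.hasFDerivAt.hasMFDerivAt
      refine HasMFDerivAt.hasMFDerivWithinAt (h3.congr_mfderiv ?_)
      ext
      change mfderiv 𝓘(ℝ, E) I c.symm z ((1 : ℝ) • (t • f z)) = (1 : ℝ) • (t • v (c.symm z))
      rw [one_smul, one_smul, ← hfz]
      exact (mfderiv 𝓘(ℝ, E) I c.symm z).map_smul t (f z)
    have hφ : IsMIntegralCurveOn (fun s => φ (s * t) x) (t • v) (Ioo (-2) 2) :=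
      ((h.integral x hxN).comp_mul t).isMIntegralCurveOn _
    have hvt : ∀ s ∈ Ioo (-2 : ℝ) 2, ContMDiffAt I I.tangent 1
        (fun x => (⟨x, (t • v) x⟩ : TangentBundle I X)) (c.symm (Γ (t, c x) s)) := by
      intro s hs'
      have hzN := (hs s hs').1.2
      exact ((contMDiffAt_const (c := t)).smul_section
        ((hv _ hzN).contMDiffAt (hN.mem_nhds hzN))).of_le (by simp)
    have := IsMIntegralCurveOn.eqOn_Ioo (t₀ := 0) (by norm_num) hvt hγ hφ
      (by simp [h0, h.zero x hxN, c.left_inv hxs]) (show (1 : ℝ) ∈ Ioo (-2 : ℝ) 2 by norm_num)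
    simpa using this.symm
  refine ContMDiffAt.congr_of_eventuallyEq ?_ heq
  have hΓ₀ : Γ (0, c x₀) 1 ∈ c.target := (hΓ.self_of_nhds.2 1 (by norm_num)).1.1
  have hcΓ : ContMDiffAt 𝓘(ℝ, E) I ∞ c.symm (Γ (0, c x₀) 1) :=
    (contMDiffOn_extChartAt_symm x₀).contMDiffAt (hct.mem_nhds hΓ₀)
  exact hcΓ.comp (0, x₀) (ContMDiffAt.comp (g := fun q => Γ q 1) (0, x₀) hΓ₁.contMDiffAt hcq)

/-- The time `t` map of the flow of a smooth vector field is smooth. -/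
theorem IsFlowOn.contMDiffAt_time (h : IsFlowOn v N φ) (hN : IsOpen N)
    (hv : ContMDiffOn I I.tangent ∞ (fun x => (⟨x, v x⟩ : TangentBundle I X)) N)
    {x₀ : X} (hx₀ : x₀ ∈ N) (t : ℝ) : ContMDiffAt I I ∞ (φ t) x₀ := by
  rw [contMDiffAt_infty]
  intro n
  -- The set of good times is open and closed.
  have hloc (s : ℝ) : ∀ᶠ q : ℝ × ℝ in 𝓝 (s, s), ContMDiffAt I I n (φ (q.2 - q.1)) (φ q.1 x₀) := by
    have h1 := (contMDiffAt_iff_contMDiffAt_nhds (by simp)).1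
      (contMDiffAt_infty.1 (h.contMDiffAt_zero hN hv (h.mem s x₀ hx₀)) n)
    have h2 : Tendsto (fun q : ℝ × ℝ => (q.2 - q.1, φ q.1 x₀)) (𝓝 (s, s)) (𝓝 (0, φ s x₀)) := by
      have hc : Continuous fun q : ℝ × ℝ => (q.2 - q.1, φ q.1 x₀) :=
        (continuous_snd.sub continuous_fst).prodMk
          ((h.integral x₀ hx₀).continuous.comp continuous_fst)
      simpa using hc.tendsto (s, s)
    filter_upwards [h2.eventually h1] with q hq
    exact ContMDiffAt.comp (φ q.1 x₀) (g := fun q : ℝ × X => φ q.1 q.2)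
      (f := fun y => (q.2 - q.1, y)) hq (contMDiffAt_const.prodMk contMDiffAt_id)
  have hstep {s t : ℝ} (h1 : ContMDiffAt I I n (φ (t - s)) (φ s x₀))
      (h2 : ContMDiffAt I I n (φ s) x₀) : ContMDiffAt I I n (φ t) x₀ := by
    refine (h1.comp x₀ h2).congr_of_eventuallyEq ?_
    filter_upwards [hN.mem_nhds hx₀] with x hx
    rw [Function.comp_apply, ← h.add hN hv _ _ hx, sub_add_cancel]
  have hclopen : IsClopen {t : ℝ | ContMDiffAt I I n (φ t) x₀} := by
    have hdiag (s : ℝ) : ∃ U ∈ 𝓝 s, ∀ a ∈ U, ∀ b ∈ U, ContMDiffAt I I n (φ (b - a)) (φ a x₀) := by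
      obtain ⟨U, hU, hUs⟩ := mem_nhds_prod_iff.1 (hloc s)
      obtain ⟨V, hV, hVs⟩ := hUs
      exact ⟨U ∩ V, inter_mem hU hV, fun a ha b hb => hVs (mk_mem_prod ha.1 hb.2)⟩
    constructor
    · rw [← closure_subset_iff_isClosed]
      intro s hs
      obtain ⟨U, hU, hUs⟩ := hdiag s
      obtain ⟨r, hrU, hr⟩ := mem_closure_iff_nhds.1 hs U hU
      exact hstep (hUs r hrU s (mem_of_mem_nhds hU)) hr
    · rw [isOpen_iff_mem_nhds]
      intro s hs
      obtain ⟨U, hU, hUs⟩ := hdiag s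
      filter_upwards [hU] with r hr
      exact hstep (hUs s (mem_of_mem_nhds hU) r hr) hs
  have hne : (0 : ℝ) ∈ {t : ℝ | ContMDiffAt I I n (φ t) x₀} := by
    refine contMDiffAt_id.congr_of_eventuallyEq ?_
    filter_upwards [hN.mem_nhds hx₀] with x hx using h.zero x hx
  have huniv := hclopen.eq_univ ⟨0, hne⟩
  exact (Set.ext_iff.1 huniv t).2 (mem_univ t)

/-- The flow of a smooth vector field is jointly smooth in time and initial point. -/
theorem IsFlowOn.contMDiffAt (h : IsFlowOn v N φ) (hN : IsOpen N)
    (hv : ContMDiffOn I I.tangent ∞ (fun x => (⟨x, v x⟩ : TangentBundle I X)) N)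
    {x₀ : X} (hx₀ : x₀ ∈ N) (t : ℝ) :
    ContMDiffAt (𝓘(ℝ, ℝ).prod I) I ∞ (fun q : ℝ × X => φ q.1 q.2) (t, x₀) := by
  have h1 : ContMDiffAt (𝓘(ℝ, ℝ).prod I) (𝓘(ℝ, ℝ).prod I) ∞
      (fun q : ℝ × X => (q.1 - t, φ t q.2)) (t, x₀) :=
    (contMDiffAt_fst.sub contMDiffAt_const).prodMk
      ((h.contMDiffAt_time hN hv hx₀ t).comp (t, x₀) contMDiffAt_snd)
  have h2 : ContMDiffAt (𝓘(ℝ, ℝ).prod I) I ∞ (fun q : ℝ × X => φ q.1 q.2) (t - t, φ t x₀) := by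
    rw [sub_self]
    exact h.contMDiffAt_zero hN hv (h.mem t x₀ hx₀)
  refine (h2.comp (t, x₀) h1).congr_of_eventuallyEq ?_
  filter_upwards [continuousAt_snd.eventually (hN.mem_nhds hx₀)] with q hq
  rw [Function.comp_apply, ← h.add hN hv _ _ hq, sub_add_cancel]

end ManifoldFlow

/-! ### Charts of the cotangent bundle -/

section CotangentCoordinates

variable {M : Type*} [TopologicalSpace M] [ChartedSpace Plane M] [IsManifold 𝓘(ℝ, Plane) ∞ M]

/-- Covectors at different points are separated by the base, the others by a local
trivialization. -/
instance [T2Space M] : T2Space (Cotangent M) := by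
  refine ⟨fun ζ ζ' hne => ?_⟩
  by_cases hb : ζ.1 = ζ'.1
  · set e := trivializationAt DualPlane
      (fun x : M => TangentSpace 𝓘(ℝ, Plane) x →L[ℝ] Bundle.Trivial M ℝ x) ζ.1 with he
    have h1 : ζ ∈ e.source := FiberBundle.mem_trivializationAt_proj_source
    have h2 : ζ' ∈ e.source := by
      rw [he, hb]
      exact FiberBundle.mem_trivializationAt_proj_source
    have h3 : e ζ ≠ e ζ' := fun h => hne (e.injOn h1 h2 h)
    obtain ⟨u, w, hu, hw, hzu, hzw, huw⟩ := t2_separation h3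
    refine ⟨e.source ∩ e ⁻¹' u, e.source ∩ e ⁻¹' w,
      e.continuousOn.isOpen_inter_preimage e.open_source hu,
      e.continuousOn.isOpen_inter_preimage e.open_source hw, ⟨h1, hzu⟩, ⟨h2, hzw⟩, ?_⟩
    exact (huw.preimage e).mono inter_subset_right inter_subset_right
  · obtain ⟨u, w, hu, hw, hzu, hzw, huw⟩ := t2_separation hb
    have hc : Continuous (fun ζ : Cotangent M => ζ.1) := FiberBundle.continuous_proj DualPlane _
    exact ⟨_, _, hu.preimage hc, hw.preimage hc, hzu, hzw, huw.preimage _⟩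

theorem mem_cotangentChart_source {ζ₀ ζ : Cotangent M} :
    ζ ∈ (extChartAt cotangentModel ζ₀).source ↔ ζ.1 ∈ (chartAt Plane ζ₀.1).source := by
  rw [FiberBundle.extChartAt]
  simp only [PartialEquiv.trans_source, Trivialization.source_eq, hom_trivializationAt_baseSet,
    TangentBundle.trivializationAt_baseSet]
  simp
  exact fun h => h

theorem cotangentChart_target (ζ₀ : Cotangent M) :
    (extChartAt cotangentModel ζ₀).target = (extChartAt 𝓘(ℝ, Plane) ζ₀.1).target ×ˢ univ := by
  rw [FiberBundle.extChartAt_target]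
  congr 1
  refine inter_eq_left.2 fun y hy => ?_
  have := (extChartAt 𝓘(ℝ, Plane) ζ₀.1).map_target hy
  simpa using this

theorem cotangentChart_fst (ζ₀ ζ : Cotangent M) :
    (extChartAt cotangentModel ζ₀ ζ).1 = extChartAt 𝓘(ℝ, Plane) ζ₀.1 ζ.1 := by
  rw [FiberBundle.extChartAt]
  rfl

theorem cotangentChart_snd (ζ₀ ζ : Cotangent M) (w : Plane) :
    (extChartAt cotangentModel ζ₀ ζ).2 w =
      ζ.2 ((trivializationAt Plane (TangentSpace 𝓘(ℝ, Plane)) ζ₀.1).symmL ℝ ζ.1 w) := by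
  rw [FiberBundle.extChartAt]
  have h := hom_trivializationAt_apply (σ := RingHom.id ℝ) (F₁ := Plane) (F₂ := ℝ)
    (E₁ := TangentSpace 𝓘(ℝ, Plane)) (E₂ := Bundle.Trivial M ℝ) ζ₀.1 ζ
  have h2 : (trivializationAt DualPlane
      (fun x : M => TangentSpace 𝓘(ℝ, Plane) x →L[ℝ] Bundle.Trivial M ℝ x) ζ₀.1 ζ).2 w =
      ζ.2 ((trivializationAt Plane (TangentSpace 𝓘(ℝ, Plane)) ζ₀.1).symmL ℝ ζ.1 w) := by
    rw [h]
    simp [ContinuousLinearMap.inCoordinates]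
  exact h2

/-- The fiber coordinate of a covector in the chart of `T*M` induced by a chart of `M`. -/
theorem cotangentChart_snd_mfderiv {ζ₀ ζ : Cotangent M} (h : ζ.1 ∈ (chartAt Plane ζ₀.1).source)
    (w : TangentSpace 𝓘(ℝ, Plane) ζ.1) :
    (extChartAt cotangentModel ζ₀ ζ).2
      (mfderiv 𝓘(ℝ, Plane) 𝓘(ℝ, Plane) (extChartAt 𝓘(ℝ, Plane) ζ₀.1) ζ.1 w) = ζ.2 w := by
  have h1 : (trivializationAt Plane (TangentSpace 𝓘(ℝ, Plane)) ζ₀.1).symmL ℝ ζ.1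
      ((trivializationAt Plane (TangentSpace 𝓘(ℝ, Plane)) ζ₀.1).continuousLinearMapAt ℝ ζ.1 w)
      = w := Trivialization.symmL_continuousLinearMapAt _ (by simpa using h) _
  have h2 : (trivializationAt Plane (TangentSpace 𝓘(ℝ, Plane)) ζ₀.1).continuousLinearMapAt ℝ ζ.1 w
      = mfderiv 𝓘(ℝ, Plane) 𝓘(ℝ, Plane) (extChartAt 𝓘(ℝ, Plane) ζ₀.1) ζ.1 w :=
    congrArg (fun A : TangentSpace 𝓘(ℝ, Plane) ζ.1 →L[ℝ] Plane => A w)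
      (TangentBundle.continuousLinearMapAt_trivializationAt (I := 𝓘(ℝ, Plane)) h)
  refine (cotangentChart_snd ζ₀ ζ _).trans ?_
  rw [← h2]
  exact congrArg ζ.2 h1

theorem cotangentChart_dilate (ζ₀ ζ : Cotangent M) (r : ℝ) :
    extChartAt cotangentModel ζ₀ (dilate r ζ) =
      ((extChartAt cotangentModel ζ₀ ζ).1, r • (extChartAt cotangentModel ζ₀ ζ).2) := by
  refine Prod.ext ?_ ?_
  · rw [cotangentChart_fst, cotangentChart_fst]
    rfl
  · ext w
    exact (cotangentChart_snd ζ₀ _ w).trans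
      (congrArg (r • ·) (cotangentChart_snd ζ₀ ζ w).symm)

/-- The derivative of the projection `T*M → M`, in the canonical coordinates. -/
theorem hasMFDerivAt_cotangent_proj (ζ : Cotangent M) :
    HasMFDerivAt cotangentModel 𝓘(ℝ, Plane) (fun ζ : Cotangent M => ζ.1) ζ
      (ContinuousLinearMap.fst ℝ Plane DualPlane) := by
  have hz : extChartAt cotangentModel ζ ζ ∈ (extChartAt cotangentModel ζ).target :=
    mem_extChartAt_target ζ
  have h : HasFDerivAt
      (writtenInExtChartAt cotangentModel 𝓘(ℝ, Plane) ζ (fun ζ : Cotangent M => ζ.1))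
      (ContinuousLinearMap.fst ℝ Plane DualPlane) (extChartAt cotangentModel ζ ζ) := by
    refine (hasFDerivAt_fst (𝕜 := ℝ) (E := Plane) (F := DualPlane)).congr_of_eventuallyEq ?_
    filter_upwards [(isOpen_extChartAt_target ζ).mem_nhds hz] with z hz'
    simp only [writtenInExtChartAt, Function.comp_apply]
    rw [← cotangentChart_fst ζ, (extChartAt cotangentModel ζ).right_inv hz']
  exact ⟨(FiberBundle.continuous_proj DualPlane _).continuousAt, h.hasFDerivWithinAt⟩

/-- The base component of the derivative of a chart of `T*M`. -/
theorem mfderiv_cotangentChart_fst {ζ₀ ζ : Cotangent M} (h : ζ.1 ∈ (chartAt Plane ζ₀.1).source)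
    (v : Plane × DualPlane) :
    (mfderiv cotangentModel 𝓘(ℝ, Plane × DualPlane) (extChartAt cotangentModel ζ₀) ζ v :
      Plane × DualPlane).1 =
    mfderiv 𝓘(ℝ, Plane) 𝓘(ℝ, Plane) (extChartAt 𝓘(ℝ, Plane) ζ₀.1) ζ.1 v.1 := by
  have hζ : ζ ∈ (chartAt (ModelProd Plane DualPlane) ζ₀).source := by
    rw [← extChartAt_source cotangentModel]
    exact mem_cotangentChart_source.2 h
  have h1 : HasMFDerivAt cotangentModel 𝓘(ℝ, Plane × DualPlane) (extChartAt cotangentModel ζ₀) ζ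
      (mfderiv cotangentModel 𝓘(ℝ, Plane × DualPlane) (extChartAt cotangentModel ζ₀) ζ) :=
    (mdifferentiableAt_extChartAt hζ).hasMFDerivAt
  have h2 := (hasFDerivAt_fst (𝕜 := ℝ) (E := Plane) (F := DualPlane)
    (p := extChartAt cotangentModel ζ₀ ζ)).hasMFDerivAt.comp ζ h1
  have h3 : HasMFDerivAt 𝓘(ℝ, Plane) 𝓘(ℝ, Plane) (extChartAt 𝓘(ℝ, Plane) ζ₀.1) ζ.1
      (mfderiv 𝓘(ℝ, Plane) 𝓘(ℝ, Plane) (extChartAt 𝓘(ℝ, Plane) ζ₀.1) ζ.1) :=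
    (mdifferentiableAt_extChartAt h).hasMFDerivAt
  have h4 := h3.comp ζ (hasMFDerivAt_cotangent_proj ζ)
  have h5 := hasMFDerivAt_unique h2 h4
  exact congrArg (fun A : Plane × DualPlane →L[ℝ] Plane => A v) h5

/-- The Liouville form `ξ dx` is invariant under the coordinate changes of `T*M`. -/
theorem liouville_cotangentChart {ζ₀ ζ : Cotangent M} (h : ζ.1 ∈ (chartAt Plane ζ₀.1).source)
    (v : Plane × DualPlane) :
    (extChartAt cotangentModel ζ₀ ζ).2 (mfderiv cotangentModel 𝓘(ℝ, Plane × DualPlane)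
      (extChartAt cotangentModel ζ₀) ζ v : Plane × DualPlane).1 = ζ.2 v.1 := by
  rw [mfderiv_cotangentChart_fst h]
  exact cotangentChart_snd_mfderiv h _

end CotangentCoordinates

/-! ### Symplectic linear algebra -/

section SymplecticLinearAlgebra

/-! Shortcut instances: on these concrete spaces the general search is slow. -/

noncomputable instance : NormedAddCommGroup (Plane × DualPlane →L[ℝ] ℝ) :=
  ContinuousLinearMap.toNormedAddCommGroup

noncomputable instance : NormedSpace ℝ (Plane × DualPlane →L[ℝ] ℝ) :=
  ContinuousLinearMap.toNormedSpace

noncomputable instance : AddCommGroup (Plane × DualPlane →L[ℝ] ℝ) :=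
  ContinuousLinearMap.addCommGroup

noncomputable instance : Module ℝ (Plane × DualPlane →L[ℝ] ℝ) :=
  ContinuousLinearMap.module

noncomputable instance : NormedAddCommGroup (Plane × DualPlane →L[ℝ] Plane × DualPlane) :=
  ContinuousLinearMap.toNormedAddCommGroup

/-- The canonical symplectic form `dξ ∧ dx` of `ℝ² × (ℝ²)*`. -/
def symplecticForm (u v : Plane × DualPlane) : ℝ := u.2 v.1 - v.2 u.1

/-- The Hamiltonian vector of a linear form `ℓ`, that is, the vector `u` with
`symplecticForm u v = -ℓ v` for all `v`. -/
noncomputable def hamiltonianVector :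
    (Plane × DualPlane →L[ℝ] ℝ) →L[ℝ] Plane × DualPlane :=
  (∑ i : Fin 2, ((ContinuousLinearMap.apply ℝ ℝ
      ((0, EuclideanSpace.proj i) : Plane × DualPlane)).smulRight
        (EuclideanSpace.single i (1 : ℝ) : Plane))).prod
    (-((ContinuousLinearMap.compL ℝ Plane (Plane × DualPlane) ℝ).flip
      (ContinuousLinearMap.inl ℝ Plane DualPlane)))

theorem hamiltonianVector_apply (ℓ : Plane × DualPlane →L[ℝ] ℝ) :
    hamiltonianVector ℓ =
      (∑ i : Fin 2, ℓ (0, EuclideanSpace.proj i) • EuclideanSpace.single i (1 : ℝ),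
        -(ℓ.comp (ContinuousLinearMap.inl ℝ Plane DualPlane))) := by
  simp [hamiltonianVector]

theorem dualPlane_eq_sum (η : DualPlane) :
    η = ∑ i : Fin 2, η (EuclideanSpace.single i 1) • (EuclideanSpace.proj i : DualPlane) := by
  ext v
  have hv : v = ∑ i : Fin 2, v i • EuclideanSpace.single i (1 : ℝ) := by
    ext j
    fin_cases j <;> simp
  conv_lhs => rw [hv]
  simp [mul_comm]

theorem symplecticForm_hamiltonianVector (ℓ : Plane × DualPlane →L[ℝ] ℝ)
    (v : Plane × DualPlane) : symplecticForm (hamiltonianVector ℓ) v = -ℓ v := by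
  have h : ℓ v = ℓ (v.1, 0) + ∑ i : Fin 2,
      v.2 (EuclideanSpace.single i 1) * ℓ (0, EuclideanSpace.proj i) := by
    have h1 : v = (v.1, 0) + (0, v.2) := by simp
    have h2 : ((0, v.2) : Plane × DualPlane) = ContinuousLinearMap.inr ℝ Plane DualPlane v.2 := rfl
    conv_lhs => rw [h1, map_add, h2, dualPlane_eq_sum v.2]
    simp only [map_sum, map_smul, smul_eq_mul]
    rfl
  rw [h, symplecticForm, hamiltonianVector_apply]
  simp [mul_comm]
  ring

theorem symplecticForm_self (v : Plane × DualPlane) : symplecticForm v v = 0 := sub_self _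

theorem symplecticForm_swap (u v : Plane × DualPlane) :
    symplecticForm u v = -symplecticForm v u := by
  simp [symplecticForm]

theorem symplecticForm_sub_left (u u' v : Plane × DualPlane) :
    symplecticForm (u - u') v = symplecticForm u v - symplecticForm u' v := by
  simp [symplecticForm]
  ring

theorem symplecticForm_smul_left (t : ℝ) (u v : Plane × DualPlane) :
    symplecticForm (t • u) v = t * symplecticForm u v := by
  simp [symplecticForm]
  ring

theorem eq_zero_of_symplecticForm {u : Plane × DualPlane}
    (h : ∀ v, symplecticForm u v = 0) : u = 0 := by
  refine Prod.ext ?_ ?_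
  · ext i
    simpa [symplecticForm] using h (0, EuclideanSpace.proj i)
  · ext x
    simpa [symplecticForm] using h (x, 0)

theorem eq_of_symplecticForm {u u' : Plane × DualPlane}
    (h : ∀ v, symplecticForm u v = symplecticForm u' v) : u = u' := by
  refine sub_eq_zero.1 (eq_zero_of_symplecticForm fun v => ?_)
  rw [symplecticForm_sub_left, h, sub_self]

theorem hamiltonianVector_injective : Function.Injective hamiltonianVector := by
  intro ℓ ℓ' h
  refine ContinuousLinearMap.ext fun v => ?_
  have := symplecticForm_hamiltonianVector ℓ v
  rw [h, symplecticForm_hamiltonianVector] at this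
  simpa using this.symm

/-- The linear form `v ↦ η (v.1)` on `ℝ² × (ℝ²)*`; at a point `(x, η)` of `T*M` it is the Liouville
form. -/
noncomputable def liouvilleForm (η : DualPlane) : Plane × DualPlane →L[ℝ] ℝ :=
  η.comp (ContinuousLinearMap.fst ℝ Plane DualPlane)

theorem hamiltonianVector_liouvilleForm (η : DualPlane) :
    hamiltonianVector (liouvilleForm η) = -((0, η) : Plane × DualPlane) := by
  refine eq_of_symplecticForm fun v => ?_
  rw [symplecticForm_hamiltonianVector]
  simp [symplecticForm]
  rfl

theorem finrank_plane_prod_dual : Module.finrank ℝ (Plane × DualPlane) = 4 := by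
  have h : Module.finrank ℝ DualPlane = 2 := by
    have h1 : Module.finrank ℝ DualPlane = Module.finrank ℝ (Module.Dual ℝ Plane) :=
      (LinearMap.toContinuousLinearMap (𝕜 := ℝ) (E := Plane) (F' := ℝ)).finrank_eq.symm
    rw [h1, Subspace.dual_finrank_eq]
    simp
  rw [Module.finrank_prod, h]
  simp

/-- Two Hamiltonian vectors of independent linear forms are independent. -/
theorem hamiltonianVector_independent {ℓ₁ ℓ₂ : Plane × DualPlane →L[ℝ] ℝ} (h₂ : ℓ₂ ≠ 0)
    {v : Plane × DualPlane} (hv₁ : ℓ₁ v ≠ 0) (hv₂ : ℓ₂ v = 0) {a b : ℝ}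
    (h : a • hamiltonianVector ℓ₁ + b • hamiltonianVector ℓ₂ = 0) : a = 0 ∧ b = 0 := by
  have h' : a • ℓ₁ + b • ℓ₂ = 0 := hamiltonianVector_injective (by simpa using h)
  have ha : a = 0 := by
    have := congrArg (fun ℓ : Plane × DualPlane →L[ℝ] ℝ => ℓ v) h'
    simpa [hv₂, hv₁] using this
  subst ha
  exact ⟨rfl, by simpa [h₂] using h'⟩

/-- In dimension four, the common kernel of two independent linear forms in involution is spanned
by their Hamiltonian vectors. -/
theorem exists_eq_hamiltonianVector {ℓ₁ ℓ₂ : Plane × DualPlane →L[ℝ] ℝ} (h₂ : ℓ₂ ≠ 0)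
    {v : Plane × DualPlane} (hv₁ : ℓ₁ v ≠ 0) (hv₂ : ℓ₂ v = 0)
    (h₁₂ : ℓ₂ (hamiltonianVector ℓ₁) = 0) {r : Plane × DualPlane} (hr₁ : ℓ₁ r = 0)
    (hr₂ : ℓ₂ r = 0) :
    ∃ a b : ℝ, r = a • hamiltonianVector ℓ₁ + b • hamiltonianVector ℓ₂ := by
  set K : Submodule ℝ (Plane × DualPlane) := LinearMap.ker (ℓ₁.prod ℓ₂).toLinearMap with hK
  have mem : ∀ x, x ∈ K ↔ ℓ₁ x = 0 ∧ ℓ₂ x = 0 := by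
    intro x
    simp [hK, LinearMap.mem_ker]
  have self : ∀ ℓ : Plane × DualPlane →L[ℝ] ℝ, ℓ (hamiltonianVector ℓ) = 0 := fun ℓ => by
    have := symplecticForm_hamiltonianVector ℓ (hamiltonianVector ℓ)
    rw [symplecticForm_self] at this
    linarith
  have h₂₁ : ℓ₁ (hamiltonianVector ℓ₂) = 0 := by
    have e1 := symplecticForm_hamiltonianVector ℓ₁ (hamiltonianVector ℓ₂)
    have e2 := symplecticForm_hamiltonianVector ℓ₂ (hamiltonianVector ℓ₁)
    rw [symplecticForm_swap, e2] at e1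
    linarith
  have hsurj : Function.Surjective (ℓ₁.prod ℓ₂).toLinearMap := by
    obtain ⟨w, hw⟩ : ∃ w, ℓ₂ w ≠ 0 := by
      by_contra! hcon
      exact h₂ (ContinuousLinearMap.ext hcon)
    rintro ⟨a, b⟩
    refine ⟨((a - b / ℓ₂ w * ℓ₁ w) / ℓ₁ v) • v + (b / ℓ₂ w) • w, ?_⟩
    refine Prod.ext ?_ ?_
    · simp
      field_simp
      ring
    · simp [hv₂]
      field_simp
  have hfin : Module.finrank ℝ K = 2 := by
    have h := LinearMap.finrank_range_add_finrank_ker (ℓ₁.prod ℓ₂).toLinearMap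
    rw [LinearMap.range_eq_top.2 hsurj, finrank_top, finrank_plane_prod_dual,
      Module.finrank_prod, Module.finrank_self] at h
    have h' : 1 + 1 + Module.finrank ℝ K = 4 := h
    omega
  have hli : LinearIndependent ℝ ![hamiltonianVector ℓ₁, hamiltonianVector ℓ₂] :=
    LinearIndependent.pair_iff.2 fun a b h => hamiltonianVector_independent h₂ hv₁ hv₂ h
  have hspan : Submodule.span ℝ (range ![hamiltonianVector ℓ₁, hamiltonianVector ℓ₂]) = K := by
    refine Submodule.eq_of_le_of_finrank_eq ?_ ?_
    · rw [Submodule.span_le]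
      rintro _ ⟨i, rfl⟩
      fin_cases i
      · exact (mem _).2 ⟨self _, h₁₂⟩
      · exact (mem _).2 ⟨h₂₁, self _⟩
    · rw [hfin, finrank_span_eq_card hli]
      simp
  have hrK : r ∈ K := (mem r).2 ⟨hr₁, hr₂⟩
  rw [← hspan] at hrK
  simp only [Matrix.range_cons, Matrix.range_empty, union_empty, singleton_union] at hrK
  obtain ⟨a, b, hab⟩ := Submodule.mem_span_pair.1 hrK
  exact ⟨a, b, hab.symm⟩

end SymplecticLinearAlgebra

/-! ### Symplectic coordinate changes -/

section SymplecticCharts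

/-- The representation of a smooth function in a chart. -/
theorem ContMDiffAt.comp_extChartAt_symm {E H X F : Type*} [NormedAddCommGroup E]
    [NormedSpace ℝ E] [TopologicalSpace H] {I : ModelWithCorners ℝ E H} [I.Boundaryless]
    [TopologicalSpace X] [ChartedSpace H X] [IsManifold I ∞ X]
    [NormedAddCommGroup F] [NormedSpace ℝ F] {f : X → F} {x x₀ : X}
    (hf : ContMDiffAt I 𝓘(ℝ, F) ∞ f x) (hx : x ∈ (chartAt H x₀).source) :
    ContDiffAt ℝ ∞ (f ∘ (extChartAt I x₀).symm) (extChartAt I x₀ x) := by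
  have h := (contMDiffAt_iff_source_of_mem_source hx).1 hf
  rw [ModelWithCorners.range_eq_univ, contMDiffWithinAt_univ] at h
  exact h.contDiffAt

/-- The differential of a smooth function, computed in a chart. -/
theorem mfderiv_eq_fderiv_comp_extChartAt {E H X F : Type*} [NormedAddCommGroup E]
    [NormedSpace ℝ E] [TopologicalSpace H] {I : ModelWithCorners ℝ E H} [I.Boundaryless]
    [TopologicalSpace X] [ChartedSpace H X] [IsManifold I ∞ X]
    [NormedAddCommGroup F] [NormedSpace ℝ F] {f : X → F} {x x₀ : X}
    (hf : ContMDiffAt I 𝓘(ℝ, F) ∞ f x) (hx : x ∈ (chartAt H x₀).source) :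
    mfderiv I 𝓘(ℝ, F) f x =
      (fderiv ℝ (f ∘ (extChartAt I x₀).symm) (extChartAt I x₀ x)).comp
        (mfderiv I 𝓘(ℝ, E) (extChartAt I x₀) x) := by
  have h1 := (hf.comp_extChartAt_symm hx).differentiableAt (by simp)
  have h2 : HasMFDerivAt I 𝓘(ℝ, E) (extChartAt I x₀) x (mfderiv I 𝓘(ℝ, E) (extChartAt I x₀) x) :=
    (mdifferentiableAt_extChartAt hx).hasMFDerivAt
  have h3 := h1.hasFDerivAt.hasMFDerivAt.comp x h2
  refine (h3.congr_of_eventuallyEq ?_).mfderiv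
  filter_upwards [(chartAt H x₀).open_source.mem_nhds hx] with y hy
  simp only [Function.comp_apply]
  rw [(extChartAt I x₀).left_inv (by rwa [extChartAt_source])]

variable {M : Type*} [TopologicalSpace M] [ChartedSpace Plane M] [IsManifold 𝓘(ℝ, Plane) ∞ M]

/-- The derivative at `ζ` of the chart of `T*M` centred at `ζ₀`. -/
noncomputable def chartDeriv (ζ₀ ζ : Cotangent M) :
    Plane × DualPlane →L[ℝ] Plane × DualPlane :=
  mfderiv cotangentModel 𝓘(ℝ, Plane × DualPlane) (extChartAt cotangentModel ζ₀) ζ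

theorem mem_cotangent_chartAt_source {ζ₀ ζ : Cotangent M} :
    ζ ∈ (chartAt (ModelProd Plane DualPlane) ζ₀).source ↔ ζ.1 ∈ (chartAt Plane ζ₀.1).source := by
  rw [← extChartAt_source cotangentModel, mem_cotangentChart_source]

theorem hasMFDerivAt_cotangentChart {ζ₀ ζ : Cotangent M}
    (h : ζ.1 ∈ (chartAt Plane ζ₀.1).source) :
    HasMFDerivAt cotangentModel 𝓘(ℝ, Plane × DualPlane) (extChartAt cotangentModel ζ₀) ζ
      (chartDeriv ζ₀ ζ) :=
  (mdifferentiableAt_extChartAt (mem_cotangent_chartAt_source.2 h)).hasMFDerivAt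

theorem chartDeriv_bijective {ζ₀ ζ : Cotangent M} (h : ζ.1 ∈ (chartAt Plane ζ₀.1).source) :
    Function.Bijective (chartDeriv ζ₀ ζ) := by
  have hi := isInvertible_mfderiv_extChartAt (I := cotangentModel)
    (mem_cotangentChart_source.2 h)
  exact hi.bijective

theorem chartDeriv_self (ζ : Cotangent M) : chartDeriv ζ ζ = ContinuousLinearMap.id ℝ _ := by
  have hz : extChartAt cotangentModel ζ ζ ∈ (extChartAt cotangentModel ζ).target :=
    mem_extChartAt_target ζ
  have h : HasFDerivAt (writtenInExtChartAt cotangentModel 𝓘(ℝ, Plane × DualPlane) ζ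
      (extChartAt cotangentModel ζ)) (ContinuousLinearMap.id ℝ (Plane × DualPlane))
      (extChartAt cotangentModel ζ ζ) := by
    refine (hasFDerivAt_id _).congr_of_eventuallyEq ?_
    filter_upwards [(isOpen_extChartAt_target ζ).mem_nhds hz] with z hz'
    simp only [writtenInExtChartAt, Function.comp_apply]
    rw [(extChartAt cotangentModel ζ).right_inv hz', extChartAt_model_space_eq_id]
    rfl
  exact HasMFDerivAt.mfderiv ⟨continuousAt_extChartAt ζ, h.hasFDerivWithinAt⟩

theorem liouville_chartDeriv {ζ₀ ζ : Cotangent M} (h : ζ.1 ∈ (chartAt Plane ζ₀.1).source)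
    (v : Plane × DualPlane) :
    (extChartAt cotangentModel ζ₀ ζ).2 (chartDeriv ζ₀ ζ v).1 = ζ.2 v.1 :=
  liouville_cotangentChart h v

theorem cotangentDiff_eq_chart {f : Cotangent M → ℝ} {ζ₀ ζ : Cotangent M}
    (hf : ContMDiffAt cotangentModel 𝓘(ℝ, ℝ) ∞ f ζ) (h : ζ.1 ∈ (chartAt Plane ζ₀.1).source) :
    cotangentDiff f ζ = (fderiv ℝ (f ∘ (extChartAt cotangentModel ζ₀).symm)
      (extChartAt cotangentModel ζ₀ ζ)).comp (chartDeriv ζ₀ ζ) :=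
  mfderiv_eq_fderiv_comp_extChartAt hf (mem_cotangent_chartAt_source.2 h)

/-- A map of `ℝ² × (ℝ²)*` that preserves the Liouville form preserves the symplectic form. -/
theorem symplecticForm_fderiv {κ : Plane × DualPlane → Plane × DualPlane} {z₀ : Plane × DualPlane}
    (hκ : ContDiffAt ℝ ∞ κ z₀)
    (hα : ∀ᶠ z in 𝓝 z₀, ∀ v, (κ z).2 (fderiv ℝ κ z v).1 = z.2 v.1) (v w : Plane × DualPlane) :
    symplecticForm (fderiv ℝ κ z₀ v) (fderiv ℝ κ z₀ w) = symplecticForm v w := by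
  have hd : HasFDerivAt κ (fderiv ℝ κ z₀) z₀ := (hκ.differentiableAt (by simp)).hasFDerivAt
  have hdd : HasFDerivAt (fderiv ℝ κ) (fderiv ℝ (fderiv ℝ κ) z₀) z₀ :=
    ((hκ.fderiv_right (m := 1) (by rw [one_add_one_eq_two]; exact ENat.LEInfty.out)
      ).differentiableAt (by simp)).hasFDerivAt
  have hsymm : IsSymmSndFDerivAt ℝ κ z₀ := hκ.isSymmSndFDerivAt (by simpa using ENat.LEInfty.out)
  have key : ∀ v w : Plane × DualPlane,
      (fderiv ℝ κ z₀ w).2 (fderiv ℝ κ z₀ v).1 +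
        (κ z₀).2 (fderiv ℝ (fderiv ℝ κ) z₀ w v).1 = w.2 v.1 := by
    intro v w
    have h1 : HasFDerivAt (fun z => (κ z).2 (fderiv ℝ κ z v).1) _ z₀ :=
      (hd.snd).clm_apply ((hdd.clm_apply (hasFDerivAt_const v z₀)).fst)
    have h2 : HasFDerivAt (fun z : Plane × DualPlane => z.2 v.1) _ z₀ :=
      (hasFDerivAt_id z₀).snd.clm_apply (hasFDerivAt_const v.1 z₀)
    have h3 := h1.unique (h2.congr_of_eventuallyEq (hα.mono fun z hz => hz v))
    have h4 := congrArg (fun A : Plane × DualPlane →L[ℝ] ℝ => A w) h3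
    simp at h4
    linarith
  have e1 := key v w
  have e2 := key w v
  have e3 : fderiv ℝ (fderiv ℝ κ) z₀ w v = fderiv ℝ (fderiv ℝ κ) z₀ v w := hsymm.eq w v
  rw [e3] at e1
  simp only [symplecticForm]
  linarith

/-- The charts of `T*M` are symplectic. -/
theorem symplecticForm_chartDeriv {ζ₀ ζ : Cotangent M} (h : ζ.1 ∈ (chartAt Plane ζ₀.1).source)
    (v w : Plane × DualPlane) :
    symplecticForm (chartDeriv ζ₀ ζ v) (chartDeriv ζ₀ ζ w) = symplecticForm v w := by
  set c := extChartAt cotangentModel ζ with hc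
  set c₀ := extChartAt cotangentModel ζ₀ with hc₀
  have hz : c ζ ∈ c.target := mem_extChartAt_target ζ
  have hsm : ∀ ζ' : Cotangent M, ζ'.1 ∈ (chartAt Plane ζ₀.1).source →
      ContMDiffAt cotangentModel 𝓘(ℝ, Plane × DualPlane) ∞ c₀ ζ' := fun ζ' hζ' =>
    contMDiffAt_extChartAt' (mem_cotangent_chartAt_source.2 hζ')
  have hself : ζ.1 ∈ (chartAt Plane ζ.1).source := mem_chart_source _ _
  have hcomp : ∀ ζ' : Cotangent M, ζ'.1 ∈ (chartAt Plane ζ₀.1).source →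
      ζ'.1 ∈ (chartAt Plane ζ.1).source →
      chartDeriv ζ₀ ζ' = (fderiv ℝ (c₀ ∘ c.symm) (c ζ')).comp (chartDeriv ζ ζ') :=
    fun ζ' h1 h2 => mfderiv_eq_fderiv_comp_extChartAt (hsm ζ' h1)
      (mem_cotangent_chartAt_source.2 h2)
  have hκ : ContDiffAt ℝ ∞ (c₀ ∘ c.symm) (c ζ) :=
    (hsm ζ h).comp_extChartAt_symm (mem_chart_source _ ζ)
  have hev : ∀ᶠ z in 𝓝 (c ζ), ∀ v,
      ((c₀ ∘ c.symm) z).2 (fderiv ℝ (c₀ ∘ c.symm) z v).1 = z.2 v.1 := by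
    have hcont : ContinuousAt c.symm (c ζ) := continuousAt_extChartAt_symm ζ
    have h1 : ∀ᶠ z in 𝓝 (c ζ), c.symm z ∈ c₀.source :=
      hcont.eventually_mem ((isOpen_extChartAt_source ζ₀).mem_nhds (by
        rw [extChartAt_to_inv]
        exact mem_cotangentChart_source.2 h))
    filter_upwards [h1, (isOpen_extChartAt_target ζ).mem_nhds hz] with z hz1 hz2 v
    have h2 := mem_cotangentChart_source.1 hz1
    have h3 := mem_cotangentChart_source.1 (c.map_target hz2)
    obtain ⟨u, rfl⟩ := (chartDeriv_bijective h3).2 v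
    have h4 := liouville_chartDeriv h2 u
    rw [hcomp _ h2 h3, c.right_inv hz2] at h4
    have h5 := liouville_chartDeriv h3 u
    rw [← hc, c.right_inv hz2] at h5
    exact h4.trans h5.symm
  have hs := symplecticForm_fderiv hκ hev v w
  have h6 : chartDeriv ζ₀ ζ = fderiv ℝ (c₀ ∘ c.symm) (c ζ) := by
    rw [hcomp ζ h hself, chartDeriv_self, ContinuousLinearMap.comp_id]
  rw [h6, hs]

theorem hamiltonianField_eq (f : Cotangent M → ℝ) (ζ : Cotangent M) :
    hamiltonianField f ζ = hamiltonianVector (cotangentDiff f ζ) :=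
  (hamiltonianVector_apply _).symm

/-- The Hamiltonian field of a function, computed in a chart. -/
theorem chartDeriv_hamiltonianField {f : Cotangent M → ℝ} {ζ₀ ζ : Cotangent M}
    (hf : ContMDiffAt cotangentModel 𝓘(ℝ, ℝ) ∞ f ζ) (h : ζ.1 ∈ (chartAt Plane ζ₀.1).source) :
    chartDeriv ζ₀ ζ (hamiltonianField f ζ) = hamiltonianVector
      (fderiv ℝ (f ∘ (extChartAt cotangentModel ζ₀).symm) (extChartAt cotangentModel ζ₀ ζ)) := by
  refine eq_of_symplecticForm fun w => ?_
  obtain ⟨v, rfl⟩ := (chartDeriv_bijective h).2 w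
  rw [symplecticForm_chartDeriv h, hamiltonianField_eq, symplecticForm_hamiltonianVector,
    symplecticForm_hamiltonianVector, cotangentDiff_eq_chart hf h]
  rfl

end SymplecticCharts

/-! ### Dilations -/

section Dilations

variable {M : Type*} [TopologicalSpace M] [ChartedSpace Plane M] [IsManifold 𝓘(ℝ, Plane) ∞ M]

theorem cotangentChart_snd_self (ζ : Cotangent M) : (extChartAt cotangentModel ζ ζ).2 = ζ.2 := by
  ext w
  have h := liouville_chartDeriv (ζ₀ := ζ) (ζ := ζ) (mem_chart_source _ _) (w, 0)
  rwa [chartDeriv_self] at h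

theorem cotangentChart_snd_eq_zero {ζ₀ ζ : Cotangent M}
    (h : ζ.1 ∈ (chartAt Plane ζ₀.1).source) :
    (extChartAt cotangentModel ζ₀ ζ).2 = 0 ↔ ζ.2 = 0 := by
  constructor
  · intro h0
    ext w
    refine (cotangentChart_snd_mfderiv h w).symm.trans ?_
    rw [h0]
    rfl
  · intro h0
    ext w
    rw [cotangentChart_snd, h0]
    rfl

theorem isOpen_puncturedCotangent : IsOpen (puncturedCotangent M) := by
  rw [isOpen_iff_mem_nhds]
  intro ζ hζ
  have h0 : ζ.1 ∈ (chartAt Plane ζ.1).source := mem_chart_source _ _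
  have h1 : ∀ᶠ z in 𝓝 (extChartAt cotangentModel ζ ζ), z.2 ≠ 0 := by
    refine continuousAt_snd.eventually_ne ?_
    exact fun h => hζ ((cotangentChart_snd_eq_zero h0).1 h)
  filter_upwards [(continuousAt_extChartAt (I := cotangentModel) ζ).eventually h1,
    extChartAt_source_mem_nhds (I := cotangentModel) ζ] with ζ' h2 h3
  exact fun h => h2 ((cotangentChart_snd_eq_zero (mem_cotangentChart_source.1 h3)).2 h)

theorem dilate_mem {ζ : Cotangent M} (hζ : ζ ∈ puncturedCotangent M) {r : ℝ} (hr : r ≠ 0) :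
    dilate r ζ ∈ puncturedCotangent M := by
  intro h
  exact hζ ((smul_eq_zero.1 (show r • ζ.2 = 0 from h)).resolve_left hr)

theorem radialField_ne_zero {ζ : Cotangent M} (hζ : ζ ∈ puncturedCotangent M) :
    radialField ζ ≠ 0 := fun h => hζ (congrArg Prod.snd h)

theorem extChartAt_dilate (r : ℝ) (ζ : Cotangent M) :
    extChartAt cotangentModel (dilate r ζ) = extChartAt cotangentModel ζ := by
  rw [FiberBundle.extChartAt, FiberBundle.extChartAt]
  rfl

/-- The multiplication of the fiber coordinate by a scalar, in a chart of `T*M`. -/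
def scaleSnd (y : ℝ × (Plane × DualPlane)) : Plane × DualPlane := (y.2.1, y.1 • y.2.2)

theorem contDiff_scaleSnd : ContDiff ℝ ∞ scaleSnd := by
  unfold scaleSnd
  fun_prop

theorem contMDiff_dilate : ContMDiff (𝓘(ℝ, ℝ).prod cotangentModel) cotangentModel ∞
    (fun q : ℝ × Cotangent M => dilate q.1 q.2) := by
  rintro ⟨r, ζ⟩
  set c := extChartAt cotangentModel ζ with hc
  have h0 : ContMDiffAt cotangentModel 𝓘(ℝ, Plane × DualPlane) ∞ c ζ := contMDiffAt_extChartAt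
  have h1 : ContMDiffAt (𝓘(ℝ, ℝ).prod cotangentModel) 𝓘(ℝ, Plane × DualPlane) ∞
      (c ∘ Prod.snd) (r, ζ) := ContMDiffAt.comp (r, ζ) h0 contMDiffAt_snd
  have h2 : ContMDiffAt (𝓘(ℝ, ℝ).prod cotangentModel) 𝓘(ℝ, ℝ) ∞
      (Prod.fst : ℝ × Cotangent M → ℝ) (r, ζ) := contMDiffAt_fst
  have h3 : ContMDiffAt (𝓘(ℝ, ℝ).prod cotangentModel) 𝓘(ℝ, Plane × DualPlane) ∞
      (scaleSnd ∘ fun q : ℝ × Cotangent M => (q.1, (c ∘ Prod.snd) q)) (r, ζ) :=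
    ContMDiffAt.comp (r, ζ) contDiff_scaleSnd.contMDiff.contMDiffAt (h2.prodMk_space h1)
  have h4 : ContMDiffAt 𝓘(ℝ, Plane × DualPlane) cotangentModel ∞ c.symm
      ((scaleSnd ∘ fun q : ℝ × Cotangent M => (q.1, (c ∘ Prod.snd) q)) (r, ζ)) := by
    refine (contMDiffOn_extChartAt_symm ζ).contMDiffAt ((isOpen_extChartAt_target ζ).mem_nhds ?_)
    have := c.map_source (mem_cotangentChart_source (ζ := dilate r ζ).2 (mem_chart_source _ _))
    rwa [hc, cotangentChart_dilate] at this
  refine (ContMDiffAt.comp (r, ζ) h4 h3).congr_of_eventuallyEq ?_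
  have h6 : ∀ᶠ q : ℝ × Cotangent M in 𝓝 (r, ζ), q.2 ∈ c.source :=
    continuousAt_snd.eventually_mem (extChartAt_source_mem_nhds (I := cotangentModel) ζ)
  filter_upwards [h6] with q hq
  have hq' : q.2.1 ∈ (chartAt Plane ζ.1).source := mem_cotangentChart_source.1 hq
  have hd : dilate q.1 q.2 ∈ c.source := mem_cotangentChart_source.2 hq'
  have h7 : (scaleSnd ∘ fun q : ℝ × Cotangent M => (q.1, (c ∘ Prod.snd) q)) q =
      c (dilate q.1 q.2) := (cotangentChart_dilate _ _ _).symm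
  rw [Function.comp_apply (f := c.symm), h7, PartialEquiv.left_inv c hd]

/-- The derivative of a dilation, in the canonical coordinates. -/
noncomputable def dilateDeriv (r : ℝ) : Plane × DualPlane →L[ℝ] Plane × DualPlane :=
  (ContinuousLinearMap.fst ℝ Plane DualPlane).prod
    (r • ContinuousLinearMap.snd ℝ Plane DualPlane)

@[simp]
theorem dilateDeriv_apply (r : ℝ) (v : Plane × DualPlane) :
    dilateDeriv r v = (v.1, r • v.2) := rfl

theorem hasMFDerivAt_dilate (r : ℝ) (ζ : Cotangent M) :
    HasMFDerivAt cotangentModel cotangentModel (dilate r) ζ (dilateDeriv r) := by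
  have hz : extChartAt cotangentModel ζ ζ ∈ (extChartAt cotangentModel ζ).target :=
    mem_extChartAt_target ζ
  have h : HasFDerivAt (writtenInExtChartAt cotangentModel cotangentModel ζ (dilate r))
      (dilateDeriv r) (extChartAt cotangentModel ζ ζ) := by
    refine (dilateDeriv r).hasFDerivAt.congr_of_eventuallyEq ?_
    filter_upwards [(isOpen_extChartAt_target ζ).mem_nhds hz] with z hz'
    simp only [writtenInExtChartAt, Function.comp_apply]
    rw [extChartAt_dilate, cotangentChart_dilate, (extChartAt cotangentModel ζ).right_inv hz']
    rfl
  refine ⟨?_, h.hasFDerivWithinAt⟩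
  have h1 : Continuous (fun q : ℝ × Cotangent M => dilate q.1 q.2) := contMDiff_dilate.continuous
  exact (h1.comp (Continuous.prodMk_right r)).continuousAt

theorem hasDerivAt_cotangentChart_dilate (ζ₀ ζ : Cotangent M) (r : ℝ) :
    HasDerivAt (fun t : ℝ => extChartAt cotangentModel ζ₀ (dilate t ζ))
      (0, (extChartAt cotangentModel ζ₀ ζ).2) r := by
  have h : (fun t : ℝ => extChartAt cotangentModel ζ₀ (dilate t ζ)) =
      fun t : ℝ => ((extChartAt cotangentModel ζ₀ ζ).1, t • (extChartAt cotangentModel ζ₀ ζ).2) :=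
    funext fun t => cotangentChart_dilate _ _ _
  rw [h]
  have h2 := (hasDerivAt_id r).smul_const (extChartAt cotangentModel ζ₀ ζ).2
  rw [one_smul] at h2
  exact (hasDerivAt_const r _).prodMk h2

theorem cotangentDiff_eq_fderiv {f : Cotangent M → ℝ} {ζ : Cotangent M}
    (hf : ContMDiffAt cotangentModel 𝓘(ℝ, ℝ) ∞ f ζ) :
    cotangentDiff f ζ = fderiv ℝ (f ∘ (extChartAt cotangentModel ζ).symm)
      (extChartAt cotangentModel ζ ζ) := by
  rw [cotangentDiff_eq_chart hf (mem_chart_source _ _), chartDeriv_self]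
  rfl

/-- The derivative of a function along a differentiable curve, read in the chart centred at the
base point. -/
theorem hasDerivWithinAt_of_cotangentChart {f : Cotangent M → ℝ} {γ : ℝ → Cotangent M} {J : Set ℝ}
    {t : ℝ} {v : Plane × DualPlane} (hf : ContMDiffAt cotangentModel 𝓘(ℝ, ℝ) ∞ f (γ t))
    (hγ : HasDerivWithinAt (fun s => extChartAt cotangentModel (γ t) (γ s)) v J t)
    (hs : ∀ᶠ s in 𝓝[J] t, γ s ∈ (extChartAt cotangentModel (γ t)).source) :
    HasDerivWithinAt (fun s => f (γ s)) (cotangentDiff f (γ t) v) J t := by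
  have h1 : HasFDerivAt (f ∘ (extChartAt cotangentModel (γ t)).symm) (cotangentDiff f (γ t))
      (extChartAt cotangentModel (γ t) (γ t)) := by
    rw [cotangentDiff_eq_fderiv hf]
    exact ((hf.comp_extChartAt_symm (mem_chart_source _ _)).differentiableAt
      (by simp)).hasFDerivAt
  refine (h1.comp_hasDerivWithinAt t hγ).congr_of_eventuallyEq ?_ ?_
  · filter_upwards [hs] with s hs
    simp only [Function.comp_apply]
    rw [PartialEquiv.left_inv _ hs]
  · simp only [Function.comp_apply]
    rw [PartialEquiv.left_inv _ (mem_extChartAt_source _)]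

theorem hasDerivAt_comp_dilate {f : Cotangent M → ℝ} {ζ : Cotangent M}
    (hf : ContMDiffAt cotangentModel 𝓘(ℝ, ℝ) ∞ f ζ) :
    HasDerivAt (fun t : ℝ => f (dilate t ζ)) (cotangentDiff f ζ (radialField ζ)) 1 := by
  have h := hasDerivAt_cotangentChart_dilate ζ ζ 1
  rw [cotangentChart_snd_self] at h
  have h1 : HasDerivWithinAt (fun t : ℝ => f (dilate t ζ))
      (cotangentDiff f (dilate 1 ζ) (radialField ζ)) univ 1 := by
    refine hasDerivWithinAt_of_cotangentChart ?_ ?_ ?_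
    · rwa [dilate_one]
    · rw [dilate_one]
      exact h.hasDerivWithinAt
    · exact Eventually.of_forall fun s => mem_cotangentChart_source.2 (mem_chart_source _ _)
  rw [dilate_one, hasDerivWithinAt_univ] at h1
  exact h1

theorem symplecticForm_radialField (ζ : Cotangent M) (v : Plane × DualPlane) :
    symplecticForm (radialField ζ) v = ζ.2 v.1 := by
  simp [symplecticForm, radialField]
  rfl

end Dilations

/-! ### Functions of order zero -/

section OrderZero

variable {M : Type*} [TopologicalSpace M] [ChartedSpace Plane M] [IsManifold 𝓘(ℝ, Plane) ∞ M]
  {p : Cotangent M → ℝ}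

theorem IsSymbolOrderZero.contMDiffAt (hp : IsSymbolOrderZero p) {ζ : Cotangent M}
    (hζ : ζ ∈ puncturedCotangent M) : ContMDiffAt cotangentModel 𝓘(ℝ, ℝ) ∞ p ζ :=
  hp.smooth.contMDiffAt (isOpen_puncturedCotangent.mem_nhds hζ)

theorem IsSymbolOrderZero.cotangentDiff_radialField (hp : IsSymbolOrderZero p) {ζ : Cotangent M}
    (hζ : ζ ∈ puncturedCotangent M) : cotangentDiff p ζ (radialField ζ) = 0 := by
  refine (hasDerivAt_comp_dilate (hp.contMDiffAt hζ)).unique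
    ((hasDerivAt_const (1 : ℝ) (p ζ)).congr_of_eventuallyEq ?_)
  filter_upwards [lt_mem_nhds one_pos] with t ht
  exact hp.homogeneous ζ hζ t ht

/-- The Liouville form vanishes on the Hamiltonian field of a function of order zero. -/
theorem IsSymbolOrderZero.liouville_hamiltonianField (hp : IsSymbolOrderZero p) {ζ : Cotangent M}
    (hζ : ζ ∈ puncturedCotangent M) : ζ.2 (hamiltonianField p ζ).1 = 0 := by
  rw [← symplecticForm_radialField, symplecticForm_swap, hamiltonianField_eq,
    symplecticForm_hamiltonianVector, hp.cotangentDiff_radialField hζ]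
  simp

theorem cotangentDiff_hamiltonianField_self (p : Cotangent M → ℝ) (ζ : Cotangent M) :
    cotangentDiff p ζ (hamiltonianField p ζ) = 0 := by
  have := symplecticForm_hamiltonianVector (cotangentDiff p ζ) (hamiltonianField p ζ)
  rw [← hamiltonianField_eq, symplecticForm_self] at this
  linarith

theorem IsSymbolOrderZero.cotangentDiff_dilate (hp : IsSymbolOrderZero p) {ζ : Cotangent M}
    (hζ : ζ ∈ puncturedCotangent M) {r : ℝ} (hr : 0 < r) (v : Plane × DualPlane) :
    cotangentDiff p (dilate r ζ) (dilateDeriv r v) = cotangentDiff p ζ v := by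
  have h1 : HasMFDerivAt cotangentModel 𝓘(ℝ, ℝ) p (dilate r ζ) (cotangentDiff p (dilate r ζ)) :=
    ((hp.contMDiffAt (dilate_mem hζ hr.ne')).mdifferentiableAt (by simp)).hasMFDerivAt
  have h2 := h1.comp ζ (hasMFDerivAt_dilate r ζ)
  have h3 : HasMFDerivAt cotangentModel 𝓘(ℝ, ℝ) p ζ (cotangentDiff p ζ) :=
    ((hp.contMDiffAt hζ).mdifferentiableAt (by simp)).hasMFDerivAt
  have h4 : HasMFDerivAt cotangentModel 𝓘(ℝ, ℝ) (p ∘ dilate r) ζ (cotangentDiff p ζ) := by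
    refine h3.congr_of_eventuallyEq ?_
    filter_upwards [isOpen_puncturedCotangent.mem_nhds hζ] with ζ' hζ'
    exact hp.homogeneous ζ' hζ' r hr
  exact congrArg (fun A : Plane × DualPlane →L[ℝ] ℝ => A v) (hasMFDerivAt_unique h2 h4)

theorem IsSymbolOrderZero.hamiltonianField_dilate (hp : IsSymbolOrderZero p) {ζ : Cotangent M}
    (hζ : ζ ∈ puncturedCotangent M) {r : ℝ} (hr : 0 < r) :
    r • hamiltonianField p (dilate r ζ) = dilateDeriv r (hamiltonianField p ζ) := by
  refine eq_of_symplecticForm fun w => ?_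
  have hw : w = dilateDeriv r (w.1, r⁻¹ • w.2) := by
    simp [smul_smul, mul_inv_cancel₀ hr.ne']
  rw [symplecticForm_smul_left, hamiltonianField_eq, symplecticForm_hamiltonianVector]
  conv_lhs => rw [hw, hp.cotangentDiff_dilate hζ hr]
  have h := symplecticForm_hamiltonianVector (cotangentDiff p ζ) (w.1, r⁻¹ • w.2)
  rw [← hamiltonianField_eq] at h
  rw [← h]
  simp only [symplecticForm, dilateDeriv_apply, smul_apply, smul_eq_mul]
  field_simp

end OrderZero

/-! ### The function `Φ` of a family of Lagrangians -/

section LagrangianFamilies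

variable {M : Type*} [TopologicalSpace M] [ChartedSpace Plane M] [IsManifold 𝓘(ℝ, Plane) ∞ M]
  {p : Cotangent M → ℝ}

/-- A smooth function that vanishes on a hypersurface has a differential proportional to that of
a defining function. -/
theorem exists_cotangentDiff_eq_smul {f G : Cotangent M → ℝ} {ζ : Cotangent M}
    (hf : ContMDiffAt cotangentModel 𝓘(ℝ, ℝ) ∞ f ζ)
    (hG : ContMDiffAt cotangentModel 𝓘(ℝ, ℝ) ∞ G ζ) (hG0 : cotangentDiff G ζ ≠ 0)
    (hGζ : G ζ = 0) (h : ∀ᶠ ζ' in 𝓝 ζ, G ζ' = 0 → f ζ' = 0) :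
    ∃ k : ℝ, cotangentDiff f ζ = k • cotangentDiff G ζ := by
  set c := extChartAt cotangentModel ζ with hc
  have hstrict : ∀ u : Cotangent M → ℝ, ContMDiffAt cotangentModel 𝓘(ℝ, ℝ) ∞ u ζ →
      HasStrictFDerivAt (u ∘ c.symm) (cotangentDiff u ζ) (c ζ) := fun u hu => by
    rw [cotangentDiff_eq_fderiv hu]
    exact (hu.comp_extChartAt_symm (mem_chart_source _ ζ)).hasStrictFDerivAt (by simp)
  have hinv : c.symm (c ζ) = ζ := extChartAt_to_inv ζ
  have hlc : ∀ᶠ z in 𝓝 (c ζ), G (c.symm z) = 0 → f (c.symm z) = 0 := by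
    have hcont : ContinuousAt c.symm (c ζ) := continuousAt_extChartAt_symm ζ
    rw [ContinuousAt, hinv] at hcont
    exact hcont.eventually h
  have hext : IsLocalExtrOn (f ∘ c.symm) {z | (G ∘ c.symm) z = (G ∘ c.symm) (c ζ)} (c ζ) := by
    left
    filter_upwards [eventually_nhdsWithin_of_eventually_nhds hlc, self_mem_nhdsWithin] with z h1 h2
    simp only [Function.comp_apply, hinv, hGζ] at h2 ⊢
    rw [h1 h2, h.self_of_nhds hGζ]
  obtain ⟨a, b, hab, hsum⟩ := hext.exists_multipliers_of_hasStrictFDerivAt_1d (hstrict G hG)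
    (hstrict f hf)
  have hb : b ≠ 0 := by
    rintro rfl
    have : a ≠ 0 := fun h => hab (by rw [h]; rfl)
    rw [zero_smul, add_zero] at hsum
    exact hG0 ((smul_eq_zero.1 hsum).resolve_left this)
  refine ⟨-(b⁻¹ * a), ?_⟩
  have h2 : b • cotangentDiff f ζ = -(a • cotangentDiff G ζ) := by
    rw [eq_neg_iff_add_eq_zero, add_comm]
    exact hsum
  rw [neg_smul, mul_smul, ← smul_neg, ← h2, smul_smul, inv_mul_cancel₀ hb, one_smul]

theorem IsDefiningFunction.contMDiffAt {Λ U : Set (Cotangent M)} {G : Cotangent M → ℝ}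
    (hG : IsDefiningFunction Λ U G) {ζ : Cotangent M} (hζ : ζ ∈ U) :
    ContMDiffAt cotangentModel 𝓘(ℝ, ℝ) ∞ G ζ :=
  hG.smooth.contMDiffAt (hG.isOpen.mem_nhds hζ)

theorem IsDefiningFunction.exists_cotangentDiff_eq {Λ U U' : Set (Cotangent M)}
    {G G' : Cotangent M → ℝ} (hG : IsDefiningFunction Λ U G) (hG' : IsDefiningFunction Λ U' G')
    {ζ : Cotangent M} (hζ : ζ ∈ U) (hζ' : ζ ∈ U') (hΛ : ζ ∈ Λ) :
    ∃ k : ℝ, cotangentDiff G ζ = k • cotangentDiff G' ζ := by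
  refine exists_cotangentDiff_eq_smul (hG.contMDiffAt hζ) (hG'.contMDiffAt hζ')
    (hG'.diff_ne_zero ζ hζ' hΛ) ((hG'.zero_iff ζ hζ').1 hΛ) ?_
  filter_upwards [hG.isOpen.mem_nhds hζ, hG'.isOpen.mem_nhds hζ'] with ξ h1 h2 h3
  exact (hG.zero_iff ξ h1).1 ((hG'.zero_iff ξ h2).2 h3)

/-- The radial field is tangent to a conic hypersurface. -/
theorem IsDefiningFunction.cotangentDiff_radialField {Λ U : Set (Cotangent M)}
    {G : Cotangent M → ℝ} (hG : IsDefiningFunction Λ U G) (hΛ : IsConic Λ) {ζ : Cotangent M}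
    (hζU : ζ ∈ U) (hζ : ζ ∈ Λ) : cotangentDiff G ζ (radialField ζ) = 0 := by
  refine (hasDerivAt_comp_dilate (hG.contMDiffAt hζU)).unique
    ((hasDerivAt_const (1 : ℝ) (0 : ℝ)).congr_of_eventuallyEq ?_)
  have hcont : ContinuousAt (fun t : ℝ => dilate t ζ) 1 := by
    have h1 : Continuous (fun q : ℝ × Cotangent M => dilate q.1 q.2) := contMDiff_dilate.continuous
    exact (h1.comp (Continuous.prodMk_left ζ)).continuousAt
  have hU : ∀ᶠ t : ℝ in 𝓝 1, dilate t ζ ∈ U :=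
    hcont.eventually_mem (by
      rw [dilate_one]
      exact hG.isOpen.mem_nhds hζU)
  filter_upwards [lt_mem_nhds one_pos, hU] with t ht htU
  exact (hG.zero_iff _ htU).1 (hΛ ζ hζ t ht)

theorem IsLagrangianFamily.exists_radialField_eq (hp : IsSymbolOrderZero p)
    {Λ U : Set (Cotangent M)} {G : Cotangent M → ℝ} (hΛ : IsLagrangianFamily p Λ)
    (hG : IsDefiningFunction Λ U G) {ζ : Cotangent M} (hζU : ζ ∈ U) (hζ : ζ ∈ Λ) :
    ∃ a b : ℝ, radialField ζ = a • hamiltonianField p ζ + b • hamiltonianField G ζ := by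
  obtain ⟨v, hv2, hv1⟩ := hΛ.diff_ne_zero ζ hζ U G hζU hG
  have h12 := hΛ.tangent ζ hζ U G hζU hG
  rw [hamiltonianField_eq] at h12
  simp only [hamiltonianField_eq]
  exact exists_eq_hamiltonianVector (hG.diff_ne_zero ζ hζU hζ) hv1 hv2 h12
    (hp.cotangentDiff_radialField (hΛ.subset hζ)) (hG.cotangentDiff_radialField hΛ.conic hζU hζ)

theorem IsLagrangianFamily.exists_isPhi (hp : IsSymbolOrderZero p) {Λ : Set (Cotangent M)}
    (hΛ : IsLagrangianFamily p Λ) : ∃ Φ : Cotangent M → ℝ, IsPhi p Λ Φ := by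
  have h : ∀ ζ, ∃ a : ℝ, ζ ∈ Λ → ∀ U G, ζ ∈ U → IsDefiningFunction Λ U G →
      ∃ b : ℝ, radialField ζ = a • hamiltonianField p ζ + b • hamiltonianField G ζ := by
    intro ζ
    by_cases hζ : ζ ∈ Λ
    · obtain ⟨U₀, G₀, hU₀, hG₀⟩ := hΛ.hypersurface ζ hζ
      obtain ⟨a, b, hab⟩ := hΛ.exists_radialField_eq hp hG₀ hU₀ hζ
      refine ⟨a, fun _ U G hU hG => ?_⟩
      obtain ⟨k, hk⟩ := hG₀.exists_cotangentDiff_eq hG hU₀ hU hζ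
      refine ⟨b * k, ?_⟩
      rw [hab, hamiltonianField_eq G₀, hamiltonianField_eq G, hk, map_smul, mul_smul]
    · exact ⟨0, fun h => absurd h hζ⟩
  choose Φ hΦ using h
  refine ⟨Φ, fun U G hG => ?_⟩
  have h : ∀ ζ, ∃ b : ℝ, ζ ∈ Λ ∩ U →
      radialField ζ = Φ ζ • hamiltonianField p ζ + b • hamiltonianField G ζ := by
    intro ζ
    by_cases hζ : ζ ∈ Λ ∩ U
    · obtain ⟨b, hb⟩ := hΦ ζ hζ.1 U G hζ.2 hG
      exact ⟨b, fun _ => hb⟩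
    · exact ⟨0, fun h => absurd h hζ⟩
  choose Θ hΘ using h
  exact ⟨Θ, hΘ⟩

/-- The value of `Φ`, computed from a tangent vector of `Λ`. -/
theorem IsPhi.liouville_eq {Λ U : Set (Cotangent M)} {Φ G : Cotangent M → ℝ}
    (hΦ : IsPhi p Λ Φ) (hG : IsDefiningFunction Λ U G) {ζ : Cotangent M} (hζU : ζ ∈ U)
    (hζ : ζ ∈ Λ) {v : Plane × DualPlane} (hv : cotangentDiff G ζ v = 0) :
    ζ.2 v.1 = -Φ ζ * cotangentDiff p ζ v := by
  obtain ⟨Θ, hΘ⟩ := hΦ U G hG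
  have hadd : ∀ a b w : Plane × DualPlane,
      symplecticForm (a + b) w = symplecticForm a w + symplecticForm b w := fun a b w => by
    simp [symplecticForm]
    ring
  rw [← symplecticForm_radialField, hΘ ζ ⟨hζ, hζU⟩, hadd, symplecticForm_smul_left,
    symplecticForm_smul_left, hamiltonianField_eq, hamiltonianField_eq,
    symplecticForm_hamiltonianVector, symplecticForm_hamiltonianVector, hv]
  ring

theorem IsLagrangianFamily.isPhi_unique {Λ : Set (Cotangent M)}
    (hΛ : IsLagrangianFamily p Λ) {Φ Φ' : Cotangent M → ℝ} (hΦ : IsPhi p Λ Φ)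
    (hΦ' : IsPhi p Λ Φ') : EqOn Φ Φ' Λ := by
  intro ζ hζ
  obtain ⟨U, G, hU, hG⟩ := hΛ.hypersurface ζ hζ
  obtain ⟨v, hv2, hv1⟩ := hΛ.diff_ne_zero ζ hζ U G hU hG
  have h := (hΦ.liouville_eq hG hU hζ hv2).symm.trans (hΦ'.liouville_eq hG hU hζ hv2)
  have := mul_right_cancel₀ hv1 h
  linarith

end LagrangianFamilies

/-! ### Generating functions -/

section GeneratingFunctions

variable {M : Type*} [TopologicalSpace M] [ChartedSpace Plane M] [IsManifold 𝓘(ℝ, Plane) ∞ M]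
  {p : Cotangent M → ℝ}

/-- Euler's identity for functions that are homogeneous of order one. -/
theorem inner_gradient_of_homogeneous {f : Plane → ℝ} {ξ : Plane} (hf : DifferentiableAt ℝ f ξ)
    (hh : ∀ t : ℝ, 0 < t → f (t • ξ) = t * f ξ) : ⟪ξ, gradient f ξ⟫_ℝ = f ξ := by
  have h1 : HasFDerivAt f (fderiv ℝ f ξ) ((1 : ℝ) • ξ) := by
    rw [one_smul]
    exact hf.hasFDerivAt
  have h2 : HasDerivAt (fun t : ℝ => t • ξ) ξ 1 := by
    simpa using (hasDerivAt_id (1 : ℝ)).smul_const ξ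
  have h3 := h1.comp_hasDerivAt (1 : ℝ) h2
  have h4 : HasDerivAt (fun t : ℝ => t * f ξ) (f ξ) 1 := by
    simpa using (hasDerivAt_id (1 : ℝ)).mul_const (f ξ)
  have h5 := h3.unique (h4.congr_of_eventuallyEq (by
    filter_upwards [lt_mem_nhds one_pos] with t ht using hh t ht))
  rw [real_inner_comm, gradient, InnerProductSpace.toDual_symm_apply]
  exact h5

/-- Partial gradients of a smooth function on `J × Γ₀` depend differentiably on the parameter. -/
theorem differentiableWithinAt_gradient {F : ℝ → Plane → ℝ} {J : Set ℝ} {Γ₀ : Set Plane}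
    (hJ : UniqueDiffOn ℝ J) (hΓ : IsOpen Γ₀)
    (hF : ContDiffOn ℝ ∞ (fun q : ℝ × Plane => F q.1 q.2) (J ×ˢ Γ₀)) {w : ℝ} (hw : w ∈ J)
    {ξ : Plane} (hξ : ξ ∈ Γ₀) :
    (∀ w' ∈ J, DifferentiableAt ℝ (F w') ξ) ∧
      DifferentiableWithinAt ℝ (fun w' => gradient (F w') ξ) J w := by
  have hu : UniqueDiffOn ℝ (J ×ˢ Γ₀) := hJ.prod hΓ.uniqueDiffOn
  set f : ℝ × Plane → ℝ := fun q => F q.1 q.2 with hf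
  have hd : ∀ w' ∈ J, HasFDerivAt (F w')
      ((fderivWithin ℝ f (J ×ˢ Γ₀) (w', ξ)).comp (ContinuousLinearMap.inr ℝ ℝ Plane)) ξ := by
    intro w' hw'
    have h1 : HasFDerivWithinAt f (fderivWithin ℝ f (J ×ˢ Γ₀) (w', ξ)) (J ×ˢ Γ₀) (w', ξ) :=
      ((hF.differentiableOn (by simp)) _ ⟨hw', hξ⟩).hasFDerivWithinAt
    have h2 : HasFDerivWithinAt (fun y : Plane => (w', y))
        (ContinuousLinearMap.inr ℝ ℝ Plane) Γ₀ ξ :=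
      (hasFDerivAt_prodMk_right w' ξ).hasFDerivWithinAt
    exact (h1.comp ξ h2 fun y hy => ⟨hw', hy⟩).hasFDerivAt (hΓ.mem_nhds hξ)
  refine ⟨fun w' hw' => (hd w' hw').differentiableAt, ?_⟩
  have h3 : DifferentiableWithinAt ℝ (fderivWithin ℝ f (J ×ˢ Γ₀)) (J ×ˢ Γ₀) (w, ξ) :=
    ((hF.fderivWithin hu (m := 1) (by rw [one_add_one_eq_two]; exact ENat.LEInfty.out)
      ).differentiableOn (by simp)) _ ⟨hw, hξ⟩
  have h4 : DifferentiableWithinAt ℝ (fun w' : ℝ => (w', ξ)) J w :=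
    (hasFDerivAt_prodMk_left w ξ).differentiableAt.differentiableWithinAt
  have h5 : DifferentiableWithinAt ℝ (fun w' => fderivWithin ℝ f (J ×ˢ Γ₀) (w', ξ)) J w :=
    h3.comp w h4 fun y hy => mk_mem_prod hy hξ
  have h6 : DifferentiableWithinAt ℝ (fun w' => (InnerProductSpace.toDual ℝ Plane).symm
      ((fderivWithin ℝ f (J ×ˢ Γ₀) (w', ξ)).comp (ContinuousLinearMap.inr ℝ ℝ Plane))) J w := by
    have h7 := (h5.clm_comp (differentiableWithinAt_const (ContinuousLinearMap.inr ℝ ℝ Plane)))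
    exact ((InnerProductSpace.toDual ℝ Plane).symm.toContinuousLinearEquiv.differentiable
      _).comp_differentiableWithinAt w h7
  refine h6.congr (fun w' hw' => ?_) ?_
  · rw [gradient, (hd w' hw').fderiv]
  · rw [gradient, (hd w hw).fderiv]

/-- The covector with coordinates `(x, ξ)` in a coordinate system `e`, read in another chart. -/
theorem cotangentChart_ofCoordinates {e : OpenPartialHomeomorph M Plane}
    (he : e ∈ IsManifold.maximalAtlas 𝓘(ℝ, Plane) ∞ M) {ζ₀ : Cotangent M} {x ξ : Plane}
    (hx : x ∈ e.target) (hx' : e.symm x ∈ (chartAt Plane ζ₀.1).source) :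
    extChartAt cotangentModel ζ₀ (ofCoordinates e x ξ) =
      (extChartAt 𝓘(ℝ, Plane) ζ₀.1 (e.symm x), (innerSL ℝ ξ).comp
        (fderiv ℝ (e ∘ (extChartAt 𝓘(ℝ, Plane) ζ₀.1).symm)
          (extChartAt 𝓘(ℝ, Plane) ζ₀.1 (e.symm x)))) := by
  refine Prod.ext (cotangentChart_fst _ _) ?_
  have hes : ContMDiffAt 𝓘(ℝ, Plane) 𝓘(ℝ, Plane) ∞ e (e.symm x) :=
    (contMDiffOn_of_mem_maximalAtlas he).contMDiffAt (e.open_source.mem_nhds (e.map_target hx))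
  ext w
  obtain ⟨u, hu⟩ := (isInvertible_mfderiv_extChartAt (I := 𝓘(ℝ, Plane)) (x := ζ₀.1)
    (y := e.symm x) (by rwa [extChartAt_source])).bijective.2 w
  have h1 := cotangentChart_snd_mfderiv (ζ₀ := ζ₀) (ζ := ofCoordinates e x ξ) hx' u
  have h2 := mfderiv_eq_fderiv_comp_extChartAt hes hx'
  rw [← hu]
  refine h1.trans ?_
  change ⟪ξ, mfderiv 𝓘(ℝ, Plane) 𝓘(ℝ, Plane) e (e.symm x) u⟫_ℝ = _
  rw [h2]
  rfl

/-- The derivative of a generating function in the parameter is `-Φ`: the curve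
`w ↦ (∂_ξ F(w, ξ), ξ)` in `Λ` has velocity `v` with `dp(v) = 1`, and the Liouville form of `v` is
the derivative of `⟨ξ, ∂_ξ F(w, ξ)⟩ = F(w, ξ)`. -/
theorem IsGeneratingFunction.hasDerivWithinAt (hp : IsSymbolOrderZero p)
    {Λ U : Set (Cotangent M)} (hΛ : IsLagrangianFamily p Λ) {Φ : Cotangent M → ℝ}
    (hΦ : IsPhi p Λ Φ) {e : OpenPartialHomeomorph M Plane} {J : Set ℝ} {Γ₀ : Set Plane}
    {F : ℝ → Plane → ℝ} (hF : IsGeneratingFunction p Λ U e J Γ₀ F) {w : ℝ} (hw : w ∈ J)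
    {ξ : Plane} (hξ : ξ ∈ Γ₀) :
    HasDerivWithinAt (fun w' => F w' ξ)
      (-Φ (ofCoordinates e (gradient (F w) ξ) ξ)) J w := by
  have hJ : UniqueDiffOn ℝ J := uniqueDiffOn_convex hF.interval.convex hF.nondegenerate
  obtain ⟨hFd, hyd⟩ := differentiableWithinAt_gradient hJ hF.cone_isOpen hF.smooth hw hξ
  set y : ℝ → Plane := fun w' => gradient (F w') ξ with hy
  obtain ⟨y', hy'⟩ : ∃ y', HasDerivWithinAt y y' J w := ⟨_, hyd.hasDerivWithinAt⟩
  set γ : ℝ → Cotangent M := fun w' => ofCoordinates e (y w') ξ with hγ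
  have hmem : ∀ w' ∈ J, γ w' ∈ Λ ∩ p ⁻¹' {w'} ∩ U := by
    intro w' hw'
    rw [hF.eq_graph w' hw']
    exact ⟨ξ, hξ, rfl⟩
  have hγΛ : γ w ∈ Λ := (hmem w hw).1.1
  obtain ⟨V, G, hV, hG⟩ := hΛ.hypersurface _ hγΛ
  -- the curve, read in the chart of `T*M` centred at its point
  set b := extChartAt 𝓘(ℝ, Plane) (γ w).1 with hb
  set u : ℝ → Plane := fun w' => b (e.symm (y w')) with hu
  set h : Plane → Plane := e ∘ b.symm with hh
  have htgt : y w ∈ e.target := hF.mem_target w hw ξ hξ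
  have hsymm : ContMDiffAt 𝓘(ℝ, Plane) 𝓘(ℝ, Plane) ∞ e.symm (y w) :=
    (contMDiffOn_symm_of_mem_maximalAtlas hF.chart).contMDiffAt (e.open_target.mem_nhds htgt)
  have hbe : ContMDiffAt 𝓘(ℝ, Plane) 𝓘(ℝ, Plane) ∞ (b ∘ e.symm) (y w) :=
    ContMDiffAt.comp (y w) (g := b) (contMDiffAt_extChartAt (x := (γ w).1)) hsymm
  have hud : DifferentiableWithinAt ℝ u J w :=
    (hbe.contDiffAt.differentiableAt (by simp)).comp_differentiableWithinAt w hyd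
  have hes : ContMDiffAt 𝓘(ℝ, Plane) 𝓘(ℝ, Plane) ∞ e (γ w).1 :=
    (contMDiffOn_of_mem_maximalAtlas hF.chart).contMDiffAt
      (e.open_source.mem_nhds (e.map_target htgt))
  have hhs : ContDiffAt ℝ ∞ h (u w) := hes.comp_extChartAt_symm (mem_chart_source _ _)
  have hsrc : ∀ᶠ w' in 𝓝[J] w, e.symm (y w') ∈ (chartAt Plane (γ w).1).source :=
    (hsymm.continuousAt.comp_continuousWithinAt hyd.continuousWithinAt).eventually_mem
      ((chartAt Plane (γ w).1).open_source.mem_nhds (mem_chart_source _ _))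
  have hsrc' : ∀ᶠ w' in 𝓝[J] w, γ w' ∈ (extChartAt cotangentModel (γ w)).source :=
    hsrc.mono fun w' h => mem_cotangentChart_source.2 h
  obtain ⟨u', hu'⟩ : ∃ u', HasDerivWithinAt u u' J w := ⟨_, hud.hasDerivWithinAt⟩
  have hfd : DifferentiableAt ℝ (fderiv ℝ h) (u w) :=
    (hhs.fderiv_right (m := 1) (by rw [one_add_one_eq_two]; exact ENat.LEInfty.out)
      ).differentiableAt (by simp)
  obtain ⟨A', hA'⟩ : ∃ A',
      HasDerivWithinAt (fun w' => (innerSL ℝ ξ).comp (fderiv ℝ h (u w'))) A' J w :=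
    ⟨_, ((differentiableWithinAt_const _).clm_comp
      (hfd.comp_differentiableWithinAt w hud)).hasDerivWithinAt⟩
  have heq : ∀ w' ∈ J, e.symm (y w') ∈ (chartAt Plane (γ w).1).source →
      extChartAt cotangentModel (γ w) (γ w') =
        (u w', (innerSL ℝ ξ).comp (fderiv ℝ h (u w'))) := fun w' hw' hs =>
    cotangentChart_ofCoordinates hF.chart (hF.mem_target w' hw' ξ hξ) hs
  have hz : HasDerivWithinAt (fun w' => extChartAt cotangentModel (γ w) (γ w')) (u', A') J w := by
    refine (hu'.prodMk hA').congr_of_eventuallyEq ?_ (heq w hw (mem_chart_source _ _))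
    filter_upwards [hsrc, self_mem_nhdsWithin] with w' hs hw'
    exact heq w' hw' hs
  have hdp : cotangentDiff p (γ w) (u', A') = 1 := by
    have h1 := hasDerivWithinAt_of_cotangentChart (γ := γ) (hp.contMDiffAt (hΛ.subset hγΛ)) hz hsrc'
    have h2 : HasDerivWithinAt (fun w' => p (γ w')) 1 J w :=
      (hasDerivWithinAt_id w J).congr (fun w' hw' => (hmem w' hw').1.2) (hmem w hw).1.2
    exact (hJ w hw).eq_deriv _ h1 h2
  have hdG : cotangentDiff G (γ w) (u', A') = 0 := by
    have h1 := hasDerivWithinAt_of_cotangentChart (γ := γ) (hG.contMDiffAt hV) hz hsrc'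
    have hzc := hz.continuousWithinAt
    have hγV : ∀ᶠ w' in 𝓝[J] w, γ w' ∈ V := by
      have h3 : ContinuousAt (extChartAt cotangentModel (γ w)).symm
          (extChartAt cotangentModel (γ w) (γ w)) := continuousAt_extChartAt_symm _
      have h4 := (ContinuousAt.comp_continuousWithinAt
        (f := fun w' => extChartAt cotangentModel (γ w) (γ w')) h3 hzc).eventually_mem (s := V)
        (by
          rw [Function.comp_apply, extChartAt_to_inv]
          exact hG.isOpen.mem_nhds hV)
      filter_upwards [h4, hsrc'] with w' h5 h6
      rwa [Function.comp_apply, PartialEquiv.left_inv _ h6] at h5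
    have h2 : HasDerivWithinAt (fun w' => G (γ w')) 0 J w := by
      refine (hasDerivWithinAt_const w J (0 : ℝ)).congr_of_eventuallyEq ?_
        ((hG.zero_iff _ hV).1 hγΛ)
      filter_upwards [hγV, self_mem_nhdsWithin] with w' h5 h6
      exact (hG.zero_iff _ h5).1 (hmem w' h6).1.1
    exact (hJ w hw).eq_deriv _ h1 h2
  have hα : (γ w).2 u' = ⟪ξ, y'⟫_ℝ := by
    have h1 : HasDerivWithinAt (h ∘ u) (fderiv ℝ h (u w) u') J w :=
      (hhs.differentiableAt (by simp)).hasFDerivAt.comp_hasDerivWithinAt w hu'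
    have h2 : ∀ w' ∈ J, e.symm (y w') ∈ (chartAt Plane (γ w).1).source → y w' = h (u w') := by
      intro w' hw' hs
      have h3 : b.symm (b (e.symm (y w'))) = e.symm (y w') :=
        b.left_inv (by rwa [hb, extChartAt_source])
      simp only [hh, hu, Function.comp_apply]
      rw [h3, e.right_inv (hF.mem_target w' hw' ξ hξ)]
    have h3 : HasDerivWithinAt y (fderiv ℝ h (u w) u') J w := by
      refine h1.congr_of_eventuallyEq ?_ (h2 w hw (mem_chart_source _ _))
      filter_upwards [hsrc, self_mem_nhdsWithin] with w' hs hw'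
      exact h2 w' hw' hs
    rw [(hJ w hw).eq_deriv _ hy' h3]
    have h4 := cotangentChart_snd_self (γ w)
    rw [heq w hw (mem_chart_source _ _)] at h4
    exact (congrArg (fun B : DualPlane => B u') h4).symm
  have hΦw := hΦ.liouville_eq hG hV hγΛ hdG
  rw [hdp, mul_one, hα] at hΦw
  have hE : ∀ w' ∈ J, F w' ξ = ⟪ξ, y w'⟫_ℝ := fun w' hw' =>
    (inner_gradient_of_homogeneous (hFd w' hw') (hF.homogeneous w' hw' ξ hξ)).symm
  rw [← hΦw]
  have h5 : HasDerivWithinAt (fun w' => ⟪ξ, y w'⟫_ℝ) ⟪ξ, y'⟫_ℝ J w :=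
    ((innerSL ℝ ξ).hasFDerivAt (x := y w)).comp_hasDerivWithinAt w hy'
  exact h5.congr hE (hE w hw)

end GeneratingFunctions

/-! ### Dual norms -/

section DualNorm

/-- The norm dual to a positive definite quadratic form. -/
theorem isLUB_of_symm_pos {E : Type*} [AddCommGroup E] [Module ℝ E] (B : E → E →ₗ[ℝ] ℝ)
    (hsymm : ∀ v w, B v w = B w v) (hpos : ∀ v, v ≠ 0 → 0 < B v v) (u : E) :
    IsLUB {r : ℝ | ∃ v, B v v ≤ 1 ∧ r = B u v} (Real.sqrt (B u u)) := by
  have h0 : ∀ v, 0 ≤ B v v := fun v => by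
    by_cases hv : v = 0
    · simp [hv]
    · exact (hpos v hv).le
  by_cases hu : u = 0
  · have hz : ∀ v, B u v = 0 := fun v => by rw [hsymm, hu, map_zero]
    have : {r : ℝ | ∃ v, B v v ≤ 1 ∧ r = B u v} = {0} := by
      ext r
      constructor
      · rintro ⟨v, -, rfl⟩
        exact hz v
      · rintro rfl
        exact ⟨0, by simp, (hz 0).symm⟩
    rw [this, hz, Real.sqrt_zero]
    exact isLUB_singleton
  have hN : 0 < B u u := hpos u hu
  have hs : 0 < Real.sqrt (B u u) := Real.sqrt_pos.2 hN
  have hss : Real.sqrt (B u u) * Real.sqrt (B u u) = B u u := Real.mul_self_sqrt hN.le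
  constructor
  · rintro _ ⟨v, hv, rfl⟩
    refine Real.le_sqrt_of_sq_le ?_
    set t := B u v / B u u with ht
    have h1 := h0 (v - t • u)
    have h2 : B (v - t • u) (v - t • u) = B v v - 2 * t * B u v + t ^ 2 * B u u := by
      have e1 : ∀ w, B (v - t • u) w = B v w - t * B u w := fun w => by
        rw [hsymm, map_sub, map_smul, smul_eq_mul, hsymm w v, hsymm w u]
      rw [e1, map_sub, map_sub, map_smul, map_smul, hsymm v u]
      simp only [smul_eq_mul]
      ring
    have h3 : t * B u u = B u v := div_mul_cancel₀ _ hN.ne'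
    have h4 : t * B u v ≤ 1 := by
      have h5 : t ^ 2 * B u u = t * B u v := by rw [sq, mul_assoc, h3]
      rw [h2, h5] at h1
      linarith
    calc B u v ^ 2 = (t * B u v) * B u u := by rw [sq]; nth_rewrite 1 [← h3]; ring
      _ ≤ 1 * B u u := by gcongr
      _ = B u u := one_mul _
  · intro r hr
    refine hr ⟨(Real.sqrt (B u u))⁻¹ • u, ?_, ?_⟩
    · refine le_of_eq ?_
      have h6 : ∀ r : ℝ, B (r • u) (r • u) = r * (r * B u u) := fun r => by
        rw [map_smul, hsymm (r • u) u, map_smul, smul_eq_mul, smul_eq_mul]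
      have h7 : ∀ s : ℝ, s ≠ 0 → s⁻¹ * (s⁻¹ * (s * s)) = 1 := fun s hs => by field_simp
      rw [h6]
      nth_rewrite 3 [← hss]
      exact h7 _ hs.ne'
    · rw [map_smul, smul_eq_mul, eq_comm, inv_mul_eq_div, div_eq_iff hs.ne']
      exact hss.symm

end DualNorm

/-! ### The norm of covectors -/

section CovectorNorm

variable {M : Type*} [TopologicalSpace M] [ChartedSpace Plane M] [IsManifold 𝓘(ℝ, Plane) ∞ M]
  (g : ContMDiffRiemannianMetric 𝓘(ℝ, Plane) ∞ Plane (fun x : M => TangentSpace 𝓘(ℝ, Plane) x))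

theorem covectorNorm_eq_sqrt {ζ : Cotangent M} {u : TangentSpace 𝓘(ℝ, Plane) ζ.1}
    (hu : ∀ v, g.inner ζ.1 u v = ζ.2 v) : covectorNorm g ζ = Real.sqrt (ζ.2 u) := by
  have h := isLUB_of_symm_pos (fun v => (g.inner ζ.1 v).toLinearMap) (g.symm ζ.1) (g.pos ζ.1) u
  have hne : {r : ℝ | ∃ v : TangentSpace 𝓘(ℝ, Plane) ζ.1, g.inner ζ.1 v v ≤ 1 ∧
      r = g.inner ζ.1 u v}.Nonempty := ⟨_, 0, by simp, rfl⟩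
  have hset : {r : ℝ | ∃ v : TangentSpace 𝓘(ℝ, Plane) ζ.1, g.inner ζ.1 v v ≤ 1 ∧ r = ζ.2 v} =
      {r : ℝ | ∃ v : TangentSpace 𝓘(ℝ, Plane) ζ.1, g.inner ζ.1 v v ≤ 1 ∧
        r = g.inner ζ.1 u v} := by
    ext r
    exact exists_congr fun v => by rw [hu]
  rw [covectorNorm, hset, ← hu]
  exact h.csSup_eq hne

/-- The matrix of the metric in the chart of `M` centred at `x₀`. -/
noncomputable def metricInChart (x₀ x : M) : Plane →L[ℝ] Plane →L[ℝ] ℝ :=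
  (trivializationAt (Plane →L[ℝ] Plane →L[ℝ] ℝ)
    (fun x : M => TangentSpace 𝓘(ℝ, Plane) x →L[ℝ] TangentSpace 𝓘(ℝ, Plane) x →L[ℝ] ℝ) x₀
      ⟨x, g.inner x⟩).2

theorem contMDiffAt_metricInChart (x₀ : M) :
    ContMDiffAt 𝓘(ℝ, Plane) 𝓘(ℝ, Plane →L[ℝ] Plane →L[ℝ] ℝ) ∞ (metricInChart g x₀) x₀ :=
  (contMDiffAt_section x₀).1 g.contMDiff.contMDiffAt

theorem metricInChart_apply {x₀ x : M} (hx : x ∈ (chartAt Plane x₀).source) (v w : Plane) :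
    metricInChart g x₀ x v w =
      g.inner x ((trivializationAt Plane (TangentSpace 𝓘(ℝ, Plane)) x₀).symmL ℝ x v)
        ((trivializationAt Plane (TangentSpace 𝓘(ℝ, Plane)) x₀).symmL ℝ x w) := by
  have h : metricInChart g x₀ x = ContinuousLinearMap.inCoordinates Plane
      (TangentSpace 𝓘(ℝ, Plane)) (Plane →L[ℝ] ℝ)
      (fun x : M => TangentSpace 𝓘(ℝ, Plane) x →L[ℝ] Bundle.Trivial M ℝ x) x₀ x x₀ x
      (g.inner x) :=
    congrArg Prod.snd (hom_trivializationAt_apply (σ := RingHom.id ℝ) (F₁ := Plane)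
      (F₂ := Plane →L[ℝ] ℝ) (E₁ := TangentSpace 𝓘(ℝ, Plane))
      (E₂ := fun x : M => TangentSpace 𝓘(ℝ, Plane) x →L[ℝ] Bundle.Trivial M ℝ x) x₀
      ⟨x, g.inner x⟩)
  have hx' : x ∈ (trivializationAt Plane (TangentSpace 𝓘(ℝ, Plane)) x₀).baseSet := by simpa using hx
  rw [h, inCoordinates_apply_eq₂ hx' hx' (Set.mem_univ _)]
  have e1 : ∀ v : Plane, (trivializationAt Plane (TangentSpace 𝓘(ℝ, Plane)) x₀).symm x v =
      (trivializationAt Plane (TangentSpace 𝓘(ℝ, Plane)) x₀).symmL ℝ x v := fun v =>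
    (Trivialization.symmL_apply _ hx' v).symm
  rw [← e1, ← e1]
  simp

/-- The matrix of the metric is invertible, as it is positive definite. -/
theorem metricInChart_isInvertible {x₀ x : M} (hx : x ∈ (chartAt Plane x₀).source) :
    (metricInChart g x₀ x).IsInvertible := by
  have hx' : x ∈ (trivializationAt Plane (TangentSpace 𝓘(ℝ, Plane)) x₀).baseSet := by simpa using hx
  have hinj : Function.Injective (metricInChart g x₀ x).toLinearMap := by
    rw [injective_iff_map_eq_zero]
    intro v hv
    have h1 : metricInChart g x₀ x v v = 0 := by
      change (metricInChart g x₀ x).toLinearMap v v = 0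
      rw [hv]
      rfl
    rw [metricInChart_apply g hx] at h1
    by_contra hne
    refine (g.pos x _ fun h0 => hne ?_).ne' h1
    have h2 := Trivialization.continuousLinearMapAt_symmL (R := ℝ)
      (trivializationAt Plane (TangentSpace 𝓘(ℝ, Plane)) x₀) hx' v
    rw [h0] at h2
    simpa using h2.symm
  have hdim : Module.finrank ℝ Plane = Module.finrank ℝ (Plane →L[ℝ] ℝ) := by
    have h1 : Module.finrank ℝ DualPlane = Module.finrank ℝ (Module.Dual ℝ Plane) :=
      (LinearMap.toContinuousLinearMap (𝕜 := ℝ) (E := Plane) (F' := ℝ)).finrank_eq.symm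
    rw [h1, Subspace.dual_finrank_eq]
  let L : Plane ≃ₗ[ℝ] (Plane →L[ℝ] ℝ) :=
    LinearEquiv.ofInjectiveOfFinrankEq _ hinj hdim
  exact ⟨L.toContinuousLinearEquiv, by ext; rfl⟩

theorem exists_metric_dual (ζ : Cotangent M) :
    ∃ u : TangentSpace 𝓘(ℝ, Plane) ζ.1, ∀ v, g.inner ζ.1 u v = ζ.2 v := by
  have h0 : ζ.1 ∈ (chartAt Plane ζ.1).source := mem_chart_source _ _
  have h0' : ζ.1 ∈ (trivializationAt Plane (TangentSpace 𝓘(ℝ, Plane)) ζ.1).baseSet := by simp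
  have hT := Trivialization.symmL_continuousLinearMapAt (R := ℝ)
    (trivializationAt Plane (TangentSpace 𝓘(ℝ, Plane)) ζ.1) h0'
  obtain ⟨w, hw⟩ := (metricInChart_isInvertible g h0).bijective.2
    (extChartAt cotangentModel ζ ζ).2
  refine ⟨(trivializationAt Plane (TangentSpace 𝓘(ℝ, Plane)) ζ.1).symmL ℝ ζ.1 w, fun v => ?_⟩
  have h2 := metricInChart_apply g h0 w
    ((trivializationAt Plane (TangentSpace 𝓘(ℝ, Plane)) ζ.1).continuousLinearMapAt ℝ ζ.1 v)
  rw [hw, hT] at h2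
  refine h2.symm.trans ((cotangentChart_snd _ _ _).trans ?_)
  exact congrArg ζ.2 (hT v)

/-- The dual norm, computed from the matrix of the metric in a chart. -/
theorem covectorNorm_eq_chart {ζ₀ ζ : Cotangent M} (h : ζ.1 ∈ (chartAt Plane ζ₀.1).source) :
    covectorNorm g ζ = Real.sqrt ((extChartAt cotangentModel ζ₀ ζ).2
      ((metricInChart g ζ₀.1 ζ.1).inverse (extChartAt cotangentModel ζ₀ ζ).2)) := by
  have hx' : ζ.1 ∈ (trivializationAt Plane (TangentSpace 𝓘(ℝ, Plane)) ζ₀.1).baseSet := by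
    simpa using h
  have hT := Trivialization.symmL_continuousLinearMapAt (R := ℝ)
    (trivializationAt Plane (TangentSpace 𝓘(ℝ, Plane)) ζ₀.1) hx'
  set η := (extChartAt cotangentModel ζ₀ ζ).2 with hη
  set w := (metricInChart g ζ₀.1 ζ.1).inverse η with hw
  have hBw : metricInChart g ζ₀.1 ζ.1 w = η := by
    obtain ⟨e, he⟩ := metricInChart_isInvertible g h
    rw [hw, ← he, ContinuousLinearMap.inverse_equiv]
    simp
  have hu : ∀ v, g.inner ζ.1
      ((trivializationAt Plane (TangentSpace 𝓘(ℝ, Plane)) ζ₀.1).symmL ℝ ζ.1 w) v = ζ.2 v := by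
    intro v
    have h2 := metricInChart_apply g h w
      ((trivializationAt Plane (TangentSpace 𝓘(ℝ, Plane)) ζ₀.1).continuousLinearMapAt ℝ ζ.1 v)
    rw [hBw, hη, hT] at h2
    refine h2.symm.trans ((cotangentChart_snd _ _ _).trans ?_)
    exact congrArg ζ.2 (hT v)
  rw [covectorNorm_eq_sqrt g hu, hη, cotangentChart_snd]

theorem covectorNorm_pos {ζ : Cotangent M} (hζ : ζ ∈ puncturedCotangent M) :
    0 < covectorNorm g ζ := by
  obtain ⟨u, hu⟩ := exists_metric_dual g ζ
  rw [covectorNorm_eq_sqrt g hu, ← hu]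
  refine Real.sqrt_pos.2 (g.pos _ _ ?_)
  rintro rfl
  refine hζ (ContinuousLinearMap.ext fun v => ?_)
  rw [← hu v, map_zero]

theorem covectorNorm_dilate (ζ : Cotangent M) {r : ℝ} (hr : 0 ≤ r) :
    covectorNorm g (dilate r ζ) = r * covectorNorm g ζ := by
  obtain ⟨u, hu⟩ := exists_metric_dual g ζ
  have h : ∀ v, g.inner (dilate r ζ).1 (r • u : TangentSpace 𝓘(ℝ, Plane) ζ.1) v =
      (dilate r ζ).2 v := fun v => by
    change g.inner ζ.1 (r • u) v = r • ζ.2 v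
    rw [map_smul]
    exact congrArg (r • ·) (hu v)
  rw [covectorNorm_eq_sqrt g h, covectorNorm_eq_sqrt g hu]
  have h2 : (dilate r ζ).2 (r • u : TangentSpace 𝓘(ℝ, Plane) ζ.1) = r ^ 2 * ζ.2 u := by
    change r • ζ.2 (r • u) = r ^ 2 * ζ.2 u
    rw [map_smul, smul_eq_mul]
    simp only [smul_eq_mul]
    ring
  rw [h2, Real.sqrt_mul (sq_nonneg r), Real.sqrt_sq hr]

/-- The norm of covectors is smooth off the zero section: it is the square root of the quadratic
form of the inverse matrix of the metric. -/
theorem contMDiffAt_covectorNorm {ζ₀ : Cotangent M} (hζ₀ : ζ₀ ∈ puncturedCotangent M) :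
    ContMDiffAt cotangentModel 𝓘(ℝ, ℝ) ∞ (covectorNorm g) ζ₀ := by
  have h0 : ζ₀.1 ∈ (chartAt Plane ζ₀.1).source := mem_chart_source _ _
  have hB : ContMDiffAt cotangentModel 𝓘(ℝ, Plane →L[ℝ] Plane →L[ℝ] ℝ) ∞
      (metricInChart g ζ₀.1 ∘ TotalSpace.proj) ζ₀ :=
    ContMDiffAt.comp ζ₀ (contMDiffAt_metricInChart g ζ₀.1) (contMDiff_proj _).contMDiffAt
  have hη : ContMDiffAt cotangentModel 𝓘(ℝ, DualPlane) ∞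
      (Prod.snd ∘ extChartAt cotangentModel ζ₀) ζ₀ :=
    ContMDiffAt.comp ζ₀ (g := (Prod.snd : Plane × DualPlane → DualPlane))
      contDiff_snd.contMDiff.contMDiffAt contMDiffAt_extChartAt
  have hs : ContDiffAt ℝ ∞ (fun q : (Plane →L[ℝ] Plane →L[ℝ] ℝ) × DualPlane =>
      Real.sqrt (q.2 (q.1.inverse q.2)))
      (metricInChart g ζ₀.1 ζ₀.1, (extChartAt cotangentModel ζ₀ ζ₀).2) := by
    refine ContDiffAt.sqrt ?_ ?_
    · obtain ⟨e, he⟩ := metricInChart_isInvertible g h0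
      have hi : ContDiffAt ℝ ∞ (ContinuousLinearMap.inverse : (Plane →L[ℝ] Plane →L[ℝ] ℝ) → _)
          (metricInChart g ζ₀.1 ζ₀.1) := by
        rw [← he]
        exact contDiffAt_map_inverse e
      have hi' : ContDiffAt ℝ ∞ (fun q : (Plane →L[ℝ] Plane →L[ℝ] ℝ) × DualPlane => q.1.inverse)
          (metricInChart g ζ₀.1 ζ₀.1, (extChartAt cotangentModel ζ₀ ζ₀).2) :=
        ContDiffAt.comp (g := ContinuousLinearMap.inverse) _ hi contDiffAt_fst
      exact contDiffAt_snd.clm_apply (hi'.clm_apply contDiffAt_snd)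
    · have h1 := covectorNorm_pos g hζ₀
      rw [covectorNorm_eq_chart g h0] at h1
      exact (Real.sqrt_pos.1 h1).ne'
  have hc := ContMDiffAt.comp ζ₀ hs.contMDiffAt (hB.prodMk_space hη)
  refine hc.congr_of_eventuallyEq ?_
  filter_upwards [extChartAt_source_mem_nhds (I := cotangentModel) ζ₀] with ζ hζ
  exact covectorNorm_eq_chart g (mem_cotangentChart_source.1 hζ)

end CovectorNorm

/-! ### The rescaled Hamiltonian flow -/

section RescaledFlows

variable {M : Type*} [TopologicalSpace M] [ChartedSpace Plane M] [IsManifold 𝓘(ℝ, Plane) ∞ M]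
  {g : ContMDiffRiemannianMetric 𝓘(ℝ, Plane) ∞ Plane (fun x : M => TangentSpace 𝓘(ℝ, Plane) x)}
  {p : Cotangent M → ℝ}

/-- The rescaled Hamiltonian field, as a vector of `ℝ² × (ℝ²)*`. -/
noncomputable def rescaledVector
    (g : ContMDiffRiemannianMetric 𝓘(ℝ, Plane) ∞ Plane (fun x : M => TangentSpace 𝓘(ℝ, Plane) x))
    (p : Cotangent M → ℝ) (ζ : Cotangent M) : Plane × DualPlane :=
  covectorNorm g ζ • hamiltonianField p ζ

theorem IsSymbolOrderZero.contMDiffOn_rescaledField (hp : IsSymbolOrderZero p) :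
    ContMDiffOn cotangentModel cotangentModel.tangent ∞
      (fun ζ => (⟨ζ, rescaledField g p ζ⟩ : TangentBundle cotangentModel (Cotangent M)))
      (puncturedCotangent M) := by
  intro ζ₀ hζ₀
  refine ContMDiffAt.contMDiffWithinAt ?_
  rw [contMDiffAt_section]
  have hpc : ContMDiffAt cotangentModel 𝓘(ℝ, Plane × DualPlane →L[ℝ] ℝ) ∞
      (fderiv ℝ (p ∘ (extChartAt cotangentModel ζ₀).symm) ∘ extChartAt cotangentModel ζ₀) ζ₀ := by
    refine ContMDiffAt.comp ζ₀ (ContDiffAt.contMDiffAt ?_) contMDiffAt_extChartAt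
    exact ((hp.contMDiffAt hζ₀).comp_extChartAt_symm (mem_chart_source _ ζ₀)).fderiv_right
      (m := ∞) (by simp)
  have hH : ContMDiffAt cotangentModel 𝓘(ℝ, Plane × DualPlane) ∞ (hamiltonianVector ∘
      (fderiv ℝ (p ∘ (extChartAt cotangentModel ζ₀).symm) ∘ extChartAt cotangentModel ζ₀)) ζ₀ :=
    ContMDiffAt.comp ζ₀ hamiltonianVector.contDiff.contMDiff.contMDiffAt hpc
  have hY := (contMDiffAt_covectorNorm g hζ₀).smul hH
  refine hY.congr_of_eventuallyEq ?_
  filter_upwards [extChartAt_source_mem_nhds (I := cotangentModel) ζ₀,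
    isOpen_puncturedCotangent.mem_nhds hζ₀] with ζ hζ hζN
  have hs := mem_cotangentChart_source.1 hζ
  rw [TangentBundle.trivializationAt_snd (mem_cotangent_chartAt_source.2 hs)]
  change chartDeriv ζ₀ ζ (covectorNorm g ζ • hamiltonianField p ζ) = _
  rw [map_smul, chartDeriv_hamiltonianField (hp.contMDiffAt hζN) hs]
  rfl

namespace RescaledFlow

variable (φ : RescaledFlow g p)

theorem isFlowOn : IsFlowOn (I := cotangentModel) (rescaledField g p) (puncturedCotangent M)
    φ.toFun := ⟨φ.mem, φ.zero, φ.integral⟩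

theorem hasMFDerivAt_time {ζ : Cotangent M} (hζ : ζ ∈ puncturedCotangent M) (t : ℝ) :
    HasMFDerivAt 𝓘(ℝ, ℝ) cotangentModel (fun t => φ.toFun t ζ) t
      ((1 : ℝ →L[ℝ] ℝ).smulRight (rescaledVector g p (φ.toFun t ζ))) :=
  φ.integral ζ hζ t

theorem continuous_time {ζ : Cotangent M} (hζ : ζ ∈ puncturedCotangent M) :
    Continuous (fun t => φ.toFun t ζ) :=
  continuous_iff_continuousAt.2 fun t => (φ.hasMFDerivAt_time hζ t).continuousAt

theorem apply_eq (φ : RescaledFlow g p) (hp : IsSymbolOrderZero p) [T2Space M]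
    {γ : ℝ → Cotangent M}
    (hγ : ∀ t, HasMFDerivAt 𝓘(ℝ, ℝ) cotangentModel γ t
      ((1 : ℝ →L[ℝ] ℝ).smulRight (rescaledVector g p (γ t))))
    (hmem : γ 0 ∈ puncturedCotangent M) (t : ℝ) : φ.toFun t (γ 0) = γ t := by
  have h := IsMIntegralCurve.eq_of_mem isOpen_puncturedCotangent
    (hp.contMDiffOn_rescaledField (g := g)) (φ.integral _ hmem) (γ' := γ) hγ
    (fun t => φ.mem t _ hmem) (φ.zero _ hmem)
  exact congrFun h t

theorem apply_unique (hp : IsSymbolOrderZero p) [T2Space M] (φ' : RescaledFlow g p)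
    {ζ : Cotangent M} (hζ : ζ ∈ puncturedCotangent M) (t : ℝ) :
    φ.toFun t ζ = φ'.toFun t ζ := by
  have h := φ.apply_eq hp (γ := fun t => φ'.toFun t ζ) (φ'.hasMFDerivAt_time hζ)
    (φ'.mem 0 ζ hζ) t
  rwa [φ'.zero ζ hζ] at h

theorem add (hp : IsSymbolOrderZero p) [T2Space M] (s t : ℝ) {ζ : Cotangent M}
    (hζ : ζ ∈ puncturedCotangent M) : φ.toFun (s + t) ζ = φ.toFun s (φ.toFun t ζ) :=
  φ.isFlowOn.add isOpen_puncturedCotangent hp.contMDiffOn_rescaledField s t hζ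

theorem neg_apply (hp : IsSymbolOrderZero p) [T2Space M] (t : ℝ) {ζ : Cotangent M}
    (hζ : ζ ∈ puncturedCotangent M) : φ.toFun (-t) (φ.toFun t ζ) = ζ := by
  rw [← φ.add hp _ _ hζ, neg_add_cancel, φ.zero ζ hζ]

theorem contMDiffAt_time (hp : IsSymbolOrderZero p) [T2Space M] {ζ : Cotangent M}
    (hζ : ζ ∈ puncturedCotangent M) (t : ℝ) :
    ContMDiffAt cotangentModel cotangentModel ∞ (φ.toFun t) ζ :=
  φ.isFlowOn.contMDiffAt_time isOpen_puncturedCotangent hp.contMDiffOn_rescaledField hζ t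

theorem contMDiffAt (hp : IsSymbolOrderZero p) [T2Space M] {ζ : Cotangent M}
    (hζ : ζ ∈ puncturedCotangent M) (t : ℝ) :
    ContMDiffAt (𝓘(ℝ, ℝ).prod cotangentModel) cotangentModel ∞
      (fun q : ℝ × Cotangent M => φ.toFun q.1 q.2) (t, ζ) :=
  φ.isFlowOn.contMDiffAt isOpen_puncturedCotangent hp.contMDiffOn_rescaledField hζ t

theorem continuous_covectorNorm {ζ : Cotangent M} (hζ : ζ ∈ puncturedCotangent M) :
    Continuous (fun t => covectorNorm g (φ.toFun t ζ)) :=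
  continuous_iff_continuousAt.2 fun t =>
    ContinuousAt.comp (f := fun t => φ.toFun t ζ)
      (contMDiffAt_covectorNorm g (φ.mem t ζ hζ)).continuousAt
      (φ.continuous_time hζ).continuousAt

/-- The flow commutes with the dilations. -/
theorem dilate_apply (hp : IsSymbolOrderZero p) [T2Space M] {ζ : Cotangent M}
    (hζ : ζ ∈ puncturedCotangent M) {r : ℝ} (hr : 0 < r) (t : ℝ) :
    φ.toFun t (dilate r ζ) = dilate r (φ.toFun t ζ) := by
  have h := φ.apply_eq hp (γ := fun t => dilate r (φ.toFun t ζ)) ?_ ?_ t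
  · simpa only [φ.zero ζ hζ] using h
  · intro t
    have h1 := (hasMFDerivAt_dilate r (φ.toFun t ζ)).comp t (φ.hasMFDerivAt_time hζ t)
    have h2 : rescaledVector g p (dilate r (φ.toFun t ζ)) =
        dilateDeriv r (rescaledVector g p (φ.toFun t ζ)) := by
      rw [rescaledVector, rescaledVector, covectorNorm_dilate g _ hr.le, map_smul,
        ← hp.hamiltonianField_dilate (φ.mem t ζ hζ) hr, smul_smul, mul_comm]
    have h3 : (dilateDeriv r).comp ((1 : ℝ →L[ℝ] ℝ).smulRight (rescaledVector g p (φ.toFun t ζ))) =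
        (1 : ℝ →L[ℝ] ℝ).smulRight (rescaledVector g p (dilate r (φ.toFun t ζ))) :=
      ContinuousLinearMap.ext fun s => by
        simp only [ContinuousLinearMap.comp_apply, ContinuousLinearMap.smulRight_apply, map_smul,
          h2]
    exact h1.congr_mfderiv h3
  · exact dilate_mem (φ.mem 0 ζ hζ) hr.ne'

/-- `p` is conserved. -/
theorem symbol_apply (hp : IsSymbolOrderZero p) {ζ : Cotangent M}
    (hζ : ζ ∈ puncturedCotangent M) (t : ℝ) : p (φ.toFun t ζ) = p ζ := by
  have h1 : ∀ t, HasDerivAt (fun t => p (φ.toFun t ζ)) 0 t := by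
    intro t
    have hmem := φ.mem t ζ hζ
    have h2 : HasMFDerivAt cotangentModel 𝓘(ℝ, ℝ) p (φ.toFun t ζ)
        (cotangentDiff p (φ.toFun t ζ)) :=
      ((hp.contMDiffAt hmem).mdifferentiableAt (by simp)).hasMFDerivAt
    have h3 : HasFDerivAt (fun t => p (φ.toFun t ζ)) ((cotangentDiff p (φ.toFun t ζ)).comp
        ((1 : ℝ →L[ℝ] ℝ).smulRight (rescaledVector g p (φ.toFun t ζ)))) t :=
      (h2.comp t (φ.hasMFDerivAt_time hζ t)).hasFDerivAt
    refine h3.hasDerivAt.congr_deriv ?_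
    have h4 : cotangentDiff p (φ.toFun t ζ) (rescaledVector g p (φ.toFun t ζ)) = 0 := by
      rw [rescaledVector, map_smul, cotangentDiff_hamiltonianField_self, smul_zero]
    refine Eq.trans ?_ h4
    change cotangentDiff p (φ.toFun t ζ) ((1 : ℝ) • rescaledVector g p (φ.toFun t ζ)) = _
    rw [one_smul]
  have h5 := is_const_of_deriv_eq_zero (f := fun t => p (φ.toFun t ζ))
    (fun t => (h1 t).differentiableAt) (fun t => (h1 t).deriv) t 0
  simpa only [φ.zero ζ hζ] using h5

/-- The derivative of the flow map, in the canonical coordinates. -/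
noncomputable def flowDeriv (t : ℝ) (ζ : Cotangent M) :
    Plane × DualPlane →L[ℝ] Plane × DualPlane :=
  mfderiv cotangentModel cotangentModel (φ.toFun t) ζ

theorem hasMFDerivAt_flow (hp : IsSymbolOrderZero p) [T2Space M] {ζ : Cotangent M}
    (hζ : ζ ∈ puncturedCotangent M) (t : ℝ) :
    HasMFDerivAt cotangentModel cotangentModel (φ.toFun t) ζ (φ.flowDeriv t ζ) :=
  ((φ.contMDiffAt_time hp hζ t).mdifferentiableAt (by simp)).hasMFDerivAt

theorem flowDeriv_add (hp : IsSymbolOrderZero p) [T2Space M] {ζ : Cotangent M}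
    (hζ : ζ ∈ puncturedCotangent M) (s t : ℝ) (v : Plane × DualPlane) :
    φ.flowDeriv (s + t) ζ v = φ.flowDeriv s (φ.toFun t ζ) (φ.flowDeriv t ζ v) := by
  have h1 := (φ.hasMFDerivAt_flow hp (φ.mem t ζ hζ) s).comp ζ (φ.hasMFDerivAt_flow hp hζ t)
  have h2 : HasMFDerivAt cotangentModel cotangentModel (φ.toFun s ∘ φ.toFun t) ζ
      (φ.flowDeriv (s + t) ζ) := by
    refine (φ.hasMFDerivAt_flow hp hζ (s + t)).congr_of_eventuallyEq ?_
    filter_upwards [isOpen_puncturedCotangent.mem_nhds hζ] with ζ' hζ'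
    exact (φ.add hp s t hζ').symm
  exact congrArg (fun A : Plane × DualPlane →L[ℝ] Plane × DualPlane => A v)
    (hasMFDerivAt_unique h2 h1)

theorem cotangentDiff_flowDeriv (hp : IsSymbolOrderZero p) [T2Space M] {ζ : Cotangent M}
    (hζ : ζ ∈ puncturedCotangent M) (t : ℝ) (v : Plane × DualPlane) :
    cotangentDiff p (φ.toFun t ζ) (φ.flowDeriv t ζ v) = cotangentDiff p ζ v := by
  have hd : ∀ ζ ∈ puncturedCotangent M, HasMFDerivAt cotangentModel 𝓘(ℝ, ℝ) p ζ
      (cotangentDiff p ζ) := fun ζ hζ =>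
    ((hp.contMDiffAt hζ).mdifferentiableAt (by simp)).hasMFDerivAt
  have h1 := (hd _ (φ.mem t ζ hζ)).comp ζ (φ.hasMFDerivAt_flow hp hζ t)
  have h2 : HasMFDerivAt cotangentModel 𝓘(ℝ, ℝ) (p ∘ φ.toFun t) ζ (cotangentDiff p ζ) := by
    refine (hd ζ hζ).congr_of_eventuallyEq ?_
    filter_upwards [isOpen_puncturedCotangent.mem_nhds hζ] with ζ' hζ'
    exact φ.symbol_apply hp hζ' t
  exact congrArg (fun A : Plane × DualPlane →L[ℝ] ℝ => A v) (hasMFDerivAt_unique h1 h2)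

/-- The flow map preserves its generator. -/
theorem flowDeriv_rescaledVector (hp : IsSymbolOrderZero p) [T2Space M] {ζ : Cotangent M}
    (hζ : ζ ∈ puncturedCotangent M) (t : ℝ) :
    φ.flowDeriv t ζ (rescaledVector g p ζ) = rescaledVector g p (φ.toFun t ζ) := by
  have h0 := φ.hasMFDerivAt_time hζ 0
  have h1 : HasMFDerivAt cotangentModel cotangentModel (φ.toFun t) (φ.toFun 0 ζ)
      (φ.flowDeriv t ζ) := by
    rw [φ.zero ζ hζ]
    exact φ.hasMFDerivAt_flow hp hζ t
  have h2 := h1.comp (0 : ℝ) h0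
  have h3 := φ.hasMFDerivAt_time (φ.mem t ζ hζ) 0
  have h4 : (φ.toFun t ∘ fun s => φ.toFun s ζ) = fun s => φ.toFun s (φ.toFun t ζ) := by
    funext s
    rw [Function.comp_apply, ← φ.add hp _ _ hζ, ← φ.add hp _ _ hζ, add_comm]
  rw [h4] at h2
  have h5 := congrArg (fun A : ℝ →L[ℝ] Plane × DualPlane => A 1) (hasMFDerivAt_unique h2 h3)
  have h6 : φ.flowDeriv t ζ ((1 : ℝ) • rescaledVector g p (φ.toFun 0 ζ)) =
    (1 : ℝ) • rescaledVector g p (φ.toFun 0 (φ.toFun t ζ)) := h5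
  rwa [one_smul, one_smul, φ.zero ζ hζ, φ.zero _ (φ.mem t ζ hζ)] at h6

end RescaledFlow

theorem hasMFDerivAt_dilate_curve (ζ : Cotangent M) (r : ℝ) :
    HasMFDerivAt 𝓘(ℝ, ℝ) cotangentModel (fun t : ℝ => dilate t ζ) r
      ((1 : ℝ →L[ℝ] ℝ).smulRight (radialField ζ)) := by
  have h1 : Continuous (fun q : ℝ × Cotangent M => dilate q.1 q.2) := contMDiff_dilate.continuous
  refine ⟨(h1.comp (Continuous.prodMk_left ζ)).continuousAt, ?_⟩
  have h2 := hasDerivAt_cotangentChart_dilate ζ ζ r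
  rw [cotangentChart_snd_self] at h2
  have h3 : HasFDerivAt (writtenInExtChartAt 𝓘(ℝ, ℝ) cotangentModel r
      (fun t : ℝ => dilate t ζ)) ((1 : ℝ →L[ℝ] ℝ).smulRight (radialField ζ))
      (extChartAt 𝓘(ℝ, ℝ) r r) := by
    have h4 : writtenInExtChartAt 𝓘(ℝ, ℝ) cotangentModel r (fun t : ℝ => dilate t ζ) =
        fun t => extChartAt cotangentModel ζ (dilate t ζ) := by
      funext t
      rw [writtenInExtChartAt, Function.comp_apply, Function.comp_apply, extChartAt_dilate,
        extChartAt_model_space_eq_id]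
      rfl
    rw [h4]
    exact h2.hasFDerivAt
  exact h3.hasFDerivWithinAt

/-- The flow map preserves the radial field. -/
theorem RescaledFlow.flowDeriv_radialField (φ : RescaledFlow g p) (hp : IsSymbolOrderZero p)
    [T2Space M] {ζ : Cotangent M} (hζ : ζ ∈ puncturedCotangent M) (t : ℝ) :
    φ.flowDeriv t ζ (radialField ζ) = radialField (φ.toFun t ζ) := by
  have h0 := hasMFDerivAt_dilate_curve ζ 1
  have h1 : HasMFDerivAt cotangentModel cotangentModel (φ.toFun t) (dilate 1 ζ)
      (φ.flowDeriv t ζ) := by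
    have := φ.hasMFDerivAt_flow hp hζ t
    rwa [dilate_one]
  have h2 := h1.comp (1 : ℝ) h0
  have h3 := hasMFDerivAt_dilate_curve (φ.toFun t ζ) 1
  have h4 : (φ.toFun t ∘ fun s => dilate s ζ) =ᶠ[𝓝 1] fun s => dilate s (φ.toFun t ζ) := by
    filter_upwards [lt_mem_nhds one_pos] with s hs
    exact φ.dilate_apply hp hζ hs t
  have h5 := congrArg (fun A : ℝ →L[ℝ] Plane × DualPlane => A 1)
    (hasMFDerivAt_unique h2 (h3.congr_of_eventuallyEq h4))
  have h6 : φ.flowDeriv t ζ ((1 : ℝ) • radialField ζ) =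
    (1 : ℝ) • radialField (φ.toFun t ζ) := h5
  rwa [one_smul, one_smul] at h6

end RescaledFlows

/-! ### The Liouville form along the flow -/

section LiouvilleVariation

/-! Shortcut instances, as for the linear maps on `Plane × DualPlane`. -/

noncomputable instance : NormedAddCommGroup (ℝ × (Plane × DualPlane) →L[ℝ] Plane × DualPlane) :=
  ContinuousLinearMap.toNormedAddCommGroup

noncomputable instance : NormedSpace ℝ (ℝ × (Plane × DualPlane) →L[ℝ] Plane × DualPlane) :=
  ContinuousLinearMap.toNormedSpace

/-- The derivative of the pulled-back Liouville form along the flow `ψ` of a field that is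
annihilated by the Liouville form (Cartan's formula). -/
theorem hasDerivAt_liouville_flow {ψ : ℝ × (Plane × DualPlane) → Plane × DualPlane}
    {z₀ : Plane × DualPlane} (hψ : ContDiffAt ℝ ∞ ψ (0, z₀))
    (h0 : ∀ᶠ z in 𝓝 z₀, ψ (0, z) = z)
    (hα : ∀ᶠ z in 𝓝 z₀, z.2 (fderiv ℝ ψ (0, z) (1, 0)).1 = 0) (v : Plane × DualPlane) :
    HasDerivAt (fun h : ℝ => (ψ (h, z₀)).2 (fderiv ℝ ψ (h, z₀) (0, v)).1)
      (symplecticForm (fderiv ℝ ψ (0, z₀) (1, 0)) v) 0 := by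
  have hd : HasFDerivAt ψ (fderiv ℝ ψ (0, z₀)) (0, z₀) :=
    (hψ.differentiableAt (by simp)).hasFDerivAt
  have hdd : HasFDerivAt (fderiv ℝ ψ) (fderiv ℝ (fderiv ℝ ψ) (0, z₀)) (0, z₀) :=
    ((hψ.fderiv_right (m := 1) (by rw [one_add_one_eq_two]; exact ENat.LEInfty.out)
      ).differentiableAt (by simp)).hasFDerivAt
  have hsymm : IsSymmSndFDerivAt ℝ ψ (0, z₀) :=
    hψ.isSymmSndFDerivAt (by simpa using ENat.LEInfty.out)
  have hc : HasDerivAt (fun h : ℝ => (h, z₀)) ((1 : ℝ), (0 : Plane × DualPlane)) 0 :=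
    (hasDerivAt_id (0 : ℝ)).prodMk (hasDerivAt_const _ _)
  have hz : HasFDerivAt (fun z : Plane × DualPlane => ((0 : ℝ), z))
      (ContinuousLinearMap.inr ℝ ℝ (Plane × DualPlane)) z₀ := hasFDerivAt_prodMk_right _ _
  -- the derivative in the time variable
  have h1 : HasDerivAt (fun h : ℝ => ψ (h, z₀)) (fderiv ℝ ψ (0, z₀) (1, 0)) 0 :=
    hd.comp_hasDerivAt (0 : ℝ) hc
  have h2 : HasDerivAt (fun h : ℝ => fderiv ℝ ψ (h, z₀) (0, v))
      (fderiv ℝ (fderiv ℝ ψ) (0, z₀) (1, 0) (0, v)) 0 := by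
    have := (hdd.comp_hasDerivAt (0 : ℝ) hc).clm_apply
      (hasDerivAt_const (0 : ℝ) ((0 : ℝ), v))
    simpa using this
  have h3 : HasDerivAt (fun h : ℝ => (ψ (h, z₀)).2 (fderiv ℝ ψ (h, z₀) (0, v)).1)
      ((fderiv ℝ ψ (0, z₀) (1, 0)).2 (fderiv ℝ ψ (0, z₀) (0, v)).1 +
        (ψ (0, z₀)).2 (fderiv ℝ (fderiv ℝ ψ) (0, z₀) (1, 0) (0, v)).1) 0 :=
    HasDerivAt.clm_apply (c := fun h : ℝ => (ψ (h, z₀)).2)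
      ((ContinuousLinearMap.snd ℝ Plane DualPlane).hasFDerivAt.comp_hasDerivAt (0 : ℝ) h1)
      ((ContinuousLinearMap.fst ℝ Plane DualPlane).hasFDerivAt.comp_hasDerivAt (0 : ℝ) h2)
  -- the derivative of `hα` in the direction `v`
  have h4 : HasFDerivAt (fun z : Plane × DualPlane => fderiv ℝ ψ (0, z) (1, 0))
      (((ContinuousLinearMap.apply ℝ (Plane × DualPlane) ((1 : ℝ), (0 : Plane × DualPlane))).comp
        (fderiv ℝ (fderiv ℝ ψ) (0, z₀))).comp
          (ContinuousLinearMap.inr ℝ ℝ (Plane × DualPlane))) z₀ :=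
    ((ContinuousLinearMap.apply ℝ (Plane × DualPlane)
      ((1 : ℝ), (0 : Plane × DualPlane))).hasFDerivAt.comp _ hdd).comp z₀ hz
  have h5 := ((hasFDerivAt_id z₀).snd.clm_apply h4.fst).unique
    ((hasFDerivAt_const (0 : ℝ) z₀).congr_of_eventuallyEq hα)
  have h6 : z₀.2 (fderiv ℝ (fderiv ℝ ψ) (0, z₀) (0, v) (1, 0)).1 +
      v.2 (fderiv ℝ ψ (0, z₀) (1, 0)).1 = 0 := by
    have := congrArg (fun A : Plane × DualPlane →L[ℝ] ℝ => A v) h5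
    simpa using this
  have h7 : fderiv ℝ ψ (0, z₀) (0, v) = v := by
    have h8 : HasFDerivAt (fun z => ψ (0, z)) ((fderiv ℝ ψ (0, z₀)).comp
        (ContinuousLinearMap.inr ℝ ℝ (Plane × DualPlane))) z₀ := hd.comp z₀ hz
    have h9 := h8.unique ((hasFDerivAt_id z₀).congr_of_eventuallyEq h0)
    exact congrArg (fun A : Plane × DualPlane →L[ℝ] Plane × DualPlane => A v) h9
  refine h3.congr_deriv ?_
  have h10 : fderiv ℝ (fderiv ℝ ψ) (0, z₀) (1, 0) (0, v) =
      fderiv ℝ (fderiv ℝ ψ) (0, z₀) (0, v) (1, 0) := hsymm.eq _ _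
  rw [h7, h10, h0.self_of_nhds, symplecticForm]
  linarith

variable {M : Type*} [TopologicalSpace M] [ChartedSpace Plane M] [IsManifold 𝓘(ℝ, Plane) ∞ M]
  {g : ContMDiffRiemannianMetric 𝓘(ℝ, Plane) ∞ Plane (fun x : M => TangentSpace 𝓘(ℝ, Plane) x)}
  {p : Cotangent M → ℝ}

theorem IsSymbolOrderZero.liouville_rescaledVector (hp : IsSymbolOrderZero p) {ζ : Cotangent M}
    (hζ : ζ ∈ puncturedCotangent M) : ζ.2 (rescaledVector g p ζ).1 = 0 :=
  (map_smul ζ.2 (covectorNorm g ζ) (hamiltonianField p ζ).1).trans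
    ((congrArg (covectorNorm g ζ • ·) (hp.liouville_hamiltonianField hζ)).trans (smul_zero _))

namespace RescaledFlow

/-- The Lie derivative of the Liouville form along `|ξ| H_p` is `-|ξ| dp`. -/
theorem hasDerivAt_liouville_zero (φ : RescaledFlow g p) (hp : IsSymbolOrderZero p) [T2Space M]
    {ζ : Cotangent M} (hζ : ζ ∈ puncturedCotangent M) (v : Plane × DualPlane) :
    HasDerivAt (fun h => (φ.toFun h ζ).2 (φ.flowDeriv h ζ v).1)
      (-(covectorNorm g ζ * cotangentDiff p ζ v)) 0 := by
  set c := extChartAt cotangentModel ζ with hc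
  have hz : c ζ ∈ c.target := mem_extChartAt_target ζ
  have hinv : c.symm (c ζ) = ζ := extChartAt_to_inv ζ
  let ψ : ℝ × (Plane × DualPlane) → Plane × DualPlane := fun q => c (φ.toFun q.1 (c.symm q.2))
  have hsymm : ContMDiffAt 𝓘(ℝ, Plane × DualPlane) cotangentModel ∞ c.symm (c ζ) :=
    (contMDiffOn_extChartAt_symm ζ).contMDiffAt ((isOpen_extChartAt_target ζ).mem_nhds hz)
  -- regularity of the flow, read in the chart
  have hsrc0 : ζ.1 ∈ (chartAt Plane ζ.1).source := mem_chart_source _ _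
  have hψ : ContDiffAt ℝ ∞ ψ (0, c ζ) := by
    have h1 : ContMDiffAt (𝓘(ℝ, ℝ).prod 𝓘(ℝ, Plane × DualPlane)) (𝓘(ℝ, ℝ).prod cotangentModel) ∞
        (fun q : ℝ × (Plane × DualPlane) => (q.1, c.symm q.2)) (0, c ζ) :=
      contMDiffAt_fst.prodMk (ContMDiffAt.comp (0, c ζ) hsymm contMDiffAt_snd)
    have h2 : ContMDiffAt (𝓘(ℝ, ℝ).prod cotangentModel) cotangentModel ∞
        (fun q : ℝ × Cotangent M => φ.toFun q.1 q.2) (0, c.symm (c ζ)) := by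
      rw [hinv]
      exact φ.contMDiffAt hp hζ 0
    have h3 := ContMDiffAt.comp (0, c ζ) h2 h1
    have h4 : ContMDiffAt cotangentModel 𝓘(ℝ, Plane × DualPlane) ∞ c
        (φ.toFun 0 (c.symm (c ζ))) := by
      rw [hinv, φ.zero ζ hζ]
      exact contMDiffAt_extChartAt
    have h5 := ContMDiffAt.comp (0, c ζ) h4 h3
    rw [← modelWithCornersSelf_prod, chartedSpaceSelf_prod] at h5
    exact h5.contDiffAt
  have hψev : ∀ᶠ q in 𝓝 ((0 : ℝ), c ζ), DifferentiableAt ℝ ψ q :=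
    ((hψ.of_le (m := 1) (by simp)).eventually (by simp)).mono fun q h =>
      h.differentiableAt (by simp)
  have hmem : ∀ᶠ z in 𝓝 (c ζ), z ∈ c.target ∧ c.symm z ∈ puncturedCotangent M := by
    refine Eventually.and ((isOpen_extChartAt_target ζ).mem_nhds hz) ?_
    refine hsymm.continuousAt.eventually_mem ?_
    rw [hinv]
    exact isOpen_puncturedCotangent.mem_nhds hζ
  have h0 : ∀ᶠ z in 𝓝 (c ζ), ψ (0, z) = z := by
    filter_upwards [hmem] with z hz
    change c (φ.toFun 0 (c.symm z)) = z
    rw [φ.zero _ hz.2, c.right_inv hz.1]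
  have htime : ∀ᶠ z in 𝓝 (c ζ),
      fderiv ℝ ψ (0, z) (1, 0) = chartDeriv ζ (c.symm z) (rescaledVector g p (c.symm z)) := by
    have h1 : ∀ᶠ z in 𝓝 (c ζ), DifferentiableAt ℝ ψ ((0 : ℝ), z) :=
      (Continuous.prodMk_right (0 : ℝ)).continuousAt.eventually hψev
    filter_upwards [h1, hmem] with z h1 hz
    have hcz : HasDerivAt (fun h : ℝ => (h, z)) ((1 : ℝ), (0 : Plane × DualPlane)) 0 :=
      (hasDerivAt_id (0 : ℝ)).prodMk (hasDerivAt_const _ _)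
    have h2 : HasDerivAt (fun h : ℝ => ψ (h, z)) (fderiv ℝ ψ (0, z) (1, 0)) 0 :=
      HasFDerivAt.comp_hasDerivAt (l := ψ) (0 : ℝ) h1.hasFDerivAt hcz
    have hs : (c.symm z).1 ∈ (chartAt Plane ζ.1).source :=
      mem_cotangentChart_source.1 (c.map_target hz.1)
    have h3 : HasMFDerivAt cotangentModel 𝓘(ℝ, Plane × DualPlane) c (φ.toFun 0 (c.symm z))
        (chartDeriv ζ (c.symm z)) := by
      rw [φ.zero _ hz.2]
      exact hasMFDerivAt_cotangentChart hs
    have h4 : HasFDerivAt (fun h : ℝ => ψ (h, z)) ((chartDeriv ζ (c.symm z)).comp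
        ((1 : ℝ →L[ℝ] ℝ).smulRight (rescaledVector g p (φ.toFun 0 (c.symm z))))) 0 :=
      (h3.comp (0 : ℝ) (φ.hasMFDerivAt_time hz.2 0)).hasFDerivAt
    rw [h2.unique h4.hasDerivAt, φ.zero _ hz.2]
    simp
  have hα : ∀ᶠ z in 𝓝 (c ζ), z.2 (fderiv ℝ ψ (0, z) (1, 0)).1 = 0 := by
    filter_upwards [htime, hmem] with z h1 hz
    have hs : (c.symm z).1 ∈ (chartAt Plane ζ.1).source :=
      mem_cotangentChart_source.1 (c.map_target hz.1)
    have h2 := liouville_chartDeriv hs (rescaledVector g p (c.symm z))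
    rw [← hc, c.right_inv hz.1] at h2
    rw [h1, h2, hp.liouville_rescaledVector hz.2]
  have hmain := hasDerivAt_liouville_flow hψ h0 hα v
  have hval : symplecticForm (fderiv ℝ ψ (0, c ζ) (1, 0)) v =
      -(covectorNorm g ζ * cotangentDiff p ζ v) := by
    rw [htime.self_of_nhds, hinv, chartDeriv_self]
    change symplecticForm (covectorNorm g ζ • hamiltonianField p ζ) v = _
    rw [symplecticForm_smul_left, hamiltonianField_eq, symplecticForm_hamiltonianVector]
    ring
  rw [hval] at hmain
  refine hmain.congr_of_eventuallyEq ?_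
  -- the Liouville form of `dφ_h v`, read in the chart
  have h1 : ∀ᶠ h : ℝ in 𝓝 0, DifferentiableAt ℝ ψ (h, c ζ) :=
    (Continuous.prodMk_left (c ζ)).continuousAt.eventually hψev
  have h2 : ∀ᶠ h : ℝ in 𝓝 0, φ.toFun h ζ ∈ c.source := by
    refine (φ.continuous_time hζ).continuousAt.eventually_mem ?_
    rw [φ.zero ζ hζ]
    exact extChartAt_source_mem_nhds (I := cotangentModel) ζ
  filter_upwards [h1, h2] with h h1 h2
  have hs := mem_cotangentChart_source.1 h2
  have h3 := liouville_chartDeriv hs (φ.flowDeriv h ζ v)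
  have h4 : HasMFDerivAt cotangentModel 𝓘(ℝ, Plane × DualPlane) (c ∘ φ.toFun h) ζ
      ((chartDeriv ζ (φ.toFun h ζ)).comp (φ.flowDeriv h ζ)) :=
    (hasMFDerivAt_cotangentChart hs).comp ζ (φ.hasMFDerivAt_flow hp hζ h)
  have h5 : HasFDerivAt (fun z => ψ (h, z)) ((fderiv ℝ ψ (h, c ζ)).comp
      (ContinuousLinearMap.inr ℝ ℝ (Plane × DualPlane))) (c ζ) :=
    h1.hasFDerivAt.comp (c ζ) (hasFDerivAt_prodMk_right _ _)
  have h6 := h5.hasMFDerivAt.comp ζ (hasMFDerivAt_cotangentChart hsrc0)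
  have h7 : (fun z => ψ (h, z)) ∘ c =ᶠ[𝓝 ζ] c ∘ φ.toFun h := by
    filter_upwards [extChartAt_source_mem_nhds (I := cotangentModel) ζ] with ζ' hζ'
    change c (φ.toFun h (c.symm (c ζ'))) = c (φ.toFun h ζ')
    rw [c.left_inv hζ']
  have h8 := hasMFDerivAt_unique h4 (h6.congr_of_eventuallyEq h7.symm)
  rw [chartDeriv_self] at h8
  have h9 : chartDeriv ζ (φ.toFun h ζ) (φ.flowDeriv h ζ v) = fderiv ℝ ψ (h, c ζ) (0, v) :=
    congrArg (fun A : Plane × DualPlane →L[ℝ] Plane × DualPlane => A v) h8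
  rw [← h3, h9]
  change (c (φ.toFun h ζ)).2 _ = (c (φ.toFun h (c.symm (c ζ)))).2 _
  rw [hinv]

/-- The pullback of the Liouville form by the flow. -/
theorem liouville_flowDeriv (φ : RescaledFlow g p) (hp : IsSymbolOrderZero p) [T2Space M]
    {ζ : Cotangent M} (hζ : ζ ∈ puncturedCotangent M) (t : ℝ) (v : Plane × DualPlane) :
    (φ.toFun t ζ).2 (φ.flowDeriv t ζ v).1 =
      ζ.2 v.1 - cotangentDiff p ζ v * ∫ τ in (0 : ℝ)..t, covectorNorm g (φ.toFun τ ζ) := by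
  have hder : ∀ t : ℝ, HasDerivAt (fun h => (φ.toFun h ζ).2 (φ.flowDeriv h ζ v).1)
      (-(covectorNorm g (φ.toFun t ζ) * cotangentDiff p ζ v)) t := by
    intro t
    have h1 := φ.hasDerivAt_liouville_zero hp (φ.mem t ζ hζ) (φ.flowDeriv t ζ v)
    rw [φ.cotangentDiff_flowDeriv hp hζ] at h1
    have h2 : HasDerivAt (fun s : ℝ => s - t) 1 t := by
      simpa using (hasDerivAt_id t).sub_const t
    have h1' : HasDerivAt (fun h => (φ.toFun h (φ.toFun t ζ)).2
        (φ.flowDeriv h (φ.toFun t ζ) (φ.flowDeriv t ζ v)).1)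
        (-(covectorNorm g (φ.toFun t ζ) * cotangentDiff p ζ v)) (t - t) := by
      rwa [sub_self]
    have h3 := HasDerivAt.comp t (h := fun s : ℝ => s - t) h1' h2
    rw [mul_one] at h3
    refine h3.congr_of_eventuallyEq (Eventually.of_forall fun s => ?_)
    simp only [Function.comp_apply]
    rw [← φ.flowDeriv_add hp hζ, ← φ.add hp _ _ hζ, sub_add_cancel]
  have hcont : Continuous fun τ => -(covectorNorm g (φ.toFun τ ζ) * cotangentDiff p ζ v) :=
    ((φ.continuous_covectorNorm hζ).mul continuous_const).neg
  have hint := intervalIntegral.integral_eq_sub_of_hasDerivAt (a := 0) (b := t)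
    (fun s _ => hder s) (hcont.intervalIntegrable _ _)
  have h0 : φ.flowDeriv 0 ζ = ContinuousLinearMap.id ℝ (Plane × DualPlane) := by
    have h1 : HasMFDerivAt cotangentModel cotangentModel (φ.toFun 0) ζ
        (ContinuousLinearMap.id ℝ (Plane × DualPlane)) := by
      refine (hasMFDerivAt_id ζ).congr_of_eventuallyEq ?_
      filter_upwards [isOpen_puncturedCotangent.mem_nhds hζ] with ζ' hζ'
      exact φ.zero ζ' hζ'
    exact h1.mfderiv
  rw [intervalIntegral.integral_neg, intervalIntegral.integral_mul_const, h0] at hint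
  have h2 : (φ.toFun 0 ζ).2 v.1 = ζ.2 v.1 := by rw [φ.zero ζ hζ]
  change _ = _ - (φ.toFun 0 ζ).2 v.1 at hint
  rw [h2] at hint
  linarith

end RescaledFlow

end LiouvilleVariation

/-! ### Closed trajectories and their multipliers -/

section ReturningPoints

variable {M : Type*} [TopologicalSpace M] [ChartedSpace Plane M] [IsManifold 𝓘(ℝ, Plane) ∞ M]
  {g : ContMDiffRiemannianMetric 𝓘(ℝ, Plane) ∞ Plane (fun x : M => TangentSpace 𝓘(ℝ, Plane) x)}
  {p : Cotangent M → ℝ}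

theorem neg_smul_plane_prod_dual (a : ℝ) (v : Plane × DualPlane) : (-a) • v = -(a • v) :=
  Prod.ext (neg_smul a v.1) (neg_smul a v.2)

/-- Away from the fixed points at infinity, `dp` and the Liouville form are independent. -/
theorem exists_dual_vectors {ζ : Cotangent M} (hζ : ζ ∈ puncturedCotangent M)
    (hfix : ¬ IsFixedAtInfinity p ζ) :
    ∃ e f : Plane × DualPlane, cotangentDiff p ζ e = 0 ∧ ζ.2 e.1 = 1 ∧
      cotangentDiff p ζ f = 1 ∧ ζ.2 f.1 = 0 := by
  set α : Plane × DualPlane →L[ℝ] ℝ := liouvilleForm ζ.2 with hα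
  set ℓ := cotangentDiff p ζ with hℓ
  obtain ⟨w, hw⟩ : ∃ w, ℓ w ≠ 0 := by
    by_contra! h
    have h0 : ℓ = 0 := ContinuousLinearMap.ext h
    refine hfix ⟨0, ?_⟩
    rw [hamiltonianField_eq, ← hℓ, h0, map_zero, zero_smul]
  have hr : hamiltonianVector α = -radialField ζ := hamiltonianVector_liouvilleForm ζ.2
  obtain ⟨e, he, heα⟩ : ∃ e, ℓ e = 0 ∧ α e ≠ 0 := by
    by_contra! h
    have h1 : α = (α w / ℓ w) • ℓ := by
      refine ContinuousLinearMap.ext fun v => ?_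
      have h2 : α (v - (ℓ v / ℓ w) • w) = 0 := h _ (by
        rw [map_sub, map_smul, smul_eq_mul, div_mul_cancel₀ _ hw, sub_self])
      rw [map_sub, map_smul, smul_eq_mul, sub_eq_zero] at h2
      rw [h2]
      simp only [smul_apply, smul_eq_mul]
      ring
    set k := α w / ℓ w with hk
    have h3 : -radialField ζ = k • hamiltonianField p ζ := by
      rw [← hr, h1, map_smul, hamiltonianField_eq]
    have hk0 : k ≠ 0 := by
      intro h0
      rw [h0, zero_smul, neg_eq_zero] at h3
      exact radialField_ne_zero hζ h3
    refine hfix ⟨-k⁻¹, ?_⟩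
    have h4 : k⁻¹ • (k • hamiltonianField p ζ) = hamiltonianField p ζ := by
      rw [smul_smul, inv_mul_cancel₀ hk0, one_smul]
    rw [← h4, ← h3, neg_smul_plane_prod_dual]
    exact Prod.ext (smul_neg _ _) (smul_neg _ _)
  set e' := (α e)⁻¹ • e with he'
  have h1 : ℓ e' = 0 := by rw [he', map_smul, he, smul_zero]
  have h2 : α e' = 1 := by rw [he', map_smul, smul_eq_mul, inv_mul_cancel₀ heα]
  set w' := (ℓ w)⁻¹ • w with hw'
  have h3 : ℓ w' = 1 := by rw [hw', map_smul, smul_eq_mul, inv_mul_cancel₀ hw]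
  clear_value e' w'
  refine ⟨e', w' - α w' • e', h1, h2, ?_, ?_⟩
  · rw [map_sub, map_smul, h1, h3, smul_zero, sub_zero]
  · change α (w' - α w' • e') = 0
    rw [map_sub, map_smul, h2, smul_eq_mul, mul_one, sub_self]

theorem IsFixedAtInfinity.dilate (hp : IsSymbolOrderZero p) {ζ : Cotangent M}
    (hζ : ζ ∈ puncturedCotangent M) {r : ℝ} (hr : 0 < r) (h : IsFixedAtInfinity p ζ) :
    IsFixedAtInfinity p (dilate r ζ) := by
  obtain ⟨a, ha⟩ := h
  refine ⟨r⁻¹ * a, ?_⟩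
  have h1 := hp.hamiltonianField_dilate hζ hr
  rw [ha, map_smul] at h1
  have h2 : dilateDeriv r (radialField ζ) = radialField (_root_.dilate r ζ) := rfl
  rw [h2] at h1
  rw [mul_smul, ← h1, smul_smul, inv_mul_cancel₀ hr.ne', one_smul]

theorem isFixedAtInfinity_dilate_iff (hp : IsSymbolOrderZero p) {ζ : Cotangent M}
    (hζ : ζ ∈ puncturedCotangent M) {r : ℝ} (hr : 0 < r) :
    IsFixedAtInfinity p (dilate r ζ) ↔ IsFixedAtInfinity p ζ := by
  refine ⟨fun h => ?_, fun h => h.dilate hp hζ hr⟩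
  have h1 := h.dilate hp (dilate_mem hζ hr.ne') (inv_pos.2 hr)
  rwa [dilate_dilate, inv_mul_cancel₀ hr.ne', dilate_one] at h1

namespace RescaledFlow

variable (φ : RescaledFlow g p)

theorem isFixedAtInfinity_apply_iff [T2Space M] (hp : IsSymbolOrderZero p) {ζ : Cotangent M}
    (hζ : ζ ∈ puncturedCotangent M) (t : ℝ) :
    IsFixedAtInfinity p (φ.toFun t ζ) ↔ IsFixedAtInfinity p ζ := by
  have key : ∀ ζ ∈ puncturedCotangent M, ∀ t, IsFixedAtInfinity p ζ →
      IsFixedAtInfinity p (φ.toFun t ζ) := by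
    rintro ζ hζ t ⟨a, ha⟩
    have h1 := φ.flowDeriv_rescaledVector hp hζ t
    rw [rescaledVector, ha, map_smul, map_smul, φ.flowDeriv_radialField hp hζ] at h1
    have h2 := covectorNorm_pos g (φ.mem t ζ hζ)
    refine ⟨(covectorNorm g (φ.toFun t ζ))⁻¹ * (covectorNorm g ζ * a), ?_⟩
    rw [mul_smul, mul_smul, h1, rescaledVector, smul_smul, inv_mul_cancel₀ h2.ne', one_smul]
  refine ⟨fun h => ?_, key ζ hζ t⟩
  have h1 := key _ (φ.mem t ζ hζ) (-t) h
  rwa [φ.neg_apply hp t hζ] at h1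

/-- A return map of the flow modulo dilations has the multiplier `1/s`: the flow preserves the
Liouville form on `ker dp`, and the dilation by `s⁻¹` divides it by `s`. -/
theorem multiplier_eq [T2Space M] (hp : IsSymbolOrderZero p) {ζ : Cotangent M}
    (hζ : ζ ∈ puncturedCotangent M) (hfix : ¬ IsFixedAtInfinity p ζ) {T s m : ℝ} (hs : 0 < s)
    (h : φ.toFun T ζ = dilate s ζ) {A : Plane × DualPlane →L[ℝ] Plane × DualPlane}
    (hA : HasMFDerivAt cotangentModel cotangentModel (fun ζ' => dilate s⁻¹ (φ.toFun T ζ')) ζ A) :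
    (∀ v : Plane × DualPlane, cotangentDiff p ζ v = 0 →
      ∃ a b : ℝ, A v = m • v + a • radialField ζ + b • hamiltonianField p ζ) ↔ m = s⁻¹ := by
  have hAeq : A = (dilateDeriv s⁻¹).comp (φ.flowDeriv T ζ) :=
    hasMFDerivAt_unique hA ((hasMFDerivAt_dilate s⁻¹ (φ.toFun T ζ)).comp ζ
      (φ.hasMFDerivAt_flow hp hζ T))
  have hα : ∀ v, cotangentDiff p ζ v = 0 → ζ.2 (A v).1 = s⁻¹ * ζ.2 v.1 := by
    intro v hv
    have h1 := φ.liouville_flowDeriv hp hζ T v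
    rw [hv, zero_mul, sub_zero, h] at h1
    have h2 : s * ζ.2 (φ.flowDeriv T ζ v).1 = ζ.2 v.1 := h1
    rw [hAeq, ← h2, inv_mul_cancel_left₀ hs.ne']
    rfl
  have hdp : ∀ v, cotangentDiff p ζ (A v) = cotangentDiff p ζ v := by
    intro v
    have h1 := φ.cotangentDiff_flowDeriv hp hζ T v
    rw [h] at h1
    have h2 := hp.cotangentDiff_dilate hζ hs (dilateDeriv s⁻¹ (φ.flowDeriv T ζ v))
    have h3 : dilateDeriv s (dilateDeriv s⁻¹ (φ.flowDeriv T ζ v)) = φ.flowDeriv T ζ v := by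
      simp [smul_smul, mul_inv_cancel₀ hs.ne']
    rw [h3, h1] at h2
    rw [hAeq]
    exact h2.symm
  obtain ⟨e, f, he, heα, hf, -⟩ := exists_dual_vectors hζ hfix
  constructor
  · intro hm
    obtain ⟨a, b, hab⟩ := hm e he
    have h1 := hα e he
    have h2 : liouvilleForm ζ.2 (A e) = m := by
      rw [hab, map_add, map_add, map_smul, map_smul, map_smul]
      have h3 : liouvilleForm ζ.2 (hamiltonianField p ζ) = 0 := hp.liouville_hamiltonianField hζ
      have h4 : liouvilleForm ζ.2 (radialField ζ) = 0 := map_zero ζ.2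
      have h5 : liouvilleForm ζ.2 e = 1 := heα
      rw [h3, h4, h5]
      simp
    rw [heα, mul_one] at h1
    exact h2.symm.trans h1
  · rintro rfl v hv
    have h0 : cotangentDiff p ζ ≠ 0 := by
      intro h0
      rw [h0] at hf
      simp at hf
    have hr : hamiltonianVector (liouvilleForm ζ.2) = -radialField ζ :=
      hamiltonianVector_liouvilleForm ζ.2
    obtain ⟨a, b, hab⟩ := exists_eq_hamiltonianVector (ℓ₁ := liouvilleForm ζ.2)
      (ℓ₂ := cotangentDiff p ζ) h0 (v := e) (r := A v - s⁻¹ • v)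
      (ne_of_eq_of_ne (show liouvilleForm ζ.2 e = 1 from heα) one_ne_zero) he
      (by rw [hr, map_neg, hp.cotangentDiff_radialField hζ, neg_zero])
      (by
        rw [map_sub, map_smul, smul_eq_mul, sub_eq_zero]
        exact hα v hv)
      (by rw [map_sub, map_smul, hdp, hv, smul_zero, sub_zero])
    refine ⟨-a, b, ?_⟩
    rw [hr, ← hamiltonianField_eq, sub_eq_iff_eq_add] at hab
    rw [hab, smul_neg, neg_smul_plane_prod_dual]
    abel

/-- The point `ζ` is moved to a multiple `s ζ` with `s > 1` by the flow, at a time of the sign of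
`ε`. -/
def IsReturning (ε : ℝ) (ζ : Cotangent M) : Prop :=
  ∃ T s : ℝ, 0 < ε * T ∧ 1 < s ∧ φ.toFun T ζ = dilate s ζ

/-- The points over closed trajectories that are no fixed points at infinity and along which, for
times of the sign of `ε`, the flow expands the covectors. -/
def returnSet (ε δ : ℝ) : Set (Cotangent M) :=
  {ζ | ζ ∈ puncturedCotangent M ∧ |p ζ| < 2 * δ ∧ ¬ IsFixedAtInfinity p ζ ∧ φ.IsReturning ε ζ}

variable {φ} in
theorem IsReturning.dilate [T2Space M] (hp : IsSymbolOrderZero p) {ε : ℝ} {ζ : Cotangent M}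
    (hζ : ζ ∈ puncturedCotangent M) (h : φ.IsReturning ε ζ) {r : ℝ} (hr : 0 < r) :
    φ.IsReturning ε (dilate r ζ) := by
  obtain ⟨T, s, hT, hs, hTs⟩ := h
  refine ⟨T, s, hT, hs, ?_⟩
  rw [φ.dilate_apply hp hζ hr, hTs, dilate_dilate, dilate_dilate, mul_comm]

variable {φ} in
theorem IsReturning.apply [T2Space M] (hp : IsSymbolOrderZero p) {ε : ℝ} {ζ : Cotangent M}
    (hζ : ζ ∈ puncturedCotangent M) (h : φ.IsReturning ε ζ) (t : ℝ) :
    φ.IsReturning ε (φ.toFun t ζ) := by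
  obtain ⟨T, s, hT, hs, hTs⟩ := h
  refine ⟨T, s, hT, hs, ?_⟩
  rw [← φ.add hp _ _ hζ, add_comm, φ.add hp _ _ hζ, hTs, φ.dilate_apply hp hζ (by linarith)]

theorem dilate_mem_returnSet [T2Space M] (hp : IsSymbolOrderZero p) {ε δ : ℝ} {ζ : Cotangent M}
    (h : ζ ∈ φ.returnSet ε δ) {r : ℝ} (hr : 0 < r) : dilate r ζ ∈ φ.returnSet ε δ := by
  obtain ⟨h1, h2, h3, h4⟩ := h
  refine ⟨dilate_mem h1 hr.ne', ?_, ?_, h4.dilate hp h1 hr⟩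
  · rwa [hp.homogeneous ζ h1 r hr]
  · rwa [isFixedAtInfinity_dilate_iff hp h1 hr]

theorem apply_mem_returnSet [T2Space M] (hp : IsSymbolOrderZero p) {ε δ : ℝ} {ζ : Cotangent M}
    (h : ζ ∈ φ.returnSet ε δ) (t : ℝ) : φ.toFun t ζ ∈ φ.returnSet ε δ := by
  obtain ⟨h1, h2, h3, h4⟩ := h
  refine ⟨φ.mem t ζ h1, ?_, ?_, h4.apply hp h1 t⟩
  · rwa [φ.symbol_apply hp h1]
  · rwa [φ.isFixedAtInfinity_apply_iff hp h1]

theorem apply_neg_of_apply_eq [T2Space M] (hp : IsSymbolOrderZero p) {ζ : Cotangent M}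
    (hζ : ζ ∈ puncturedCotangent M) {T s : ℝ} (hs : 0 < s) (h : φ.toFun T ζ = dilate s ζ) :
    φ.toFun (-T) ζ = dilate s⁻¹ ζ := by
  have h1 := φ.neg_apply hp T hζ
  rw [h, φ.dilate_apply hp hζ hs] at h1
  rw [← h1, dilate_dilate, inv_mul_cancel₀ hs.ne', dilate_one, h1]

theorem isClosedTrajectory_of_apply_eq [T2Space M] (hp : IsSymbolOrderZero p) {ζ : Cotangent M}
    (hζ : ζ ∈ puncturedCotangent M) (hfix : ¬ IsFixedAtInfinity p ζ) {T s : ℝ} (hT : 0 < T)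
    (hs : 0 < s) (h : φ.toFun T ζ = dilate s ζ) :
    φ.IsClosedTrajectory (p ζ) (range (φ.trajectory ⟨ζ, hζ⟩)) s⁻¹ := by
  have hA : HasMFDerivAt cotangentModel cotangentModel (fun ζ' => dilate s⁻¹ (φ.toFun T ζ')) ζ
      ((dilateDeriv s⁻¹).comp (φ.flowDeriv T ζ)) :=
    (hasMFDerivAt_dilate s⁻¹ (φ.toFun T ζ)).comp ζ (φ.hasMFDerivAt_flow hp hζ T)
  exact ⟨⟨ζ, hζ⟩, T, s, _, rfl, hfix, hT, hs, h, rfl, hA,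
    (φ.multiplier_eq hp hζ hfix hs h hA).2 rfl⟩

theorem mem_range_trajectory {ζ : Cotangent M}
    (hζ : ζ ∈ puncturedCotangent M) : kappa ⟨ζ, hζ⟩ ∈ range (φ.trajectory ⟨ζ, hζ⟩) := by
  refine ⟨0, ?_⟩
  rw [trajectory]
  congr 1
  exact Subtype.ext (φ.zero ζ hζ)

/-- The union of the closed trajectories whose multiplier satisfies a condition. -/
theorem exists_isClosedTrajectory_iff [T2Space M] (hp : IsSymbolOrderZero p) (Q : ℝ → Prop)
    {w : ℝ} {ζ : Cotangent M} (hζ : ζ ∈ puncturedCotangent M) :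
    (∃ (φ : RescaledFlow g p) (C : Set (FiberInfinity M)) (m : ℝ),
      Q m ∧ φ.IsClosedTrajectory w C m ∧ kappa ⟨ζ, hζ⟩ ∈ C) ↔
    p ζ = w ∧ ¬ IsFixedAtInfinity p ζ ∧
      ∃ T s : ℝ, 0 < T ∧ 0 < s ∧ Q s⁻¹ ∧ φ.toFun T ζ = dilate s ζ := by
  constructor
  · rintro ⟨φ', C, m, hm, ⟨⟨ζ', hζ'⟩, T, s, A, hw, hfix, hT, hs, hTs, rfl, hA, hAm⟩, t, ht⟩
    have hms := (φ'.multiplier_eq hp hζ' hfix hs hTs hA).1 hAm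
    obtain ⟨r, hr, hrt⟩ := Quotient.exact ht
    have hrt' : ζ = dilate r (φ.toFun t ζ') := by
      rw [φ.apply_unique hp φ' hζ']
      exact hrt
    have hmem := φ.mem t ζ' hζ'
    refine ⟨?_, ?_, T, s, hT, hs, hms ▸ hm, ?_⟩
    · rw [hrt', hp.homogeneous _ hmem r hr, φ.symbol_apply hp hζ', ← hw]
    · rwa [hrt', isFixedAtInfinity_dilate_iff hp hmem hr, φ.isFixedAtInfinity_apply_iff hp hζ']
    · have hTs' : φ.toFun T ζ' = dilate s ζ' := by
        rw [φ.apply_unique hp φ' hζ']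
        exact hTs
      rw [hrt', φ.dilate_apply hp hmem hr, ← φ.add hp _ _ hζ', add_comm, φ.add hp _ _ hζ', hTs',
        φ.dilate_apply hp hζ' hs, dilate_dilate, dilate_dilate, mul_comm]
  · rintro ⟨rfl, hfix, T, s, hT, hs, hQ, hTs⟩
    exact ⟨φ, _, s⁻¹, hQ, φ.isClosedTrajectory_of_apply_eq hp hζ hfix hT hs hTs,
      φ.mem_range_trajectory hζ⟩

/-- `Λ⁺` consists of points over closed trajectories with multiplier `1/s < 1`. -/
theorem lambdaPlus_eq [T2Space M] (hp : IsSymbolOrderZero p) (δ : ℝ) :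
    lambdaPlus g p δ = φ.returnSet 1 δ := by
  ext ζ
  constructor
  · rintro ⟨w, hw, hζ, hmem⟩
    obtain ⟨rfl, hfix, T, s, hT, hs, hQ, hTs⟩ :=
      (φ.exists_isClosedTrajectory_iff hp (fun m => |m| < 1) hζ).1 hmem
    refine ⟨hζ, hw, hfix, T, s, by linarith, ?_, hTs⟩
    rw [abs_of_pos (inv_pos.2 hs)] at hQ
    exact (inv_lt_one₀ hs).1 hQ
  · rintro ⟨hζ, hw, hfix, T, s, hT, hs, hTs⟩
    refine ⟨p ζ, hw, hζ, (φ.exists_isClosedTrajectory_iff hp (fun m => |m| < 1) hζ).2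
      ⟨rfl, hfix, T, s, by linarith, by linarith, ?_, hTs⟩⟩
    have hs0 : 0 < s := by linarith
    rw [abs_of_pos (inv_pos.2 hs0)]
    exact (inv_lt_one₀ hs0).2 hs

/-- `Λ⁻` consists of points over closed trajectories with multiplier `1/s > 1`; the inverse of the
return map then expands the covectors. -/
theorem lambdaMinus_eq [T2Space M] (hp : IsSymbolOrderZero p) (δ : ℝ) :
    lambdaMinus g p δ = φ.returnSet (-1) δ := by
  ext ζ
  constructor
  · rintro ⟨w, hw, hζ, hmem⟩
    obtain ⟨rfl, hfix, T, s, hT, hs, hQ, hTs⟩ :=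
      (φ.exists_isClosedTrajectory_iff hp (fun m => 1 < |m|) hζ).1 hmem
    rw [abs_of_pos (inv_pos.2 hs)] at hQ
    exact ⟨hζ, hw, hfix, -T, s⁻¹, by linarith, hQ, φ.apply_neg_of_apply_eq hp hζ hs hTs⟩
  · rintro ⟨hζ, hw, hfix, T, s, hT, hs, hTs⟩
    have hs0 : 0 < s := by linarith
    refine ⟨p ζ, hw, hζ, (φ.exists_isClosedTrajectory_iff hp (fun m => 1 < |m|) hζ).2
      ⟨rfl, hfix, -T, s⁻¹, by linarith, inv_pos.2 hs0, ?_,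
        φ.apply_neg_of_apply_eq hp hζ hs0 hTs⟩⟩
    rwa [inv_inv, abs_of_pos hs0]

end RescaledFlow

end ReturningPoints

/-! ### The sign of `Φ` -/

section Sign

variable {M : Type*} [TopologicalSpace M] [ChartedSpace Plane M] [IsManifold 𝓘(ℝ, Plane) ∞ M]
  {g : ContMDiffRiemannianMetric 𝓘(ℝ, Plane) ∞ Plane (fun x : M => TangentSpace 𝓘(ℝ, Plane) x)}
  {p : Cotangent M → ℝ}

/-- A diffeomorphism that maps `Λ` into itself maps its tangent vectors to tangent vectors. -/
theorem IsDefiningFunction.cotangentDiff_map {Λ U U' : Set (Cotangent M)}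
    {G G' : Cotangent M → ℝ} (hG : IsDefiningFunction Λ U G) (hG' : IsDefiningFunction Λ U' G')
    {ψ : Cotangent M → Cotangent M} {ζ : Cotangent M} (hζU : ζ ∈ U) (hζ : ζ ∈ Λ)
    (hψU : ψ ζ ∈ U') (hψ : ContMDiffAt cotangentModel cotangentModel ∞ ψ ζ)
    (hψΛ : ∀ ζ ∈ Λ, ψ ζ ∈ Λ) {A : Plane × DualPlane →L[ℝ] Plane × DualPlane}
    (hA : HasMFDerivAt cotangentModel cotangentModel ψ ζ A) {v : Plane × DualPlane}
    (hv : cotangentDiff G ζ v = 0) : cotangentDiff G' (ψ ζ) (A v) = 0 := by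
  have h1 : ContMDiffAt cotangentModel 𝓘(ℝ, ℝ) ∞ (G' ∘ ψ) ζ :=
    ContMDiffAt.comp ζ (hG'.contMDiffAt hψU) hψ
  obtain ⟨k, hk⟩ := exists_cotangentDiff_eq_smul h1 (hG.contMDiffAt hζU)
    (hG.diff_ne_zero ζ hζU hζ) ((hG.zero_iff ζ hζU).1 hζ) (by
      filter_upwards [hG.isOpen.mem_nhds hζU,
        hψ.continuousAt.eventually_mem (hG'.isOpen.mem_nhds hψU)] with ζ' h2 h3 h4
      exact (hG'.zero_iff _ h3).1 (hψΛ _ ((hG.zero_iff _ h2).2 h4)))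
  have h2 : HasMFDerivAt cotangentModel 𝓘(ℝ, ℝ) G' (ψ ζ) (cotangentDiff G' (ψ ζ)) :=
    ((hG'.contMDiffAt hψU).mdifferentiableAt (by simp)).hasMFDerivAt
  have h3 : cotangentDiff (G' ∘ ψ) ζ = (cotangentDiff G' (ψ ζ)).comp A := (h2.comp ζ hA).mfderiv
  have h4 := congrArg (fun B : Plane × DualPlane →L[ℝ] ℝ => B v) (h3.symm.trans hk)
  have h5 : cotangentDiff G' (ψ ζ) (A v) = k * cotangentDiff G ζ v := h4
  rw [h5, hv, mul_zero]

variable {Λ : Set (Cotangent M)} {Φ : Cotangent M → ℝ}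

theorem IsPhi.apply_dilate (hp : IsSymbolOrderZero p) (hΛ : IsLagrangianFamily p Λ)
    (hΦ : IsPhi p Λ Φ) {ζ : Cotangent M} (hζ : ζ ∈ Λ) {r : ℝ} (hr : 0 < r) :
    Φ (dilate r ζ) = r * Φ ζ := by
  obtain ⟨U, G, hU, hG⟩ := hΛ.hypersurface ζ hζ
  obtain ⟨v, hv2, hv1⟩ := hΛ.diff_ne_zero ζ hζ U G hU hG
  have hζ' := hΛ.conic ζ hζ r hr
  obtain ⟨U', G', hU', hG'⟩ := hΛ.hypersurface _ hζ'
  have hsm : ContMDiffAt cotangentModel cotangentModel ∞ (dilate r : Cotangent M → _) ζ :=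
    ContMDiffAt.comp ζ (g := fun q : ℝ × Cotangent M => dilate q.1 q.2)
      (f := fun ζ => (r, ζ)) contMDiff_dilate.contMDiffAt
      (contMDiffAt_const.prodMk contMDiffAt_id)
  have hv' := hG.cotangentDiff_map hG' hU hζ hU' hsm (fun ξ hξ => hΛ.conic ξ hξ r hr)
    (hasMFDerivAt_dilate r ζ) hv2
  have h1 := hΦ.liouville_eq hG hU hζ hv2
  have h2 := hΦ.liouville_eq hG' hU' hζ' hv'
  rw [hp.cotangentDiff_dilate (hΛ.subset hζ) hr] at h2
  have h3 : r * ζ.2 v.1 = -Φ (dilate r ζ) * cotangentDiff p ζ v := h2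
  rw [h1] at h3
  exact mul_right_cancel₀ hv1 (by linarith)

/-- `Φ` grows along the flow by the integral of the norm. -/
theorem IsPhi.apply_flow (hp : IsSymbolOrderZero p) [T2Space M] (φ : RescaledFlow g p)
    (hΛ : IsLagrangianFamily p Λ) (hφ : ∀ t, ∀ ζ ∈ Λ, φ.toFun t ζ ∈ Λ)
    (hΦ : IsPhi p Λ Φ) {ζ : Cotangent M} (hζ : ζ ∈ Λ) (t : ℝ) :
    Φ (φ.toFun t ζ) = Φ ζ + ∫ τ in (0 : ℝ)..t, covectorNorm g (φ.toFun τ ζ) := by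
  obtain ⟨U, G, hU, hG⟩ := hΛ.hypersurface ζ hζ
  obtain ⟨v, hv2, hv1⟩ := hΛ.diff_ne_zero ζ hζ U G hU hG
  obtain ⟨U', G', hU', hG'⟩ := hΛ.hypersurface _ (hφ t ζ hζ)
  have hN := hΛ.subset hζ
  have hv' := hG.cotangentDiff_map hG' hU hζ hU' (φ.contMDiffAt_time hp hN t)
    (fun ξ hξ => hφ t ξ hξ) (φ.hasMFDerivAt_flow hp hN t) hv2
  have h1 := hΦ.liouville_eq hG hU hζ hv2
  have h2 := hΦ.liouville_eq hG' hU' (hφ t ζ hζ) hv'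
  rw [φ.cotangentDiff_flowDeriv hp hN, φ.liouville_flowDeriv hp hN, h1] at h2
  exact mul_right_cancel₀ hv1 (by linarith)

/-- If `φ_T ζ = s ζ`, then `(s - 1) Φ(ζ)` is the integral of the norm over `[0, T]`. Hence `Φ` has
the sign of `T`, if `s > 1`. -/
theorem IsPhi.pos_of_isReturning (hp : IsSymbolOrderZero p) [T2Space M] (φ : RescaledFlow g p)
    (hΛ : IsLagrangianFamily p Λ) (hφ : ∀ t, ∀ ζ ∈ Λ, φ.toFun t ζ ∈ Λ)
    (hΦ : IsPhi p Λ Φ) {ε : ℝ} (hε : ε = 1 ∨ ε = -1) {ζ : Cotangent M} (hζ : ζ ∈ Λ)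
    (hret : φ.IsReturning ε ζ) : 0 < ε * Φ ζ := by
  obtain ⟨T, s, hT, hs, hTs⟩ := hret
  have h1 := hΦ.apply_flow hp φ hΛ hφ hζ T
  rw [hTs, hΦ.apply_dilate hp hΛ hζ (by linarith)] at h1
  have hN := hΛ.subset hζ
  have hpos : ∀ a b : ℝ, a < b → 0 < ∫ τ in a..b, covectorNorm g (φ.toFun τ ζ) := fun a b hab =>
    intervalIntegral.intervalIntegral_pos_of_pos_on
      ((φ.continuous_covectorNorm hN).intervalIntegrable _ _)
      (fun τ _ => covectorNorm_pos g (φ.mem τ ζ hN)) hab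
  have h2 : (s - 1) * Φ ζ = ∫ τ in (0 : ℝ)..T, covectorNorm g (φ.toFun τ ζ) := by linarith
  have h3 : 0 < (s - 1) * (ε * Φ ζ) := by
    rcases hε with rfl | rfl
    · have := hpos 0 T (by linarith)
      linarith
    · have := hpos T 0 (by linarith)
      rw [intervalIntegral.integral_symm] at this
      linarith
  exact (pos_iff_pos_of_mul_pos h3).1 (by linarith)

/-- Up to dilations, `T*M ∖ 0` is compact. -/
theorem exists_isCompact_dilate_mem [CompactSpace M] [T2Space M] :
    ∃ K ⊆ puncturedCotangent M, IsCompact K ∧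
      ∀ ζ ∈ puncturedCotangent M, ∃ r : ℝ, 0 < r ∧ dilate r ζ ∈ K := by
  suffices h : ∃ K ⊆ puncturedCotangent M, IsCompact K ∧
      ∀ ζ ∈ puncturedCotangent M, ζ.1 ∈ (univ : Set M) → ∃ r : ℝ, 0 < r ∧ dilate r ζ ∈ K by
    obtain ⟨K, hK, hKc, h⟩ := h
    exact ⟨K, hK, hKc, fun ζ hζ => h ζ hζ (mem_univ _)⟩
  refine isCompact_univ.induction_on (p := fun s : Set M => ∃ K ⊆ puncturedCotangent M,
    IsCompact K ∧ ∀ ζ ∈ puncturedCotangent M, ζ.1 ∈ s → ∃ r : ℝ, 0 < r ∧ dilate r ζ ∈ K)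
    ?_ ?_ ?_ ?_
  · exact ⟨∅, empty_subset _, isCompact_empty, fun ζ _ h => h.elim⟩
  · rintro s t hst ⟨K, hK, hKc, h⟩
    exact ⟨K, hK, hKc, fun ζ hζ hs => h ζ hζ (hst hs)⟩
  · rintro s t ⟨K, hK, hKc, h⟩ ⟨K', hK', hKc', h'⟩
    refine ⟨K ∪ K', union_subset hK hK', hKc.union hKc', fun ζ hζ hst => ?_⟩
    rcases hst with hs | ht
    · obtain ⟨r, hr, hm⟩ := h ζ hζ hs
      exact ⟨r, hr, Or.inl hm⟩
    · obtain ⟨r, hr, hm⟩ := h' ζ hζ ht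
      exact ⟨r, hr, Or.inr hm⟩
  · intro x _
    let ζ₀ : Cotangent M := ⟨x, 0⟩
    set c := extChartAt cotangentModel ζ₀ with hc
    set b := extChartAt 𝓘(ℝ, Plane) x with hb
    obtain ⟨ρ, hρ, hball⟩ := Metric.nhds_basis_closedBall.mem_iff.1
      ((isOpen_extChartAt_target (I := 𝓘(ℝ, Plane)) x).mem_nhds (mem_extChartAt_target x))
    have hsub : Metric.closedBall (b x) ρ ×ˢ Metric.sphere (0 : DualPlane) 1 ⊆ c.target := by
      rw [hc, cotangentChart_target]
      exact prod_mono hball (subset_univ _)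
    refine ⟨b.source ∩ b ⁻¹' Metric.closedBall (b x) ρ, ?_,
      c.symm '' (Metric.closedBall (b x) ρ ×ˢ Metric.sphere (0 : DualPlane) 1), ?_, ?_, ?_⟩
    · refine mem_nhdsWithin_of_mem_nhds (inter_mem (extChartAt_source_mem_nhds x) ?_)
      exact (continuousAt_extChartAt x).preimage_mem_nhds (Metric.closedBall_mem_nhds _ hρ)
    · rintro _ ⟨z, hz, rfl⟩ h0
      have h1 := mem_cotangentChart_source.1 (c.map_target (hsub hz))
      have h2 := (cotangentChart_snd_eq_zero h1).2 h0
      rw [← hc, c.right_inv (hsub hz)] at h2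
      have h3 := hz.2
      rw [h2] at h3
      simp at h3
    · exact ((isCompact_closedBall _ _).prod (isCompact_sphere _ _)).image_of_continuousOn
        ((continuousOn_extChartAt_symm ζ₀).mono hsub)
    · rintro ζ hζ ⟨hζs, hζb⟩
      have hs : ζ.1 ∈ (chartAt Plane ζ₀.1).source := by
        rwa [hb, extChartAt_source] at hζs
      have h1 : (c ζ).2 ≠ 0 := fun h => hζ ((cotangentChart_snd_eq_zero hs).1 h)
      have h2 : 0 < ‖(c ζ).2‖ := norm_pos_iff.2 h1
      refine ⟨‖(c ζ).2‖⁻¹, inv_pos.2 h2, c (dilate ‖(c ζ).2‖⁻¹ ζ), ?_, ?_⟩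
      · rw [hc, cotangentChart_dilate]
        refine ⟨?_, ?_⟩
        · rw [cotangentChart_fst]
          exact hζb
        · rw [mem_sphere_zero_iff_norm, norm_smul, norm_inv, norm_norm]
          exact inv_mul_cancel₀ h2.ne'
      · exact c.left_inv (mem_cotangentChart_source.2 hs)

/-- For bounded times, the flow cannot contract the norm too much. -/
theorem RescaledFlow.exists_le_covectorNorm (φ : RescaledFlow g p) (hp : IsSymbolOrderZero p)
    [CompactSpace M] [T2Space M] : ∃ c : ℝ, 0 < c ∧ ∀ ζ ∈ puncturedCotangent M,
      ∀ t ∈ Icc (-1 : ℝ) 1, c * covectorNorm g ζ ≤ covectorNorm g (φ.toFun t ζ) := by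
  obtain ⟨K, hKN, hK, hcov⟩ := exists_isCompact_dilate_mem (M := M)
  have hcont : ContinuousOn
      (fun q : ℝ × Cotangent M => covectorNorm g (φ.toFun q.1 q.2) / covectorNorm g q.2)
      (Icc (-1 : ℝ) 1 ×ˢ K) := by
    rintro ⟨t, ζ⟩ ⟨-, hζ⟩
    have hN := hKN hζ
    refine ContinuousAt.continuousWithinAt (ContinuousAt.div ?_ ?_ (covectorNorm_pos g hN).ne')
    · exact ContinuousAt.comp (f := fun q : ℝ × Cotangent M => φ.toFun q.1 q.2)
        (contMDiffAt_covectorNorm g (φ.mem t ζ hN)).continuousAt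
        (φ.contMDiffAt hp hN t).continuousAt
    · exact ContinuousAt.comp (f := fun q : ℝ × Cotangent M => q.2)
        (contMDiffAt_covectorNorm g hN).continuousAt continuousAt_snd
  rcases (Icc (-1 : ℝ) 1 ×ˢ K).eq_empty_or_nonempty with hempty | hne
  · refine ⟨1, one_pos, fun ζ hζ t ht => ?_⟩
    obtain ⟨r, -, hr⟩ := hcov ζ hζ
    exact (Set.notMem_empty _ (hempty ▸ mk_mem_prod ht hr)).elim
  obtain ⟨⟨t₀, ζ₀⟩, ⟨-, hζ₀⟩, hmin⟩ :=
    (isCompact_Icc.prod hK).exists_isMinOn hne hcont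
  refine ⟨_, div_pos (covectorNorm_pos g (φ.mem t₀ ζ₀ (hKN hζ₀)))
    (covectorNorm_pos g (hKN hζ₀)), fun ζ hζ t ht => ?_⟩
  obtain ⟨r, hr, hrK⟩ := hcov ζ hζ
  have h1 := hmin (mk_mem_prod ht hrK)
  change _ ≤ covectorNorm g (φ.toFun t (dilate r ζ)) / covectorNorm g (dilate r ζ) at h1
  rw [φ.dilate_apply hp hζ hr, covectorNorm_dilate g _ hr.le, covectorNorm_dilate g _ hr.le,
    mul_div_mul_left _ _ hr.ne', le_div_iff₀ (covectorNorm_pos g hζ)] at h1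
  exact h1

/-- As `Φ` increases along the flow, its positivity at an earlier or later point of the trajectory
implies a lower bound that is uniform by compactness. -/
theorem IsPhi.exists_le (hp : IsSymbolOrderZero p) [CompactSpace M] [T2Space M]
    (φ : RescaledFlow g p) (hΛ : IsLagrangianFamily p Λ)
    (hφ : ∀ t, ∀ ζ ∈ Λ, φ.toFun t ζ ∈ Λ) {ε : ℝ} (hε : ε = 1 ∨ ε = -1)
    (hret : ∀ ζ ∈ Λ, φ.IsReturning ε ζ) :
    ∃ c : ℝ, 0 < c ∧ ∀ Φ : Cotangent M → ℝ, IsPhi p Λ Φ →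
      ∀ ζ ∈ Λ, c * covectorNorm g ζ ≤ ε * Φ ζ := by
  obtain ⟨c, hc, hmin⟩ := φ.exists_le_covectorNorm hp
  refine ⟨c, hc, fun Φ hΦ ζ hζ => ?_⟩
  have hN := hΛ.subset hζ
  have h1 := hΦ.pos_of_isReturning hp φ hΛ hφ hε (hφ (-ε) ζ hζ) (hret _ (hφ (-ε) ζ hζ))
  rw [hΦ.apply_flow hp φ hΛ hφ hζ] at h1
  have hint : ∀ a b : ℝ, b - a = 1 → -1 ≤ a → b ≤ 1 →
      c * covectorNorm g ζ ≤ ∫ τ in a..b, covectorNorm g (φ.toFun τ ζ) := by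
    intro a b hab ha hb
    have h2 := intervalIntegral.integral_mono_on (a := a) (b := b)
      (μ := MeasureTheory.volume)
      (f := fun _ => c * covectorNorm g ζ)
      (g := fun τ => covectorNorm g (φ.toFun τ ζ)) (by linarith)
      (continuous_const.intervalIntegrable _ _)
      ((φ.continuous_covectorNorm hN).intervalIntegrable _ _)
      (fun τ hτ => hmin ζ hN τ ⟨ha.trans hτ.1, hτ.2.trans hb⟩)
    rwa [intervalIntegral.integral_const, hab, one_smul] at h2
  rcases hε with rfl | rfl
  · have h2 := hint (-1) 0 (by norm_num) le_rfl (by norm_num)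
    rw [intervalIntegral.integral_symm] at h2
    linarith
  · have h2 := hint 0 1 (by norm_num) (by norm_num) le_rfl
    rw [neg_neg] at h1
    linarith

end Sign

/-! ### Fixed points of maps that contract the levels of a function -/

section LevelContraction

/-- A map `R` of the plane with the fixed point `0` which preserves the levels of a function `q`
with `dq(0) = dx₁`, and which contracts the level through `0` infinitesimally, contracts all nearby
levels: near `0` a point is fixed as soon as its second coordinate is, and all orbits that
start near `0` converge to fixed points. -/
theorem exists_fixedPoint_of_level_contraction {R : ℝ × ℝ → ℝ × ℝ} {q : ℝ × ℝ → ℝ}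
    {R' : ℝ × ℝ →L[ℝ] ℝ × ℝ} {q' : ℝ × ℝ →L[ℝ] ℝ} (hR : HasStrictFDerivAt R R' 0) (hR0 : R 0 = 0)
    (hq : HasStrictFDerivAt q q' 0) (hq' : ∀ u, q' u = u.1) (hl : |(R' (0, 1)).2| < 1)
    (hinv : ∀ᶠ x in 𝓝 0, q (R x) = q x) :
    (∀ᶠ x in 𝓝 (0 : ℝ × ℝ), (R x).2 = x.2 → R x = x) ∧
      ∀ W ∈ 𝓝 (0 : ℝ × ℝ), ∀ᶠ x in 𝓝 0, ∃ z ∈ W, R z = z ∧ (∀ n : ℕ, R^[n] x ∈ W) ∧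
        Tendsto (fun n : ℕ => R^[n] x) atTop (𝓝 z) := by
  set m := (R' (1, 0)).2 with hm
  set l := (R' (0, 1)).2 with hl'
  have hR2 : ∀ u, (R' u).2 = m * u.1 + l * u.2 := by
    intro u
    have h1 : u = u.1 • ((1 : ℝ), (0 : ℝ)) + u.2 • ((0 : ℝ), (1 : ℝ)) := by
      ext <;> simp
    conv_lhs => rw [h1, map_add, map_smul, map_smul]
    simp only [Prod.snd_add, Prod.smul_snd, smul_eq_mul]
    ring
  -- `η` is so small that `(|m| + 1) η + |l| = μ < 1`
  set μ := (1 + |l|) / 2 with hμ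
  set η := (1 - |l|) / (2 * (|m| + 1)) with hη
  have hm1 : 0 < |m| + 1 := by positivity
  have hη0 : 0 < η := div_pos (by linarith) (by linarith)
  have hημ : (|m| + 1) * η + |l| = μ := by
    rw [hη, hμ]
    field_simp
    ring
  have hμ1 : μ < 1 := by linarith
  have hμ0 : 0 ≤ μ := by positivity
  have hη1 : η < 1 := by nlinarith [abs_nonneg m, abs_nonneg l]
  have hcont : ContinuousAt R 0 := hR.continuousAt
  -- on a level of `q`, the norm is the distance of the second coordinates
  have hE : ∀ᶠ y in 𝓝 ((0 : ℝ × ℝ), (0 : ℝ × ℝ)), q y.1 = q y.2 →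
      ‖y.1 - y.2‖ = |y.1.2 - y.2.2| ∧ |y.1.1 - y.2.1| ≤ η * ‖y.1 - y.2‖ := by
    filter_upwards [hq.isLittleO.def hη0] with y hy hqy
    rw [hqy, sub_self, zero_sub, norm_neg, hq', Real.norm_eq_abs] at hy
    refine ⟨?_, hy⟩
    rw [Prod.norm_def] at hy ⊢
    simp only [Prod.fst_sub, Prod.snd_sub, Real.norm_eq_abs] at hy ⊢
    refine max_eq_right ?_
    by_contra! hlt
    rw [max_eq_left hlt.le] at hy
    have : 0 < |y.1.1 - y.2.1| := (abs_nonneg _).trans_lt hlt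
    nlinarith
  have hRR : Tendsto (fun y : (ℝ × ℝ) × (ℝ × ℝ) => (R y.1, R y.2)) (𝓝 (0, 0)) (𝓝 (0, 0)) := by
    have h1 : ContinuousAt (fun y : (ℝ × ℝ) × (ℝ × ℝ) => (R y.1, R y.2)) (0, 0) :=
      (ContinuousAt.comp (f := Prod.fst) (x := ((0 : ℝ × ℝ), (0 : ℝ × ℝ))) hcont
        continuousAt_fst).prodMk (ContinuousAt.comp (f := Prod.snd)
          (x := ((0 : ℝ × ℝ), (0 : ℝ × ℝ))) hcont continuousAt_snd)
    rw [ContinuousAt, hR0] at h1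
    exact h1
  have hC : ∀ᶠ y in 𝓝 ((0 : ℝ × ℝ), (0 : ℝ × ℝ)), q y.1 = q y.2 →
      ‖R y.1 - R y.2‖ ≤ μ * ‖y.1 - y.2‖ := by
    have hinv1 : ∀ᶠ y in 𝓝 ((0 : ℝ × ℝ), (0 : ℝ × ℝ)), q (R y.1) = q y.1 :=
      (continuous_fst.tendsto ((0 : ℝ × ℝ), (0 : ℝ × ℝ))).eventually hinv
    have hinv2 : ∀ᶠ y in 𝓝 ((0 : ℝ × ℝ), (0 : ℝ × ℝ)), q (R y.2) = q y.2 :=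
      (continuous_snd.tendsto ((0 : ℝ × ℝ), (0 : ℝ × ℝ))).eventually hinv
    filter_upwards [hE, hRR.eventually hE, hinv1, hinv2, hR.isLittleO.def hη0]
      with y h1 h2 h3 h4 h5 hqy
    rw [(h2 (by rw [h3, h4, hqy])).1]
    have h6 := (norm_snd_le (R y.1 - R y.2 - R' (y.1 - y.2))).trans h5
    rw [Prod.snd_sub, Prod.snd_sub, hR2, Real.norm_eq_abs] at h6
    obtain ⟨h7, h8⟩ := h1 hqy
    set d := ‖y.1 - y.2‖ with hd
    have h9 : |m * (y.1 - y.2).1 + l * (y.1 - y.2).2| ≤ |m| * (η * d) + |l| * d := by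
      refine (abs_add_le _ _).trans (add_le_add ?_ ?_)
      · rw [abs_mul]
        exact mul_le_mul_of_nonneg_left h8 (abs_nonneg _)
      · rw [abs_mul, h7]
        rfl
    have h10 : |(R y.1).2 - (R y.2).2| ≤ η * d + (|m| * (η * d) + |l| * d) := by
      have := abs_sub_abs_le_abs_sub ((R y.1).2 - (R y.2).2)
        (m * (y.1 - y.2).1 + l * (y.1 - y.2).2)
      linarith
    calc |(R y.1).2 - (R y.2).2| ≤ η * d + (|m| * (η * d) + |l| * d) := h10
      _ = ((|m| + 1) * η + |l|) * d := by ring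
      _ = μ * d := by rw [hημ]
  constructor
  · have h1 : Tendsto (fun x : ℝ × ℝ => (R x, x)) (𝓝 0) (𝓝 (0, 0)) := by
      have := hcont.prodMk (continuousAt_id (x := (0 : ℝ × ℝ)))
      rw [ContinuousAt, hR0] at this
      exact this
    filter_upwards [h1.eventually hE, hinv] with x h2 h3 h4
    have h5 := (h2 h3).1
    rw [h4, sub_self, abs_zero, norm_eq_zero, sub_eq_zero] at h5
    exact h5
  · intro W hW
    obtain ⟨K, s, hs, hsK⟩ := hq.exists_lipschitzOnWith
    have hC' := hC
    rw [nhds_prod_eq] at hC'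
    obtain ⟨t, ht, htC⟩ := (eventually_prod_self_iff
      (r := fun x y => q x = q y → ‖R x - R y‖ ≤ μ * ‖x - y‖)).1 hC'
    obtain ⟨r, hr, hball⟩ := Metric.nhds_basis_closedBall.mem_iff.1
      (inter_mem (inter_mem hs ht) (inter_mem hW hinv))
    have hsmall : ∀ᶠ x in 𝓝 (0 : ℝ × ℝ), ‖R x - x‖ < (1 - μ) * (r / 2) := by
      have h1 : ContinuousAt (fun x => ‖R x - x‖) 0 := (hcont.sub continuousAt_id).norm
      refine h1.eventually (gt_mem_nhds ?_)
      change ‖R 0 - 0‖ < _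
      rw [hR0, sub_zero, norm_zero]
      exact mul_pos (by linarith) (by linarith)
    filter_upwards [hsmall, Metric.closedBall_mem_nhds (0 : ℝ × ℝ) (half_pos hr)] with x hx1 hx2
    have hx2' : ‖x‖ ≤ r / 2 := by simpa using hx2
    have hsub : Metric.closedBall x (r / 2) ⊆ Metric.closedBall 0 r := by
      refine Metric.closedBall_subset_closedBall' ?_
      rw [dist_zero_right]
      linarith
    set Z := Metric.closedBall x (r / 2) ∩ q ⁻¹' {q x} with hZ
    have hZc : IsComplete Z := by
      refine IsClosed.isComplete (ContinuousOn.preimage_isClosed_of_isClosed ?_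
        Metric.isClosed_closedBall isClosed_singleton)
      exact hsK.continuousOn.mono fun y hy => (hball (hsub hy)).1.1
    have hxZ : x ∈ Z := ⟨Metric.mem_closedBall_self (by linarith), rfl⟩
    have hcontr : ∀ y ∈ Z, ∀ y' ∈ Z, ‖R y - R y'‖ ≤ μ * ‖y - y'‖ := fun y hy y' hy' =>
      htC y (hball (hsub hy.1)).1.2 y' (hball (hsub hy'.1)).1.2
        ((show q y = q x from hy.2).trans (show q y' = q x from hy'.2).symm)
    have hmaps : MapsTo R Z Z := by
      intro y hy
      refine ⟨?_, ?_⟩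
      · have h1 := hcontr y hy x hxZ
        have h2 : ‖y - x‖ ≤ r / 2 := by simpa [dist_eq_norm] using hy.1
        rw [Metric.mem_closedBall, dist_eq_norm]
        calc ‖R y - x‖ = ‖(R y - R x) + (R x - x)‖ := by congr 1; abel
          _ ≤ ‖R y - R x‖ + ‖R x - x‖ := norm_add_le _ _
          _ ≤ μ * (r / 2) + (1 - μ) * (r / 2) :=
            add_le_add (h1.trans (mul_le_mul_of_nonneg_left h2 hμ0)) hx1.le
          _ = r / 2 := by ring
      · have h1 : q (R y) = q y := (hball (hsub hy.1)).2.2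
        exact h1.trans hy.2
    have hcw : ContractingWith ⟨μ, hμ0⟩ (hmaps.restrict R Z Z) := by
      refine ⟨by exact_mod_cast hμ1, LipschitzWith.of_dist_le_mul fun y y' => ?_⟩
      rw [Subtype.dist_eq, Subtype.dist_eq, dist_eq_norm, dist_eq_norm]
      exact hcontr y y.2 y' y'.2
    obtain ⟨z, hzZ, hz, htend, -⟩ := hcw.exists_fixedPoint' hZc hmaps hxZ (edist_ne_top _ _)
    exact ⟨z, (hball (hsub hzZ.1)).2.1, hz,
      fun n => (hball (hsub (hmaps.iterate n hxZ).1)).2.1, htend⟩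

end LevelContraction

/-! ### Slices of the action of the flow and the dilations -/

section SliceCoordinates

variable {M : Type*} [TopologicalSpace M] [ChartedSpace Plane M] [IsManifold 𝓘(ℝ, Plane) ∞ M]
  {g : ContMDiffRiemannianMetric 𝓘(ℝ, Plane) ∞ Plane (fun x : M => TangentSpace 𝓘(ℝ, Plane) x)}
  {p : Cotangent M → ℝ}

namespace RescaledFlow

variable (φ : RescaledFlow g p)

/-- The action of `ℝ²` on `T*M ∖ 0` by the flow and the positive dilations. -/
noncomputable def act (k : ℝ × ℝ) (ζ : Cotangent M) : Cotangent M :=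
  dilate (Real.exp k.2) (φ.toFun k.1 ζ)

theorem act_mem (k : ℝ × ℝ) {ζ : Cotangent M} (hζ : ζ ∈ puncturedCotangent M) :
    φ.act k ζ ∈ puncturedCotangent M :=
  dilate_mem (φ.mem _ ζ hζ) (Real.exp_pos _).ne'

theorem act_zero {ζ : Cotangent M} (hζ : ζ ∈ puncturedCotangent M) : φ.act 0 ζ = ζ := by
  rw [act, Prod.snd_zero, Prod.fst_zero, Real.exp_zero, dilate_one, φ.zero ζ hζ]

theorem symbol_act (hp : IsSymbolOrderZero p) (k : ℝ × ℝ) {ζ : Cotangent M}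
    (hζ : ζ ∈ puncturedCotangent M) : p (φ.act k ζ) = p ζ := by
  rw [act, hp.homogeneous _ (φ.mem _ ζ hζ) _ (Real.exp_pos _), φ.symbol_apply hp hζ]

variable [T2Space M]

theorem act_add (hp : IsSymbolOrderZero p) (k k' : ℝ × ℝ) {ζ : Cotangent M}
    (hζ : ζ ∈ puncturedCotangent M) : φ.act (k + k') ζ = φ.act k (φ.act k' ζ) := by
  rw [act, act, act, φ.dilate_apply hp (φ.mem _ ζ hζ) (Real.exp_pos _), ← φ.add hp _ _ hζ,
    dilate_dilate, Prod.snd_add, Prod.fst_add, Real.exp_add]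

theorem contMDiffAt_act (hp : IsSymbolOrderZero p) (k : ℝ × ℝ) {ζ : Cotangent M}
    (hζ : ζ ∈ puncturedCotangent M) :
    ContMDiffAt (𝓘(ℝ, ℝ × ℝ).prod cotangentModel) cotangentModel ∞
      (fun q : (ℝ × ℝ) × Cotangent M => φ.act q.1 q.2) (k, ζ) := by
  have h1 : ContMDiffAt (𝓘(ℝ, ℝ × ℝ).prod cotangentModel) 𝓘(ℝ, ℝ) ∞
      (Prod.fst ∘ (Prod.fst : (ℝ × ℝ) × Cotangent M → ℝ × ℝ)) (k, ζ) :=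
    ContMDiffAt.comp (k, ζ) contDiff_fst.contMDiff.contMDiffAt contMDiffAt_fst
  have h2 : ContMDiffAt (𝓘(ℝ, ℝ × ℝ).prod cotangentModel) 𝓘(ℝ, ℝ) ∞
      ((fun k : ℝ × ℝ => Real.exp k.2) ∘ (Prod.fst : (ℝ × ℝ) × Cotangent M → ℝ × ℝ)) (k, ζ) :=
    ContMDiffAt.comp (k, ζ) contDiff_snd.exp.contMDiff.contMDiffAt contMDiffAt_fst
  have h3 : ContMDiffAt (𝓘(ℝ, ℝ × ℝ).prod cotangentModel) cotangentModel ∞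
      ((fun q : ℝ × Cotangent M => φ.toFun q.1 q.2) ∘
        fun q : (ℝ × ℝ) × Cotangent M => (q.1.1, q.2)) (k, ζ) :=
    ContMDiffAt.comp (k, ζ) (φ.contMDiffAt hp hζ k.1) (h1.prodMk contMDiffAt_snd)
  exact ContMDiffAt.comp (k, ζ) (g := fun q : ℝ × Cotangent M => dilate q.1 q.2)
    contMDiff_dilate.contMDiffAt (h2.prodMk h3)

/-- The derivative of the action of `k`. -/
noncomputable def actDeriv (k : ℝ × ℝ) (ζ : Cotangent M) :
    Plane × DualPlane →L[ℝ] Plane × DualPlane :=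
  (dilateDeriv (Real.exp k.2)).comp (φ.flowDeriv k.1 ζ)

theorem hasMFDerivAt_act (hp : IsSymbolOrderZero p) (k : ℝ × ℝ) {ζ : Cotangent M}
    (hζ : ζ ∈ puncturedCotangent M) :
    HasMFDerivAt cotangentModel cotangentModel (φ.act k) ζ (φ.actDeriv k ζ) :=
  (hasMFDerivAt_dilate _ _).comp ζ (φ.hasMFDerivAt_flow hp hζ k.1)

theorem liouville_actDeriv (hp : IsSymbolOrderZero p) (k : ℝ × ℝ) {ζ : Cotangent M}
    (hζ : ζ ∈ puncturedCotangent M) {v : Plane × DualPlane} (hv : cotangentDiff p ζ v = 0) :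
    (φ.act k ζ).2 (φ.actDeriv k ζ v).1 = Real.exp k.2 * ζ.2 v.1 := by
  have h := φ.liouville_flowDeriv hp hζ k.1 v
  rw [hv, zero_mul, sub_zero] at h
  rw [← h]
  rfl

/-- The affine slice through `ζ₀` spanned by the vectors `f` and `e`, in the chart centred at
`ζ₀`. -/
noncomputable def _root_.cotangentSlice (ζ₀ : Cotangent M) (e f : Plane × DualPlane)
    (x : ℝ × ℝ) : Cotangent M :=
  (extChartAt cotangentModel ζ₀).symm (extChartAt cotangentModel ζ₀ ζ₀ + x.1 • f + x.2 • e)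

theorem _root_.cotangentSlice_zero (ζ₀ : Cotangent M) (e f : Plane × DualPlane) :
    cotangentSlice ζ₀ e f 0 = ζ₀ := by
  simp only [cotangentSlice, Prod.fst_zero, Prod.snd_zero, zero_smul, add_zero]
  exact extChartAt_to_inv ζ₀

theorem _root_.eventually_contMDiffAt_cotangentSlice (ζ₀ : Cotangent M) (e f : Plane × DualPlane) :
    ∀ᶠ x in 𝓝 0, ContMDiffAt 𝓘(ℝ, ℝ × ℝ) cotangentModel ∞ (cotangentSlice ζ₀ e f) x := by
  have hs : ContDiff ℝ ∞ (fun x : ℝ × ℝ =>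
      extChartAt cotangentModel ζ₀ ζ₀ + x.1 • f + x.2 • e) := by fun_prop
  have h1 : ∀ᶠ x : ℝ × ℝ in 𝓝 0, extChartAt cotangentModel ζ₀ ζ₀ + x.1 • f + x.2 • e ∈
      (extChartAt cotangentModel ζ₀).target := by
    refine hs.continuous.continuousAt.eventually_mem ((isOpen_extChartAt_target ζ₀).mem_nhds ?_)
    simp only [Prod.fst_zero, Prod.snd_zero, zero_smul, add_zero]
    exact mem_extChartAt_target ζ₀
  filter_upwards [h1] with x hx
  exact ContMDiffAt.comp x (g := (extChartAt cotangentModel ζ₀).symm)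
    ((contMDiffOn_extChartAt_symm ζ₀).contMDiffAt ((isOpen_extChartAt_target ζ₀).mem_nhds hx))
    hs.contMDiff.contMDiffAt

theorem _root_.hasFDerivAt_cotangentSlice (ζ₀ : Cotangent M) (e f : Plane × DualPlane) :
    HasFDerivAt (fun x => extChartAt cotangentModel ζ₀ (cotangentSlice ζ₀ e f x))
      ((ContinuousLinearMap.fst ℝ ℝ ℝ).smulRight f + (ContinuousLinearMap.snd ℝ ℝ ℝ).smulRight e)
      0 := by
  have h1 : HasFDerivAt (fun x : ℝ × ℝ => extChartAt cotangentModel ζ₀ ζ₀ + x.1 • f + x.2 • e)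
      ((ContinuousLinearMap.fst ℝ ℝ ℝ).smulRight f +
        (ContinuousLinearMap.snd ℝ ℝ ℝ).smulRight e) 0 := by
    have := (((hasFDerivAt_fst (𝕜 := ℝ) (E := ℝ) (F := ℝ) (p := 0)).smul_const f).const_add
      (extChartAt cotangentModel ζ₀ ζ₀)).add
      ((hasFDerivAt_snd (𝕜 := ℝ) (E := ℝ) (F := ℝ) (p := 0)).smul_const e)
    exact this
  refine h1.congr_of_eventuallyEq ?_
  have h2 : ∀ᶠ x : ℝ × ℝ in 𝓝 0, extChartAt cotangentModel ζ₀ ζ₀ + x.1 • f + x.2 • e ∈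
      (extChartAt cotangentModel ζ₀).target := by
    refine h1.continuousAt.eventually_mem ((isOpen_extChartAt_target ζ₀).mem_nhds ?_)
    simp only [Prod.fst_zero, Prod.snd_zero, zero_smul, add_zero]
    exact mem_extChartAt_target ζ₀
  filter_upwards [h2] with x hx
  exact (extChartAt cotangentModel ζ₀).right_inv hx

theorem _root_.hasMFDerivAt_cotangentSlice (ζ₀ : Cotangent M) (e f : Plane × DualPlane) :
    HasMFDerivAt 𝓘(ℝ, ℝ × ℝ) cotangentModel (cotangentSlice ζ₀ e f) 0
      ((ContinuousLinearMap.fst ℝ ℝ ℝ).smulRight f +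
        (ContinuousLinearMap.snd ℝ ℝ ℝ).smulRight e : ℝ × ℝ →L[ℝ] Plane × DualPlane) := by
  obtain ⟨B, hB⟩ : ∃ B : ℝ × ℝ →L[ℝ] Plane × DualPlane,
      HasMFDerivAt 𝓘(ℝ, ℝ × ℝ) cotangentModel (cotangentSlice ζ₀ e f) 0 B :=
    ⟨_, ((eventually_contMDiffAt_cotangentSlice ζ₀ e f).self_of_nhds.mdifferentiableAt
      (by simp)).hasMFDerivAt⟩
  have h1 : HasMFDerivAt cotangentModel 𝓘(ℝ, Plane × DualPlane) (extChartAt cotangentModel ζ₀)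
      (cotangentSlice ζ₀ e f 0) (ContinuousLinearMap.id ℝ (Plane × DualPlane)) := by
    rw [cotangentSlice_zero, ← chartDeriv_self ζ₀]
    exact hasMFDerivAt_cotangentChart (mem_chart_source _ _)
  have h2 : HasFDerivAt (fun x => extChartAt cotangentModel ζ₀ (cotangentSlice ζ₀ e f x)) B 0 :=
    (h1.comp (0 : ℝ × ℝ) hB).hasFDerivAt
  rw [← h2.unique (hasFDerivAt_cotangentSlice ζ₀ e f)]
  exact hB

theorem _root_.eventually_cotangentSlice_mem {ζ₀ : Cotangent M} (hζ₀ : ζ₀ ∈ puncturedCotangent M)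
    (e f : Plane × DualPlane) :
    ∀ᶠ x in 𝓝 0, cotangentSlice ζ₀ e f x ∈ puncturedCotangent M :=
  (eventually_contMDiffAt_cotangentSlice ζ₀ e f).self_of_nhds.continuousAt.eventually_mem (by
    rw [cotangentSlice_zero]
    exact isOpen_puncturedCotangent.mem_nhds hζ₀)

/-- The map `(k, x) ↦ act k (cotangentSlice x)` is smooth near `0`. -/
theorem eventually_contMDiffAt_act_slice (hp : IsSymbolOrderZero p) {ζ₀ : Cotangent M}
    (hζ₀ : ζ₀ ∈ puncturedCotangent M) (e f : Plane × DualPlane) :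
    ∀ᶠ y in 𝓝 (0 : (ℝ × ℝ) × (ℝ × ℝ)), ContMDiffAt 𝓘(ℝ, (ℝ × ℝ) × (ℝ × ℝ)) cotangentModel ∞
      (fun y : (ℝ × ℝ) × (ℝ × ℝ) => φ.act y.1 (cotangentSlice ζ₀ e f y.2)) y := by
  have h2 : Tendsto (Prod.snd : (ℝ × ℝ) × (ℝ × ℝ) → ℝ × ℝ) (𝓝 0) (𝓝 0) :=
    continuous_snd.tendsto 0
  filter_upwards [h2.eventually (eventually_contMDiffAt_cotangentSlice ζ₀ e f),
    h2.eventually (eventually_cotangentSlice_mem hζ₀ e f)] with y h3 h4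
  have h5 : ContMDiffAt 𝓘(ℝ, (ℝ × ℝ) × (ℝ × ℝ)) cotangentModel ∞
      (cotangentSlice ζ₀ e f ∘ Prod.snd) y :=
    ContMDiffAt.comp y h3 contDiff_snd.contMDiff.contMDiffAt
  have h6 : ContMDiffAt 𝓘(ℝ, (ℝ × ℝ) × (ℝ × ℝ)) 𝓘(ℝ, ℝ × ℝ) ∞
      (Prod.fst : (ℝ × ℝ) × (ℝ × ℝ) → ℝ × ℝ) y := contDiff_fst.contMDiff.contMDiffAt
  exact ContMDiffAt.comp y (g := fun q : (ℝ × ℝ) × Cotangent M => φ.act q.1 q.2)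
    (φ.contMDiffAt_act hp y.1 h4) (h6.prodMk h5)

theorem hasFDerivAt_act_slice_apply {ζ₀ : Cotangent M}
    (hζ₀ : ζ₀ ∈ puncturedCotangent M) {e f : Plane × DualPlane}
    {A : (ℝ × ℝ) × (ℝ × ℝ) →L[ℝ] Plane × DualPlane}
    (hA : HasFDerivAt (fun y : (ℝ × ℝ) × (ℝ × ℝ) =>
      extChartAt cotangentModel ζ₀ (φ.act y.1 (cotangentSlice ζ₀ e f y.2))) A 0)
    (y : (ℝ × ℝ) × (ℝ × ℝ)) :
    A y = y.1.1 • rescaledVector g p ζ₀ + y.1.2 • radialField ζ₀ + (y.2.1 • f + y.2.2 • e) := by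
  have hself : ζ₀.1 ∈ (chartAt Plane ζ₀.1).source := mem_chart_source _ _
  have hS0 : cotangentSlice ζ₀ e f 0 = ζ₀ := cotangentSlice_zero ζ₀ e f
  have hB1 : A ((1, 0), 0) = rescaledVector g p ζ₀ := by
    have h1 : HasDerivAt (fun t : ℝ => (((t, 0), 0) : (ℝ × ℝ) × (ℝ × ℝ))) ((1, 0), 0) 0 :=
      ((hasDerivAt_id (0 : ℝ)).prodMk (hasDerivAt_const (0 : ℝ) (0 : ℝ))).prodMk
        (hasDerivAt_const (0 : ℝ) (0 : ℝ × ℝ))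
    have h2 := HasFDerivAt.comp_hasDerivAt (l := fun y : (ℝ × ℝ) × (ℝ × ℝ) =>
      extChartAt cotangentModel ζ₀ (φ.act y.1 (cotangentSlice ζ₀ e f y.2))) (0 : ℝ) hA h1
    have h3 : HasMFDerivAt cotangentModel 𝓘(ℝ, Plane × DualPlane) (extChartAt cotangentModel ζ₀)
        (φ.toFun 0 ζ₀) (chartDeriv ζ₀ ζ₀) := by
      rw [φ.zero ζ₀ hζ₀]
      exact hasMFDerivAt_cotangentChart hself
    have h4 : HasFDerivAt (fun t : ℝ => extChartAt cotangentModel ζ₀ (φ.toFun t ζ₀))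
        ((chartDeriv ζ₀ ζ₀).comp
          ((1 : ℝ →L[ℝ] ℝ).smulRight (rescaledVector g p (φ.toFun 0 ζ₀)))) 0 :=
      (h3.comp (0 : ℝ) (φ.hasMFDerivAt_time hζ₀ 0)).hasFDerivAt
    have h5 : ((fun y : (ℝ × ℝ) × (ℝ × ℝ) => extChartAt cotangentModel ζ₀
        (φ.act y.1 (cotangentSlice ζ₀ e f y.2))) ∘ fun t : ℝ => ((t, 0), 0)) =
        fun t : ℝ => extChartAt cotangentModel ζ₀ (φ.toFun t ζ₀) := by
      funext t
      change extChartAt cotangentModel ζ₀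
        (dilate (Real.exp 0) (φ.toFun t (cotangentSlice ζ₀ e f 0))) = _
      rw [Real.exp_zero, dilate_one, hS0]
    rw [h5] at h2
    rw [h2.unique h4.hasDerivAt, φ.zero ζ₀ hζ₀, chartDeriv_self]
    simp
  have hB2 : A ((0, 1), 0) = radialField ζ₀ := by
    have h1 : HasDerivAt (fun t : ℝ => (((0, t), 0) : (ℝ × ℝ) × (ℝ × ℝ))) ((0, 1), 0) 0 :=
      ((hasDerivAt_const (0 : ℝ) (0 : ℝ)).prodMk (hasDerivAt_id (0 : ℝ))).prodMk
        (hasDerivAt_const (0 : ℝ) (0 : ℝ × ℝ))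
    have h2 := HasFDerivAt.comp_hasDerivAt (l := fun y : (ℝ × ℝ) × (ℝ × ℝ) =>
      extChartAt cotangentModel ζ₀ (φ.act y.1 (cotangentSlice ζ₀ e f y.2))) (0 : ℝ) hA h1
    have h3 := HasDerivAt.scomp (0 : ℝ) (h := Real.exp)
      (hasDerivAt_cotangentChart_dilate ζ₀ ζ₀ (Real.exp 0)) (Real.hasDerivAt_exp 0)
    rw [Real.exp_zero, one_smul, cotangentChart_snd_self] at h3
    have h5 : ((fun y : (ℝ × ℝ) × (ℝ × ℝ) => extChartAt cotangentModel ζ₀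
        (φ.act y.1 (cotangentSlice ζ₀ e f y.2))) ∘ fun t : ℝ => ((0, t), 0)) =
        (fun t : ℝ => extChartAt cotangentModel ζ₀ (dilate t ζ₀)) ∘ Real.exp := by
      funext t
      change extChartAt cotangentModel ζ₀
        (dilate (Real.exp t) (φ.toFun 0 (cotangentSlice ζ₀ e f 0))) =
          extChartAt cotangentModel ζ₀ (dilate (Real.exp t) ζ₀)
      rw [hS0, φ.zero ζ₀ hζ₀]
    rw [h5] at h2
    exact h2.unique h3
  have hB3 : ∀ x : ℝ × ℝ, A (0, x) = x.1 • f + x.2 • e := by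
    intro x
    have h1 : HasFDerivAt ((fun y : (ℝ × ℝ) × (ℝ × ℝ) => extChartAt cotangentModel ζ₀
        (φ.act y.1 (cotangentSlice ζ₀ e f y.2))) ∘ fun x : ℝ × ℝ => ((0 : ℝ × ℝ), x))
        (A.comp (ContinuousLinearMap.inr ℝ (ℝ × ℝ) (ℝ × ℝ))) 0 :=
      HasFDerivAt.comp (g := fun y : (ℝ × ℝ) × (ℝ × ℝ) => extChartAt cotangentModel ζ₀
        (φ.act y.1 (cotangentSlice ζ₀ e f y.2))) (0 : ℝ × ℝ) hA (hasFDerivAt_prodMk_right _ _)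
    have h2 := hasFDerivAt_cotangentSlice ζ₀ e f
    have h3 : ((fun y : (ℝ × ℝ) × (ℝ × ℝ) => extChartAt cotangentModel ζ₀
        (φ.act y.1 (cotangentSlice ζ₀ e f y.2))) ∘ fun x : ℝ × ℝ => ((0 : ℝ × ℝ), x)) =ᶠ[𝓝 0]
        fun x => extChartAt cotangentModel ζ₀ (cotangentSlice ζ₀ e f x) := by
      filter_upwards [eventually_cotangentSlice_mem hζ₀ e f] with x hx
      change extChartAt cotangentModel ζ₀ (φ.act 0 (cotangentSlice ζ₀ e f x)) = _
      rw [φ.act_zero hx]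
    have h4 := h1.unique (h2.congr_of_eventuallyEq h3)
    exact congrArg (fun A : ℝ × ℝ →L[ℝ] Plane × DualPlane => A x) h4
  have h1 : y = y.1.1 • (((1, 0), 0) : (ℝ × ℝ) × (ℝ × ℝ)) +
      y.1.2 • (((0, 1), 0) : (ℝ × ℝ) × (ℝ × ℝ)) + (0, y.2) := by
    ext <;> simp
  conv_lhs => rw [h1, map_add, map_add, map_smul, map_smul, hB1, hB2, hB3]

/-- A smooth map to `T*M` whose derivative at `0` is bijective has a smooth local inverse. -/
theorem _root_.exists_smooth_local_inverse {E : Type*} [NormedAddCommGroup E] [NormedSpace ℝ E]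
    [CompleteSpace E] {Q : E → Cotangent M} {ζ₀ : Cotangent M}
    (hQ : ∀ᶠ y in 𝓝 0, ContMDiffAt 𝓘(ℝ, E) cotangentModel ∞ Q y) (hQ0 : Q 0 = ζ₀)
    {L : E ≃L[ℝ] Plane × DualPlane} (hL : HasFDerivAt (fun y => extChartAt cotangentModel ζ₀ (Q y))
      (L : E →L[ℝ] Plane × DualPlane) 0) :
    ∃ X : Cotangent M → E, X ζ₀ = 0 ∧
      (∀ᶠ ζ in 𝓝 ζ₀, ContMDiffAt cotangentModel 𝓘(ℝ, E) ∞ X ζ) ∧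
      (∀ᶠ ζ in 𝓝 ζ₀, Q (X ζ) = ζ) ∧ (∀ᶠ y in 𝓝 0, X (Q y) = y) ∧
      HasMFDerivAt cotangentModel 𝓘(ℝ, E) X ζ₀ (L.symm : Plane × DualPlane →L[ℝ] E) := by
  obtain ⟨c, hc⟩ : ∃ c, c = extChartAt cotangentModel ζ₀ := ⟨_, rfl⟩
  obtain ⟨Ψ, hΨ⟩ : ∃ Ψ : E → Plane × DualPlane, Ψ = fun y => c (Q y) := ⟨_, rfl⟩
  have hchart : ∀ ζ ∈ c.source, ContMDiffAt cotangentModel 𝓘(ℝ, Plane × DualPlane) ∞ c ζ := by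
    intro ζ h
    rw [hc] at h ⊢
    have h1 := mem_cotangentChart_source.1 h
    have h2 := mem_cotangent_chartAt_source.2 h1
    exact contMDiffAt_extChartAt' h2
  have hsrc : c.source ∈ 𝓝 ζ₀ := by
    rw [hc]
    exact extChartAt_source_mem_nhds (I := cotangentModel) ζ₀
  have hQc : ∀ᶠ y in 𝓝 0, Q y ∈ c.source :=
    hQ.self_of_nhds.continuousAt.eventually_mem (by rwa [hQ0])
  have hΨsm : ∀ᶠ y in 𝓝 0, ContDiffAt ℝ ∞ Ψ y := by
    filter_upwards [hQ, hQc] with y h1 h2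
    rw [hΨ]
    exact (ContMDiffAt.comp y (hchart _ h2) h1).contDiffAt
  have hΨ0 : Ψ 0 = c ζ₀ := by rw [hΨ]; exact congrArg c hQ0
  have hΨd : HasFDerivAt Ψ (L : E →L[ℝ] Plane × DualPlane) 0 := by
    rw [hΨ, hc]
    exact hL
  have hstrict : HasStrictFDerivAt Ψ (L : E →L[ℝ] Plane × DualPlane) 0 := by
    rw [← hΨd.fderiv]
    exact hΨsm.self_of_nhds.hasStrictFDerivAt (by simp)
  obtain ⟨H, hHcoe, h0H⟩ : ∃ H : OpenPartialHomeomorph E (Plane × DualPlane),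
      (H : E → Plane × DualPlane) = Ψ ∧ 0 ∈ H.source :=
    ⟨hstrict.toOpenPartialHomeomorph Ψ, hstrict.toOpenPartialHomeomorph_coe,
      hstrict.mem_toOpenPartialHomeomorph_source⟩
  have hsymm0 : H.symm (c ζ₀) = 0 := by
    rw [← hΨ0, ← hHcoe]
    exact H.left_inv h0H
  have hct : c ζ₀ ∈ H.target := by
    rw [← hΨ0, ← hHcoe]
    exact H.map_source h0H
  have hcc : ContinuousAt c ζ₀ := by
    rw [hc]
    exact continuousAt_extChartAt (I := cotangentModel) ζ₀
  have htgt : ∀ᶠ ζ in 𝓝 ζ₀, c ζ ∈ H.target := hcc.eventually_mem (H.open_target.mem_nhds hct)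
  have hXtend : Tendsto (fun ζ => H.symm (c ζ)) (𝓝 ζ₀) (𝓝 0) := by
    have h1 : ContinuousAt (fun ζ => H.symm (c ζ)) ζ₀ :=
      ContinuousAt.comp (f := c) (H.continuousAt_symm hct) hcc
    rwa [ContinuousAt, hsymm0] at h1
  have hXsm : ∀ᶠ ζ in 𝓝 ζ₀, ContMDiffAt cotangentModel 𝓘(ℝ, E) ∞ (fun ζ => H.symm (c ζ)) ζ := by
    have hinv : ∀ᶠ y in 𝓝 (0 : E), fderiv ℝ Ψ y ∈
        range ((↑) : (E ≃L[ℝ] Plane × DualPlane) → E →L[ℝ] Plane × DualPlane) := by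
      have h1 : ContinuousAt (fderiv ℝ Ψ) 0 :=
        (hΨsm.self_of_nhds.fderiv_right (m := 0) (by simp)).continuousAt
      refine h1.eventually_mem ?_
      rw [hΨd.fderiv]
      exact L.nhds
    filter_upwards [htgt, hXtend.eventually hinv, hXtend.eventually hΨsm, hsrc] with ζ h1 h2 h3 h4
    obtain ⟨L', hL'⟩ := h2
    have h5 : ContDiffAt ℝ ∞ H.symm (c ζ) := by
      refine H.contDiffAt_symm (f₀' := L') h1 ?_ ?_
      · rw [hHcoe, hL']
        exact (h3.differentiableAt (by simp)).hasFDerivAt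
      · rwa [hHcoe]
    exact ContMDiffAt.comp ζ h5.contMDiffAt (hchart ζ h4)
  refine ⟨fun ζ => H.symm (c ζ), hsymm0, hXsm, ?_, ?_, ?_⟩
  · filter_upwards [htgt, hXtend.eventually hQc, hsrc] with ζ h1 h2 h3
    have h4 : Ψ (H.symm (c ζ)) = c ζ := by
      rw [← hHcoe]
      exact H.right_inv h1
    rw [hΨ] at h4
    exact c.injOn h2 h3 h4
  · filter_upwards [H.open_source.mem_nhds h0H] with y hy
    have h1 : H.symm (Ψ y) = y := by
      rw [← hHcoe]
      exact H.left_inv hy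
    rwa [hΨ] at h1
  · have h1 : HasFDerivAt H.symm (L.symm : Plane × DualPlane →L[ℝ] E) (c ζ₀) := by
      refine H.hasFDerivAt_symm hct ?_
      rwa [hsymm0, hHcoe]
    have h2 : HasMFDerivAt cotangentModel 𝓘(ℝ, Plane × DualPlane) c ζ₀
        (ContinuousLinearMap.id ℝ (Plane × DualPlane)) := by
      have h3 := hasMFDerivAt_cotangentChart (ζ₀ := ζ₀) (mem_chart_source Plane ζ₀.1)
      rw [chartDeriv_self, ← hc] at h3
      exact h3
    exact HasMFDerivAt.comp ζ₀ h1.hasMFDerivAt h2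

/-- `X` consists of coordinates `(k, x) ∈ ℝ² × ℝ²` near `ζ₀`, in which `(k, x)` is the point
`act k (cotangentSlice ζ₀ e f x)`. -/
structure IsSliceCoordinates (ζ₀ : Cotangent M) (e f : Plane × DualPlane)
    (X : Cotangent M → (ℝ × ℝ) × (ℝ × ℝ)) : Prop where
  apply_self : X ζ₀ = 0
  smooth : ∀ᶠ ζ in 𝓝 ζ₀, ContMDiffAt cotangentModel 𝓘(ℝ, (ℝ × ℝ) × (ℝ × ℝ)) ∞ X ζ
  act_apply : ∀ᶠ ζ in 𝓝 ζ₀, φ.act (X ζ).1 (cotangentSlice ζ₀ e f (X ζ).2) = ζ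
  apply_act : ∀ᶠ y in 𝓝 (0 : (ℝ × ℝ) × (ℝ × ℝ)), X (φ.act y.1 (cotangentSlice ζ₀ e f y.2)) = y
  deriv : ∃ X' : Plane × DualPlane →L[ℝ] (ℝ × ℝ) × (ℝ × ℝ),
    HasMFDerivAt cotangentModel 𝓘(ℝ, (ℝ × ℝ) × (ℝ × ℝ)) X ζ₀ X' ∧
      ∀ v, (X' v).2 = (cotangentDiff p ζ₀ v, ζ₀.2 v.1)

/-- Off the fixed points at infinity, the orbits of the action of `ℝ²` are surfaces, transversal to
the slices. The second half of the coordinates that an orbit and a slice define together has the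
derivative `(dp, α)`, with the Liouville form `α`. -/
theorem exists_isSliceCoordinates (hp : IsSymbolOrderZero p) {ζ₀ : Cotangent M}
    (hζ₀ : ζ₀ ∈ puncturedCotangent M) (hfix : ¬ IsFixedAtInfinity p ζ₀)
    {e f : Plane × DualPlane} (he : cotangentDiff p ζ₀ e = 0) (heα : ζ₀.2 e.1 = 1)
    (hf : cotangentDiff p ζ₀ f = 1) (hfα : ζ₀.2 f.1 = 0) :
    ∃ X, φ.IsSliceCoordinates ζ₀ e f X := by
  obtain ⟨Q, hQ⟩ : ∃ Q : (ℝ × ℝ) × (ℝ × ℝ) → Cotangent M,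
    Q = fun y => φ.act y.1 (cotangentSlice ζ₀ e f y.2) := ⟨_, rfl⟩
  have hQsm := φ.eventually_contMDiffAt_act_slice hp hζ₀ e f
  rw [← hQ] at hQsm
  have hQ0 : Q 0 = ζ₀ := by
    rw [hQ]
    change φ.act 0 (cotangentSlice ζ₀ e f 0) = ζ₀
    rw [cotangentSlice_zero, φ.act_zero hζ₀]
  obtain ⟨A, hA⟩ : ∃ A : (ℝ × ℝ) × (ℝ × ℝ) →L[ℝ] Plane × DualPlane,
      HasFDerivAt (fun y => extChartAt cotangentModel ζ₀ (Q y)) A 0 := by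
    have h1 : ContMDiffAt cotangentModel 𝓘(ℝ, Plane × DualPlane) ∞
        (extChartAt cotangentModel ζ₀) (Q 0) := by
      rw [hQ0]
      exact contMDiffAt_extChartAt
    have h2 := (ContMDiffAt.comp (0 : (ℝ × ℝ) × (ℝ × ℝ)) h1 hQsm.self_of_nhds).contDiffAt
    exact ⟨_, (h2.differentiableAt (by simp)).hasFDerivAt⟩
  have hB : ∀ y, A y =
      y.1.1 • rescaledVector g p ζ₀ + y.1.2 • radialField ζ₀ + (y.2.1 • f + y.2.2 • e) := by
    rw [hQ] at hA
    exact φ.hasFDerivAt_act_slice_apply hζ₀ hA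
  have hBp : ∀ y, cotangentDiff p ζ₀ (A y) = y.2.1 := by
    intro y
    rw [hB, map_add, map_add, map_add, map_smul, map_smul, map_smul, map_smul, he, hf,
      hp.cotangentDiff_radialField hζ₀, rescaledVector, map_smul,
      cotangentDiff_hamiltonianField_self]
    simp
  have hBα : ∀ y, liouvilleForm ζ₀.2 (A y) = y.2.2 := by
    intro y
    have h1 : liouvilleForm ζ₀.2 (rescaledVector g p ζ₀) = 0 := hp.liouville_rescaledVector hζ₀
    have h2 : liouvilleForm ζ₀.2 (radialField ζ₀) = 0 := map_zero ζ₀.2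
    have h3 : liouvilleForm ζ₀.2 f = 0 := hfα
    have h4 : liouvilleForm ζ₀.2 e = 1 := heα
    rw [hB, map_add, map_add, map_add, map_smul, map_smul, map_smul, map_smul, h1, h2, h3, h4]
    simp
  have hinj : Function.Injective A.toLinearMap := by
    rw [injective_iff_map_eq_zero]
    intro y hy
    have hy' : A y = 0 := hy
    have h1 := hBp y
    have h2 := hBα y
    rw [hy', map_zero] at h1 h2
    rw [hB, ← h1, ← h2, zero_smul, zero_smul, add_zero, add_zero] at hy'
    have h3 : y.1.1 = 0 := by
      by_contra hne
      have hn := covectorNorm_pos g hζ₀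
      refine hfix ⟨-((y.1.1 * covectorNorm g ζ₀)⁻¹ * y.1.2), ?_⟩
      rw [rescaledVector, smul_smul, add_eq_zero_iff_eq_neg] at hy'
      have h4 : (y.1.1 * covectorNorm g ζ₀)⁻¹ • ((y.1.1 * covectorNorm g ζ₀) •
          hamiltonianField p ζ₀) = hamiltonianField p ζ₀ := by
        rw [smul_smul, inv_mul_cancel₀ (mul_ne_zero hne hn.ne'), one_smul]
      rw [← h4, hy', neg_smul_plane_prod_dual, mul_smul]
      exact Prod.ext (smul_neg _ _) (smul_neg _ _)
    rw [h3, zero_smul, zero_add] at hy'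
    have h4 := (smul_eq_zero.1 hy').resolve_right (radialField_ne_zero hζ₀)
    exact Prod.ext (Prod.ext h3 h4) (Prod.ext h1.symm h2.symm)
  have hdim : Module.finrank ℝ ((ℝ × ℝ) × (ℝ × ℝ)) = Module.finrank ℝ (Plane × DualPlane) := by
    rw [finrank_plane_prod_dual]
    simp
  obtain ⟨L, hL⟩ : ∃ L : ((ℝ × ℝ) × (ℝ × ℝ)) ≃L[ℝ] Plane × DualPlane,
      (L : (ℝ × ℝ) × (ℝ × ℝ) →L[ℝ] Plane × DualPlane) = A :=
    ⟨(LinearEquiv.ofInjectiveOfFinrankEq _ hinj hdim).toContinuousLinearEquiv,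
      ContinuousLinearMap.ext fun y => rfl⟩
  obtain ⟨X, hX0, hXsm, hQX, hXQ, hX'⟩ := exists_smooth_local_inverse hQsm hQ0 (hL ▸ hA)
  rw [hQ] at hQX hXQ
  refine ⟨X, hX0, hXsm, hQX, hXQ, L.symm, hX', fun v => ?_⟩
  have h0 : A (L.symm v) = v := by
    rw [← hL]
    exact L.apply_symm_apply v
  have h1 := hBp (L.symm v)
  have h2 := hBα (L.symm v)
  rw [h0] at h1 h2
  exact Prod.ext h1.symm h2.symm

end RescaledFlow

end SliceCoordinates

/-! ### Stabilizers and closed orbits -/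

section ReturningOrbits

variable {M : Type*} [TopologicalSpace M] [ChartedSpace Plane M] [IsManifold 𝓘(ℝ, Plane) ∞ M]
  {g : ContMDiffRiemannianMetric 𝓘(ℝ, Plane) ∞ Plane (fun x : M => TangentSpace 𝓘(ℝ, Plane) x)}
  {p : Cotangent M → ℝ}

/-- Being a fixed point at infinity is a closed condition, as the dependence of the vector fields
`H_p` and `ξ∂_ξ` is. -/
theorem eventually_not_isFixedAtInfinity (hp : IsSymbolOrderZero p) {ζ₀ : Cotangent M}
    (hζ₀ : ζ₀ ∈ puncturedCotangent M) (hfix : ¬ IsFixedAtInfinity p ζ₀) :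
    ∀ᶠ ζ in 𝓝 ζ₀, ¬ IsFixedAtInfinity p ζ := by
  obtain ⟨c, hc⟩ : ∃ c, c = extChartAt cotangentModel ζ₀ := ⟨_, rfl⟩
  have hself : ζ₀.1 ∈ (chartAt Plane ζ₀.1).source := mem_chart_source _ _
  have hcc : ContinuousAt c ζ₀ := by
    rw [hc]
    exact continuousAt_extChartAt (I := cotangentModel) ζ₀
  obtain ⟨u, hu⟩ : ∃ u : Plane × DualPlane → Plane × DualPlane,
    u = fun y => hamiltonianVector (fderiv ℝ (p ∘ c.symm) y) := ⟨_, rfl⟩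
  have huc : ContinuousAt u (c ζ₀) := by
    have h1 : ContDiffAt ℝ ∞ (p ∘ c.symm) (c ζ₀) := by
      rw [hc]
      exact (hp.contMDiffAt hζ₀).comp_extChartAt_symm (mem_chart_source _ ζ₀)
    have h2 : ContinuousAt (fderiv ℝ (p ∘ c.symm)) (c ζ₀) :=
      (h1.fderiv_right (m := 0) (by simp)).continuousAt
    rw [hu]
    exact ContinuousAt.comp (g := hamiltonianVector) (f := fderiv ℝ (p ∘ c.symm))
      hamiltonianVector.continuous.continuousAt h2
  have huζ : ∀ ζ ∈ puncturedCotangent M, ζ.1 ∈ (chartAt Plane ζ₀.1).source →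
      chartDeriv ζ₀ ζ (hamiltonianField p ζ) = u (c ζ) := by
    intro ζ hζ hs
    rw [hu, hc]
    exact chartDeriv_hamiltonianField (hp.contMDiffAt hζ) hs
  have hr : ∀ ζ : Cotangent M, ζ.1 ∈ (chartAt Plane ζ₀.1).source →
      chartDeriv ζ₀ ζ (radialField ζ) = (0, (c ζ).2) := by
    intro ζ hs
    have h1 : HasMFDerivAt cotangentModel 𝓘(ℝ, Plane × DualPlane)
        (extChartAt cotangentModel ζ₀) (dilate 1 ζ) (chartDeriv ζ₀ ζ) := by
      rw [dilate_one]
      exact hasMFDerivAt_cotangentChart hs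
    have h2 : HasFDerivAt (fun t : ℝ => extChartAt cotangentModel ζ₀ (dilate t ζ))
        ((chartDeriv ζ₀ ζ).comp ((1 : ℝ →L[ℝ] ℝ).smulRight (radialField ζ))) 1 :=
      (h1.comp (1 : ℝ) (hasMFDerivAt_dilate_curve ζ 1)).hasFDerivAt
    have h3 := h2.hasDerivAt.unique (hasDerivAt_cotangentChart_dilate ζ₀ ζ 1)
    rw [hc]
    have h4 : chartDeriv ζ₀ ζ ((1 : ℝ) • radialField ζ) = _ := h3
    rwa [one_smul] at h4
  have hopen : ∀ᶠ ζ in 𝓝 ζ₀,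
      LinearIndependent ℝ ![((0, (c ζ).2) : Plane × DualPlane), u (c ζ)] := by
    have h1 : ContinuousAt (fun ζ => ![((0, (c ζ).2) : Plane × DualPlane), u (c ζ)]) ζ₀ := by
      have h2 : ContinuousAt (fun ζ => ((0, (c ζ).2) : Plane × DualPlane)) ζ₀ :=
        continuousAt_const.prodMk hcc.snd
      have h3 : ContinuousAt (fun ζ => u (c ζ)) ζ₀ := ContinuousAt.comp (f := c) huc hcc
      exact h2.finCons (h3.finCons continuousAt_const)
    refine h1.eventually_mem (isOpen_setOfPred_linearIndependent.mem_nhds ?_)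
    change LinearIndependent ℝ ![((0, (c ζ₀).2) : Plane × DualPlane), u (c ζ₀)]
    rw [← hr ζ₀ hself, ← huζ ζ₀ hζ₀ hself, chartDeriv_self]
    refine (LinearIndependent.pair_iff' (radialField_ne_zero hζ₀)).2 ?_
    exact fun a ha => hfix ⟨a, ha.symm⟩
  have hsrc : (extChartAt cotangentModel ζ₀).source ∈ 𝓝 ζ₀ :=
    extChartAt_source_mem_nhds (I := cotangentModel) ζ₀
  filter_upwards [hopen, isOpen_puncturedCotangent.mem_nhds hζ₀, hsrc] with ζ h1 hζ h2
  rintro ⟨a, ha⟩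
  have hs := mem_cotangentChart_source.1 h2
  have h3 : ((0, (c ζ).2) : Plane × DualPlane) ≠ 0 := h1.ne_zero 0
  refine (LinearIndependent.pair_iff' h3).1 h1 a ?_
  rw [← hr ζ hs, ← huζ ζ hζ hs, ha, map_smul]

namespace RescaledFlow

variable (φ : RescaledFlow g p)

/-- A point is returning if it has a suitable stabilizer. -/
theorem isReturning_iff {ε : ℝ} {ζ : Cotangent M} :
    φ.IsReturning ε ζ ↔ ∃ k : ℝ × ℝ, 0 < ε * k.1 ∧ k.2 < 0 ∧ φ.act k ζ = ζ := by
  constructor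
  · rintro ⟨T, s, hT, hs, hTs⟩
    refine ⟨(T, -Real.log s), hT, neg_neg_of_pos (Real.log_pos hs), ?_⟩
    rw [act, hTs, dilate_dilate, Real.exp_neg, Real.exp_log (by linarith),
      inv_mul_cancel₀ (by linarith), dilate_one]
  · rintro ⟨k, hk1, hk2, h⟩
    refine ⟨k.1, Real.exp (-k.2), hk1, Real.one_lt_exp_iff.2 (by linarith), ?_⟩
    conv_rhs => rw [← h, act, dilate_dilate, ← Real.exp_add, neg_add_cancel, Real.exp_zero,
      dilate_one]

variable [T2Space M]

theorem act_neg_act (hp : IsSymbolOrderZero p) (k : ℝ × ℝ) {ζ : Cotangent M}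
    (hζ : ζ ∈ puncturedCotangent M) : φ.act (-k) (φ.act k ζ) = ζ := by
  rw [← φ.act_add hp _ _ hζ, neg_add_cancel, φ.act_zero hζ]

theorem act_comm (hp : IsSymbolOrderZero p) (k k' : ℝ × ℝ) {ζ : Cotangent M}
    (hζ : ζ ∈ puncturedCotangent M) : φ.act k (φ.act k' ζ) = φ.act k' (φ.act k ζ) := by
  rw [← φ.act_add hp _ _ hζ, ← φ.act_add hp _ _ hζ, add_comm]

theorem act_sub_eq_iff (hp : IsSymbolOrderZero p) (k k' : ℝ × ℝ) {ζ ζ' : Cotangent M}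
    (hζ : ζ ∈ puncturedCotangent M) (hζ' : ζ' ∈ puncturedCotangent M) :
    φ.act (k - k') ζ = ζ' ↔ φ.act k ζ = φ.act k' ζ' := by
  constructor
  · rintro rfl
    rw [← φ.act_add hp _ _ hζ, add_sub_cancel]
  · intro h
    rw [sub_eq_neg_add, φ.act_add hp _ _ hζ, h, φ.act_neg_act hp _ hζ']

theorem isReturning_act_iff (hp : IsSymbolOrderZero p) {ε : ℝ} {ζ : Cotangent M}
    (hζ : ζ ∈ puncturedCotangent M) (k : ℝ × ℝ) :
    φ.IsReturning ε (φ.act k ζ) ↔ φ.IsReturning ε ζ := by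
  have key : ∀ ζ ∈ puncturedCotangent M, ∀ k, φ.IsReturning ε ζ → φ.IsReturning ε (φ.act k ζ) :=
    fun ζ hζ k h => (h.apply hp hζ k.1).dilate hp (φ.mem _ ζ hζ) (Real.exp_pos _)
  refine ⟨fun h => ?_, key ζ hζ k⟩
  have h1 := key _ (φ.act_mem k hζ) (-k) h
  rwa [φ.act_neg_act hp k hζ] at h1

theorem act_int_smul (hp : IsSymbolOrderZero p) {k : ℝ × ℝ} {ζ : Cotangent M}
    (hζ : ζ ∈ puncturedCotangent M) (h : φ.act k ζ = ζ) (n : ℤ) : φ.act ((n : ℝ) • k) ζ = ζ := by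
  induction n with
  | zero => rw [Int.cast_zero, zero_smul, φ.act_zero hζ]
  | succ n ih => rw [Int.cast_add, Int.cast_one, add_smul, one_smul, φ.act_add hp _ _ hζ, h, ih]
  | pred n ih =>
    rw [Int.cast_sub, Int.cast_one, sub_smul, one_smul, sub_eq_add_neg, φ.act_add hp _ _ hζ]
    conv_lhs => rw [← h, φ.act_neg_act hp _ hζ, ih]

/-- The orbit of a point which has a stabilizer with a nonzero time is closed in `T*M ∖ 0`. -/
theorem exists_act_eq_of_tendsto (hp : IsSymbolOrderZero p) {k₀ : ℝ × ℝ} {ζ z : Cotangent M}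
    (hζ : ζ ∈ puncturedCotangent M) (hz : z ∈ puncturedCotangent M) (hk₀ : k₀.1 ≠ 0)
    (h : φ.act k₀ ζ = ζ) {y : ℕ → Cotangent M} (hy : ∀ n, ∃ k, y n = φ.act k ζ)
    (hlim : Tendsto y atTop (𝓝 z)) : ∃ k, z = φ.act k ζ := by
  -- modulo the stabilizer, the times are in a compact interval
  have h1 : ∀ n, ∃ k : ℝ × ℝ, k.1 ∈ Icc (-|k₀.1|) |k₀.1| ∧ y n = φ.act k ζ := by
    intro n
    obtain ⟨k, hk⟩ := hy n
    refine ⟨k - (⌊k.1 / k₀.1⌋ : ℝ) • k₀, ?_, ?_⟩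
    · have h2 : (k - (⌊k.1 / k₀.1⌋ : ℝ) • k₀).1 = Int.fract (k.1 / k₀.1) * k₀.1 := by
        rw [Prod.fst_sub, Prod.smul_fst, smul_eq_mul, Int.fract, sub_mul, div_mul_cancel₀ _ hk₀]
      rw [h2, mem_Icc, ← abs_le, abs_mul, abs_of_nonneg (Int.fract_nonneg _)]
      exact mul_le_of_le_one_left (abs_nonneg _) (Int.fract_lt_one _).le
    · rw [hk, eq_comm, φ.act_sub_eq_iff hp _ _ hζ (φ.act_mem _ hζ), φ.act_comm hp _ _ hζ,
        φ.act_int_smul hp hζ h]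
  choose k hkI hky using h1
  obtain ⟨τ, -, ψ, hψ, hτ⟩ := isCompact_Icc.tendsto_subseq hkI
  -- the dilation factors are determined by the norms
  have hnorm : ∀ n, covectorNorm g (y n) =
      Real.exp (k n).2 * covectorNorm g (φ.toFun (k n).1 ζ) := by
    intro n
    rw [hky, act, covectorNorm_dilate g _ (Real.exp_pos _).le]
  have hpos := fun t => covectorNorm_pos g (φ.mem t ζ hζ)
  have hr : ∀ n, (k n).2 =
      Real.log (covectorNorm g (y n)) - Real.log (covectorNorm g (φ.toFun (k n).1 ζ)) := by
    intro n
    rw [hnorm, Real.log_mul (Real.exp_pos _).ne' (hpos _).ne', Real.log_exp, add_sub_cancel_right]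
  have hlim' : Tendsto (fun n => y (ψ n)) atTop (𝓝 z) := hlim.comp hψ.tendsto_atTop
  have h2 : Tendsto (fun n => (k (ψ n)).2) atTop
      (𝓝 (Real.log (covectorNorm g z) - Real.log (covectorNorm g (φ.toFun τ ζ)))) := by
    simp only [hr]
    refine Tendsto.sub ?_ ?_
    · exact (Real.continuousAt_log (covectorNorm_pos g hz).ne').tendsto.comp
        ((contMDiffAt_covectorNorm g hz).continuousAt.tendsto.comp hlim')
    · exact (Real.continuousAt_log (hpos τ).ne').tendsto.comp
        (((φ.continuous_covectorNorm hζ).tendsto τ).comp hτ)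
  refine ⟨(τ, Real.log (covectorNorm g z) - Real.log (covectorNorm g (φ.toFun τ ζ))), ?_⟩
  have h3 : Tendsto (fun n => (k (ψ n), ζ)) atTop (𝓝 ((τ, Real.log (covectorNorm g z) -
      Real.log (covectorNorm g (φ.toFun τ ζ))), ζ)) :=
    (Tendsto.prodMk_nhds hτ h2).prodMk_nhds tendsto_const_nhds
  have h4 := (φ.contMDiffAt_act hp (τ, Real.log (covectorNorm g z) -
    Real.log (covectorNorm g (φ.toFun τ ζ))) hζ).continuousAt.tendsto.comp h3
  refine tendsto_nhds_unique hlim' (h4.congr fun n => ?_)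
  exact (hky (ψ n)).symm

end RescaledFlow

end ReturningOrbits

/-! ### The return map -/

section ReturnMap

variable {M : Type*} [TopologicalSpace M] [ChartedSpace Plane M] [IsManifold 𝓘(ℝ, Plane) ∞ M]
  {g : ContMDiffRiemannianMetric 𝓘(ℝ, Plane) ∞ Plane (fun x : M => TangentSpace 𝓘(ℝ, Plane) x)}
  {p : Cotangent M → ℝ}

theorem eventually_cotangentDiff_ne_zero {G : Cotangent M → ℝ} {ζ₀ : Cotangent M}
    (hG : ∀ᶠ ζ in 𝓝 ζ₀, ContMDiffAt cotangentModel 𝓘(ℝ, ℝ) ∞ G ζ)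
    (hG0 : cotangentDiff G ζ₀ ≠ 0) : ∀ᶠ ζ in 𝓝 ζ₀, cotangentDiff G ζ ≠ 0 := by
  have hcc : ContinuousAt (extChartAt cotangentModel ζ₀) ζ₀ := continuousAt_extChartAt ζ₀
  have h1 : ContDiffAt ℝ ∞ (G ∘ (extChartAt cotangentModel ζ₀).symm)
      (extChartAt cotangentModel ζ₀ ζ₀) :=
    hG.self_of_nhds.comp_extChartAt_symm (mem_chart_source _ ζ₀)
  have h2 : ContinuousAt (fderiv ℝ (G ∘ (extChartAt cotangentModel ζ₀).symm))
      (extChartAt cotangentModel ζ₀ ζ₀) := (h1.fderiv_right (m := 0) (by simp)).continuousAt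
  have h3 : ContinuousAt (fun ζ => fderiv ℝ (G ∘ (extChartAt cotangentModel ζ₀).symm)
      (extChartAt cotangentModel ζ₀ ζ)) ζ₀ :=
    ContinuousAt.comp (f := extChartAt cotangentModel ζ₀) h2 hcc
  rw [cotangentDiff_eq_fderiv hG.self_of_nhds] at hG0
  filter_upwards [h3.eventually_ne hG0, hG, extChartAt_source_mem_nhds (I := cotangentModel) ζ₀]
    with ζ h4 h5 h6 h7
  have hs := mem_cotangentChart_source.1 h6
  rw [cotangentDiff_eq_chart h5 hs] at h7
  refine h4 (ContinuousLinearMap.ext fun w => ?_)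
  obtain ⟨v, rfl⟩ := (chartDeriv_bijective hs).2 w
  exact congrArg (fun B : Plane × DualPlane →L[ℝ] ℝ => B v) h7

namespace RescaledFlow

variable (φ : RescaledFlow g p) [T2Space M] {ζ₀ : Cotangent M} {e f : Plane × DualPlane}
  {X : Cotangent M → (ℝ × ℝ) × (ℝ × ℝ)}

/-- The coordinates of the image of a point of the slice through `ζ₀` under the action of `k₀`. If
`act k₀ ζ₀ = ζ₀`, the second half is a return map of the slice. -/
noncomputable def returnCoordinates (ζ₀ : Cotangent M) (e f : Plane × DualPlane)
    (X : Cotangent M → (ℝ × ℝ) × (ℝ × ℝ)) (k₀ x : ℝ × ℝ) : (ℝ × ℝ) × (ℝ × ℝ) :=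
  X (φ.act k₀ (cotangentSlice ζ₀ e f x))

variable {φ}

/-- Points of the slice near a fixed point `ζ₀` of `act k₀` are mapped into the domain of the
coordinates. -/
theorem IsSliceCoordinates.eventually_contDiffAt_returnCoordinates
    (hX : φ.IsSliceCoordinates ζ₀ e f X) (hp : IsSymbolOrderZero p)
    (hζ₀ : ζ₀ ∈ puncturedCotangent M) {k₀ : ℝ × ℝ} (hk₀ : φ.act k₀ ζ₀ = ζ₀) :
    (∀ᶠ x in 𝓝 0, ContDiffAt ℝ ∞ (φ.returnCoordinates ζ₀ e f X k₀) x) ∧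
    (∀ᶠ x in 𝓝 0, φ.act (φ.returnCoordinates ζ₀ e f X k₀ x).1
      (cotangentSlice ζ₀ e f (φ.returnCoordinates ζ₀ e f X k₀ x).2) =
        φ.act k₀ (cotangentSlice ζ₀ e f x)) := by
  have hN := eventually_cotangentSlice_mem hζ₀ e f
  have hact : ∀ ζ ∈ puncturedCotangent M,
      ContMDiffAt cotangentModel cotangentModel ∞ (φ.act k₀) ζ := fun ζ hζ =>
    ContMDiffAt.comp ζ (g := fun q : (ℝ × ℝ) × Cotangent M => φ.act q.1 q.2)
      (f := fun ζ => (k₀, ζ)) (φ.contMDiffAt_act hp k₀ hζ)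
      (contMDiffAt_const.prodMk contMDiffAt_id)
  have hsm : ∀ᶠ x in 𝓝 0, ContMDiffAt 𝓘(ℝ, ℝ × ℝ) cotangentModel ∞
      (fun x => φ.act k₀ (cotangentSlice ζ₀ e f x)) x := by
    filter_upwards [hN, eventually_contMDiffAt_cotangentSlice ζ₀ e f] with x h1 h2
    exact ContMDiffAt.comp x (g := φ.act k₀) (hact _ h1) h2
  have htend : Tendsto (fun x => φ.act k₀ (cotangentSlice ζ₀ e f x)) (𝓝 0) (𝓝 ζ₀) := by
    have h1 := hsm.self_of_nhds.continuousAt.tendsto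
    rwa [cotangentSlice_zero, hk₀] at h1
  constructor
  · filter_upwards [hsm, htend.eventually hX.smooth] with x h1 h2
    exact (ContMDiffAt.comp x h2 h1).contDiffAt
  · filter_upwards [htend.eventually hX.act_apply] with x h1
    exact h1

theorem IsSliceCoordinates.returnCoordinates_zero
    (hX : φ.IsSliceCoordinates ζ₀ e f X) {k₀ : ℝ × ℝ} (hk₀ : φ.act k₀ ζ₀ = ζ₀) :
    φ.returnCoordinates ζ₀ e f X k₀ 0 = 0 := by
  rw [returnCoordinates, cotangentSlice_zero, hk₀, hX.apply_self]

/-- The return map multiplies the vector `e` of the slice, at which `dp = 0`, by the dilation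
factor, since the flow preserves the Liouville form on `ker dp`. -/
theorem IsSliceCoordinates.fderiv_returnCoordinates
    (hX : φ.IsSliceCoordinates ζ₀ e f X) (hp : IsSymbolOrderZero p)
    (hζ₀ : ζ₀ ∈ puncturedCotangent M) {k₀ : ℝ × ℝ} (hk₀ : φ.act k₀ ζ₀ = ζ₀)
    (he : cotangentDiff p ζ₀ e = 0) (heα : ζ₀.2 e.1 = 1)
    {K' : ℝ × ℝ →L[ℝ] (ℝ × ℝ) × (ℝ × ℝ)}
    (hK : HasFDerivAt (φ.returnCoordinates ζ₀ e f X k₀) K' 0) :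
    (K' (0, 1)).2.2 = Real.exp k₀.2 := by
  obtain ⟨X', hX', hX2⟩ := hX.deriv
  have hS := hasMFDerivAt_cotangentSlice ζ₀ e f
  have hact : HasMFDerivAt cotangentModel cotangentModel (φ.act k₀) (cotangentSlice ζ₀ e f 0)
      (φ.actDeriv k₀ ζ₀) := by
    rw [cotangentSlice_zero]
    exact φ.hasMFDerivAt_act hp k₀ hζ₀
  have h1 := hact.comp (0 : ℝ × ℝ) hS
  have hX'' : HasMFDerivAt cotangentModel 𝓘(ℝ, (ℝ × ℝ) × (ℝ × ℝ)) X
      ((φ.act k₀ ∘ cotangentSlice ζ₀ e f) 0) X' := by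
    rw [Function.comp_apply, cotangentSlice_zero, hk₀]
    exact hX'
  have h2 : HasFDerivAt (φ.returnCoordinates ζ₀ e f X k₀) (X'.comp ((φ.actDeriv k₀ ζ₀).comp
      ((ContinuousLinearMap.fst ℝ ℝ ℝ).smulRight f +
        (ContinuousLinearMap.snd ℝ ℝ ℝ).smulRight e))) 0 :=
    (hX''.comp (0 : ℝ × ℝ) h1).hasFDerivAt
  have h3 := φ.liouville_actDeriv hp k₀ hζ₀ he
  rw [heα, mul_one, hk₀] at h3
  have h4 : ((0 : ℝ) • f + (1 : ℝ) • e : Plane × DualPlane) = e := by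
    rw [zero_smul, one_smul, zero_add]
  rw [hK.unique h2]
  change (X' (φ.actDeriv k₀ ζ₀ ((0 : ℝ) • f + (1 : ℝ) • e))).2.2 = _
  rw [hX2, h4]
  exact h3

/-- Near `ζ₀`, the returning points of the slice are the fixed points of the return map, and these
are given by one equation. -/
theorem IsSliceCoordinates.eventually_isReturning_iff
    (hX : φ.IsSliceCoordinates ζ₀ e f X) (hp : IsSymbolOrderZero p)
    (hζ₀ : ζ₀ ∈ puncturedCotangent M) {ε : ℝ} {k₀ : ℝ × ℝ} (hk₀ : φ.act k₀ ζ₀ = ζ₀)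
    (hk1 : 0 < ε * k₀.1) (hk2 : k₀.2 < 0)
    (he : cotangentDiff p ζ₀ e = 0) (heα : ζ₀.2 e.1 = 1) (hf : cotangentDiff p ζ₀ f = 1) :
    ∀ᶠ x in 𝓝 0, (φ.IsReturning ε (cotangentSlice ζ₀ e f x) ↔
      (φ.returnCoordinates ζ₀ e f X k₀ x).2.2 = x.2) := by
  obtain ⟨hKsm, hKact⟩ := hX.eventually_contDiffAt_returnCoordinates hp hζ₀ hk₀
  have hK0 := hX.returnCoordinates_zero hk₀
  obtain ⟨K, hKdef⟩ : ∃ K, K = φ.returnCoordinates ζ₀ e f X k₀ := ⟨_, rfl⟩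
  obtain ⟨S, hSdef⟩ : ∃ S, S = cotangentSlice ζ₀ e f := ⟨_, rfl⟩
  have hN : ∀ᶠ x in 𝓝 0, S x ∈ puncturedCotangent M := by
    rw [hSdef]
    exact eventually_cotangentSlice_mem hζ₀ e f
  have hSsm : ∀ᶠ x in 𝓝 0, ContMDiffAt 𝓘(ℝ, ℝ × ℝ) cotangentModel ∞ S x := by
    rw [hSdef]
    exact eventually_contMDiffAt_cotangentSlice ζ₀ e f
  have hS0 : S 0 = ζ₀ := by rw [hSdef]; exact cotangentSlice_zero ζ₀ e f
  have hXact := hX.apply_act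
  have hKd : ∀ x, X (φ.act k₀ (S x)) = K x := by
    intro x
    rw [hKdef, hSdef]
    rfl
  have hKstrict := hKsm.self_of_nhds.hasStrictFDerivAt (by simp)
  have hl := hX.fderiv_returnCoordinates hp hζ₀ hk₀ he heα hKstrict.hasFDerivAt
  rw [← hKdef] at hKsm hKact hK0 hKstrict hl
  rw [← hSdef] at hKact hXact ⊢
  rw [← hKdef]
  have hKc : Tendsto K (𝓝 0) (𝓝 0) := by
    have h1 := hKsm.self_of_nhds.continuousAt.tendsto
    rwa [hK0] at h1
  have hKc1 : Tendsto (fun x => (K x).1) (𝓝 0) (𝓝 0) := (continuous_fst.tendsto _).comp hKc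
  have hKc2 : Tendsto (fun x => (K x).2) (𝓝 0) (𝓝 0) := (continuous_snd.tendsto _).comp hKc
  -- `p` in the slice
  have hqsm : ContMDiffAt 𝓘(ℝ, ℝ × ℝ) 𝓘(ℝ, ℝ) ∞ (p ∘ S) 0 := by
    refine ContMDiffAt.comp (0 : ℝ × ℝ) (g := p) ?_ hSsm.self_of_nhds
    rw [hS0]
    exact hp.contMDiffAt hζ₀
  have hq := hqsm.contDiffAt.hasStrictFDerivAt (by simp)
  have hq' : ∀ u, fderiv ℝ (p ∘ S) 0 u = u.1 := by
    have h1 := hasMFDerivAt_cotangentSlice ζ₀ e f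
    rw [← hSdef] at h1
    have h2 : HasMFDerivAt cotangentModel 𝓘(ℝ, ℝ) p (S 0) (cotangentDiff p ζ₀) := by
      rw [hS0]
      exact ((hp.contMDiffAt hζ₀).mdifferentiableAt (by simp)).hasMFDerivAt
    have h3 : HasFDerivAt (p ∘ S) ((cotangentDiff p ζ₀).comp
        ((ContinuousLinearMap.fst ℝ ℝ ℝ).smulRight f +
          (ContinuousLinearMap.snd ℝ ℝ ℝ).smulRight e)) 0 :=
      (h2.comp (0 : ℝ × ℝ) h1).hasFDerivAt
    intro u
    rw [h3.fderiv]
    change cotangentDiff p ζ₀ (u.1 • f + u.2 • e) = u.1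
    rw [map_add, map_smul, map_smul, he, hf]
    simp
  have hinv : ∀ᶠ x in 𝓝 0, (p ∘ S) ((K x).2) = (p ∘ S) x := by
    filter_upwards [hN, hKc2.eventually hN, hKact] with x h1 h2 h3
    rw [Function.comp_apply, Function.comp_apply, ← φ.symbol_act hp (K x).1 h2, h3,
      φ.symbol_act hp _ h1]
  have hR : HasStrictFDerivAt (fun x => (K x).2)
      ((ContinuousLinearMap.snd ℝ (ℝ × ℝ) (ℝ × ℝ)).comp (fderiv ℝ K 0)) 0 := hKstrict.snd
  obtain ⟨hfix, hconv⟩ := exists_fixedPoint_of_level_contraction hR (by rw [hK0]; rfl) hq hq'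
    (by
      change |(fderiv ℝ K 0 (0, 1)).2.2| < 1
      rw [hl, abs_of_pos (Real.exp_pos _)]
      exact Real.exp_lt_one_iff.2 hk2) hinv
  -- the coordinates of `act k (S x)` are `(k, x)` for `k ∈ A` and `x ∈ B`
  obtain ⟨A, hA, B, hB, hAB⟩ := mem_nhds_prod_iff.1 hXact
  have hW : ∀ᶠ z in 𝓝 0, S z ∈ puncturedCotangent M ∧ ContinuousAt S z ∧ (K z).1 ∈ A ∧
      φ.act (K z).1 (S (K z).2) = φ.act k₀ (S z) := by
    filter_upwards [hN, hSsm, hKc1.eventually_mem hA, hKact] with z h1 h2 h3 h4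
    exact ⟨h1, h2.continuousAt, h3, h4⟩
  have hstab : Tendsto (fun x => k₀ - (K x).1) (𝓝 0) (𝓝 k₀) := by
    simpa using tendsto_const_nhds.sub hKc1
  have hstab1 : ∀ᶠ x in 𝓝 0, 0 < ε * (k₀ - (K x).1).1 :=
    (((continuous_fst.tendsto _).comp hstab).const_mul ε).eventually_const_lt hk1
  have hstab2 : ∀ᶠ x in 𝓝 0, (k₀ - (K x).1).2 < 0 :=
    ((continuous_snd.tendsto _).comp hstab).eventually_lt_const hk2
  filter_upwards [hfix, hconv _ hW, hW, hB, hstab1, hstab2] with x h1 h2 hx h5 h6 h7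
  obtain ⟨h3, -, -, h4⟩ := hx
  constructor
  · intro hret
    obtain ⟨k, hk, -, hkx⟩ := (φ.isReturning_iff).1 hret
    have hk0 : k.1 ≠ 0 := fun h => by simp [h] at hk
    obtain ⟨z, hzW, hzR, hxW, hlim⟩ := h2
    obtain ⟨hzN, hzc, hzA, hzK⟩ := hzW
    -- the iterates are in the orbit of `S x`, which is closed
    have horb : ∀ n : ℕ, ∃ k, S ((fun x => (K x).2)^[n] x) = φ.act k (S x) := by
      intro n
      induction n with
      | zero => exact ⟨0, (φ.act_zero h3).symm⟩
      | succ n ih =>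
        obtain ⟨k', hk'⟩ := ih
        obtain ⟨hyN, -, -, hyK⟩ := hxW n
        obtain ⟨hyN', -, -, -⟩ := hxW (n + 1)
        rw [Function.iterate_succ_apply'] at hyN' ⊢
        refine ⟨k₀ - (K ((fun x => (K x).2)^[n] x)).1 + k', ?_⟩
        rw [φ.act_add hp _ _ h3, ← hk', eq_comm, φ.act_sub_eq_iff hp _ _ hyN hyN', hyK]
    obtain ⟨k', hk'⟩ := φ.exists_act_eq_of_tendsto hp h3 hzN hk0 hkx horb
      (hzc.tendsto.comp hlim)
    -- hence the stabilizer of `S z` is the stabilizer of `S x`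
    rw [hzR, hk', φ.act_comm hp _ _ h3, φ.act_comm hp k₀ _ h3] at hzK
    have hxK := congrArg (φ.act (-k')) hzK
    rw [φ.act_neg_act hp _ (φ.act_mem _ h3), φ.act_neg_act hp _ (φ.act_mem _ h3)] at hxK
    have h8 : X (φ.act (K z).1 (S x)) = ((K z).1, x) := hAB (mk_mem_prod hzA h5)
    rw [hxK, hKd] at h8
    rw [h8]
  · intro hx
    rw [h1 hx] at h4
    exact (φ.isReturning_iff).2 ⟨k₀ - (K x).1, h6, h7,
      (φ.act_sub_eq_iff hp _ _ h3 h3).2 h4.symm⟩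

end RescaledFlow

end ReturnMap

/-! ### The attracting and repelling Lagrangians -/

section ReturnSet

variable {M : Type*} [TopologicalSpace M] [ChartedSpace Plane M] [IsManifold 𝓘(ℝ, Plane) ∞ M]
  {g : ContMDiffRiemannianMetric 𝓘(ℝ, Plane) ∞ Plane (fun x : M => TangentSpace 𝓘(ℝ, Plane) x)}
  {p : Cotangent M → ℝ}

theorem isDefiningFunction_of_eventually {Λ : Set (Cotangent M)} {G : Cotangent M → ℝ}
    {ζ₀ : Cotangent M} (hζ₀ : ζ₀ ∈ puncturedCotangent M)
    (hsm : ∀ᶠ ζ in 𝓝 ζ₀, ContMDiffAt cotangentModel 𝓘(ℝ, ℝ) ∞ G ζ)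
    (hzero : ∀ᶠ ζ in 𝓝 ζ₀, (ζ ∈ Λ ↔ G ζ = 0)) (hG0 : cotangentDiff G ζ₀ ≠ 0) :
    ∃ U, ζ₀ ∈ U ∧ IsDefiningFunction Λ U G := by
  have hN : ∀ᶠ ζ in 𝓝 ζ₀, ζ ∈ puncturedCotangent M := isOpen_puncturedCotangent.mem_nhds hζ₀
  obtain ⟨U, hU, hUo, hmem⟩ := eventually_nhds_iff.1
    ((hN.and hsm).and (hzero.and (eventually_cotangentDiff_ne_zero hsm hG0)))
  exact ⟨U, hmem, hUo, fun ζ h => (hU ζ h).1.1, fun ζ h => (hU ζ h).1.2.contMDiffWithinAt,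
    fun ζ h => (hU ζ h).2.1, fun ζ h _ => (hU ζ h).2.2⟩

namespace RescaledFlow

variable (φ : RescaledFlow g p) [T2Space M]

/-- Near each of its points, the set of returning points is a hypersurface: in slice coordinates it
is the fixed point set of the return map. Its tangent space contains a vector with `dp ≠ 0`, as the
derivative of the return map along the level of `p` is not `1`. -/
theorem exists_isDefiningFunction_returnSet (hp : IsSymbolOrderZero p) {ε δ : ℝ}
    {ζ₀ : Cotangent M} (h₀ : ζ₀ ∈ φ.returnSet ε δ) :
    ∃ U G, ζ₀ ∈ U ∧ IsDefiningFunction (φ.returnSet ε δ) U G ∧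
      ∃ v : Plane × DualPlane, cotangentDiff G ζ₀ v = 0 ∧ cotangentDiff p ζ₀ v ≠ 0 := by
  obtain ⟨hζ₀, hpδ, hfix, hret⟩ := h₀
  obtain ⟨k₀, hk1, hk2, hk₀⟩ := (φ.isReturning_iff).1 hret
  obtain ⟨e, f, he, heα, hf, hfα⟩ := exists_dual_vectors hζ₀ hfix
  obtain ⟨X, hX⟩ := φ.exists_isSliceCoordinates hp hζ₀ hfix he heα hf hfα
  obtain ⟨hKsm, -⟩ := hX.eventually_contDiffAt_returnCoordinates hp hζ₀ hk₀
  have hiff := hX.eventually_isReturning_iff hp hζ₀ hk₀ hk1 hk2 he heα hf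
  have hN := eventually_cotangentSlice_mem hζ₀ e f
  obtain ⟨K, hK⟩ : ∃ K, K = φ.returnCoordinates ζ₀ e f X k₀ := ⟨_, rfl⟩
  have hKd := (hKsm.self_of_nhds.differentiableAt (by simp)).hasFDerivAt
  have hl := hX.fderiv_returnCoordinates hp hζ₀ hk₀ he heα hKd
  rw [← hK] at hKsm hiff hKd hl
  obtain ⟨D, hD⟩ : ∃ D : (ℝ × ℝ) × (ℝ × ℝ) → ℝ, D = fun y => (K y.2).2.2 - y.2.2 := ⟨_, rfl⟩
  have hXtend : Tendsto X (𝓝 ζ₀) (𝓝 0) := by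
    have h1 := hX.smooth.self_of_nhds.continuousAt.tendsto
    rwa [hX.apply_self] at h1
  have hX2 : Tendsto (fun ζ => (X ζ).2) (𝓝 ζ₀) (𝓝 0) := (continuous_snd.tendsto _).comp hXtend
  have hsm : ∀ᶠ ζ in 𝓝 ζ₀, ContMDiffAt cotangentModel 𝓘(ℝ, ℝ) ∞ (D ∘ X) ζ := by
    filter_upwards [hX.smooth, hX2.eventually hKsm] with ζ h1 h2
    refine ContMDiffAt.comp ζ (g := D) (ContDiffAt.contMDiffAt ?_) h1
    have h3 : ContDiffAt ℝ ∞ (fun y : (ℝ × ℝ) × (ℝ × ℝ) => K y.2) (X ζ) :=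
      ContDiffAt.comp (g := K) (X ζ) h2 contDiffAt_snd
    rw [hD]
    exact h3.snd.snd.sub contDiffAt_snd.snd
  have hzero : ∀ᶠ ζ in 𝓝 ζ₀, (ζ ∈ φ.returnSet ε δ ↔ (D ∘ X) ζ = 0) := by
    have hpc : ∀ᶠ ζ in 𝓝 ζ₀, |p ζ| < 2 * δ :=
      (hp.contMDiffAt hζ₀).continuousAt.abs.eventually_lt_const hpδ
    filter_upwards [hpc, isOpen_puncturedCotangent.mem_nhds hζ₀,
      eventually_not_isFixedAtInfinity hp hζ₀ hfix, hX.act_apply, hX2.eventually hiff,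
      hX2.eventually hN] with ζ h1 h2 h3 h4 h5 h6
    have h7 : ζ ∈ φ.returnSet ε δ ↔ φ.IsReturning ε ζ :=
      ⟨fun h => h.2.2.2, fun h => ⟨h2, h1, h3, h⟩⟩
    have h8 := φ.isReturning_act_iff (ε := ε) hp h6 (X ζ).1
    rw [h4, h5] at h8
    rw [h7, h8, Function.comp_apply, hD, sub_eq_zero]
  obtain ⟨X', hX', hXv⟩ := hX.deriv
  -- `dG = m dp + (l - 1) α`, where `(m, l)` is the second row of the derivative of the return map
  have hdG : ∀ v, cotangentDiff (D ∘ X) ζ₀ v = (fderiv ℝ K 0 (1, 0)).2.2 * cotangentDiff p ζ₀ v +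
      (Real.exp k₀.2 - 1) * liouvilleForm ζ₀.2 v := by
    have h1 : HasFDerivAt (fun y : (ℝ × ℝ) × (ℝ × ℝ) => K y.2)
        ((fderiv ℝ K 0).comp (ContinuousLinearMap.snd ℝ (ℝ × ℝ) (ℝ × ℝ))) 0 :=
      HasFDerivAt.comp (g := K) (0 : (ℝ × ℝ) × (ℝ × ℝ)) hKd hasFDerivAt_snd
    have h2 : HasFDerivAt D (((ContinuousLinearMap.snd ℝ ℝ ℝ).comp
        ((ContinuousLinearMap.snd ℝ (ℝ × ℝ) (ℝ × ℝ)).comp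
          ((fderiv ℝ K 0).comp (ContinuousLinearMap.snd ℝ (ℝ × ℝ) (ℝ × ℝ))))) -
        (ContinuousLinearMap.snd ℝ ℝ ℝ).comp (ContinuousLinearMap.snd ℝ (ℝ × ℝ) (ℝ × ℝ)))
        (X ζ₀) := by
      rw [hD, hX.apply_self]
      exact h1.snd.snd.sub hasFDerivAt_snd.snd
    have h3 : cotangentDiff (D ∘ X) ζ₀ = _ := (h2.hasMFDerivAt.comp ζ₀ hX').mfderiv
    intro v
    rw [h3]
    change (fderiv ℝ K 0 (X' v).2).2.2 - (X' v).2.2 = _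
    have h4 : (X' v).2 = cotangentDiff p ζ₀ v • ((1 : ℝ), (0 : ℝ)) +
        liouvilleForm ζ₀.2 v • ((0 : ℝ), (1 : ℝ)) := by
      rw [hXv]
      ext
      · simp
      · simp
        rfl
    rw [h4, map_add, map_smul, map_smul]
    simp only [Prod.snd_add, Prod.smul_snd, smul_eq_mul, hl]
    ring
  have heα' : liouvilleForm ζ₀.2 e = 1 := heα
  have hfα' : liouvilleForm ζ₀.2 f = 0 := hfα
  have hl1 : Real.exp k₀.2 - 1 < 0 := sub_neg.2 (Real.exp_lt_one_iff.2 hk2)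
  have hG0 : cotangentDiff (D ∘ X) ζ₀ ≠ 0 := by
    intro h
    have h1 := hdG e
    rw [h, he, heα'] at h1
    simp at h1
    exact hl1.ne h1.symm
  obtain ⟨U, hU, hG⟩ := isDefiningFunction_of_eventually hζ₀ hsm hzero hG0
  refine ⟨U, D ∘ X, hU, hG,
    (1 - Real.exp k₀.2) • f + (fderiv ℝ K 0 (1, 0)).2.2 • e, ?_, ?_⟩
  · rw [hdG, map_add, map_add, map_smul, map_smul, map_smul, map_smul, he, hf, heα', hfα']
    simp only [smul_eq_mul]
    ring
  · rw [map_add, map_smul, map_smul, he, hf, smul_zero, add_zero, smul_eq_mul, mul_one]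
    exact (by linarith : (0 : ℝ) < 1 - Real.exp k₀.2).ne'

/-- `Λ^±` is a family of Lagrangians: the flow preserves it, so `H_p` is tangent to it. -/
theorem isLagrangianFamily_returnSet (hp : IsSymbolOrderZero p) (ε δ : ℝ) :
    IsLagrangianFamily p (φ.returnSet ε δ) where
  subset _ h := h.1
  conic ζ h t ht := φ.dilate_mem_returnSet hp h ht
  hypersurface ζ h := by
    obtain ⟨U, G, hU, hG, -⟩ := φ.exists_isDefiningFunction_returnSet hp h
    exact ⟨U, G, hU, hG⟩
  diff_ne_zero ζ h U' G' hU' hG' := by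
    obtain ⟨U, G, hU, hG, v, hv, hpv⟩ := φ.exists_isDefiningFunction_returnSet hp h
    obtain ⟨k, hk⟩ := hG'.exists_cotangentDiff_eq hG hU' hU h
    refine ⟨v, ?_, hpv⟩
    have h1 : (k • cotangentDiff G ζ) v = k * cotangentDiff G ζ v := rfl
    rw [hk, h1, hv, mul_zero]
  tangent ζ h U G hU hG := by
    -- the curve `t ↦ φ_t(ζ)` stays in the set
    have hN := h.1
    have h1 : HasMFDerivAt cotangentModel 𝓘(ℝ, ℝ) G (φ.toFun 0 ζ) (cotangentDiff G ζ) := by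
      rw [φ.zero ζ hN]
      exact ((hG.contMDiffAt hU).mdifferentiableAt (by simp)).hasMFDerivAt
    have h2 : HasFDerivAt (fun t : ℝ => G (φ.toFun t ζ)) ((cotangentDiff G ζ).comp
        ((1 : ℝ →L[ℝ] ℝ).smulRight (rescaledVector g p (φ.toFun 0 ζ)))) 0 :=
      (h1.comp (0 : ℝ) (φ.hasMFDerivAt_time hN 0)).hasFDerivAt
    have h3 : (fun t : ℝ => G (φ.toFun t ζ)) =ᶠ[𝓝 0] fun _ => 0 := by
      have h4 : ∀ᶠ t in 𝓝 (0 : ℝ), φ.toFun t ζ ∈ U :=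
        (φ.continuous_time hN).continuousAt.eventually_mem (by
          rw [φ.zero ζ hN]
          exact hG.isOpen.mem_nhds hU)
      filter_upwards [h4] with t ht
      exact (hG.zero_iff _ ht).1 (φ.apply_mem_returnSet hp h t)
    have h5 := h2.hasDerivAt.unique ((hasDerivAt_const (0 : ℝ) (0 : ℝ)).congr_of_eventuallyEq h3)
    have h6 : cotangentDiff G ζ ((1 : ℝ) • rescaledVector g p (φ.toFun 0 ζ)) = 0 := h5
    rw [one_smul, φ.zero ζ hN, rescaledVector, map_smul, smul_eq_mul] at h6
    exact (mul_eq_zero.1 h6).resolve_left (covectorNorm_pos g hN).ne'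

end RescaledFlow

end ReturnSet

theorem lemmal {M : Type*} [TopologicalSpace M] [T2Space M] [CompactSpace M]
    [ChartedSpace Plane M] [IsManifold 𝓘(ℝ, Plane) ∞ M]
    (g : ContMDiffRiemannianMetric 𝓘(ℝ, Plane) ∞ Plane
      (fun x : M => TangentSpace 𝓘(ℝ, Plane) x))
    (p : Cotangent M → ℝ) (hp : IsSymbolOrderZero p) :
    -- general families of Lagrangians
    (∀ Λ : Set (Cotangent M), IsLagrangianFamily p Λ →
      (∃ Φ : Cotangent M → ℝ, IsPhi p Λ Φ) ∧
      (∀ Φ Φ' : Cotangent M → ℝ, IsPhi p Λ Φ → IsPhi p Λ Φ' → EqOn Φ Φ' Λ) ∧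
      (∀ Φ : Cotangent M → ℝ, IsPhi p Λ Φ →
        ∀ U e J Γ₀ F, IsGeneratingFunction p Λ U e J Γ₀ F →
          ∀ w ∈ J, ∀ ξ ∈ Γ₀, HasDerivWithinAt (fun w' => F w' ξ)
            (-Φ (ofCoordinates e (gradient (F w) ξ) ξ)) J w)) ∧
    -- attracting and repulsive Lagrangians of a Morse-Smale flow
    ((∀ ζ ∈ puncturedCotangent M, p ζ = 0 → cotangentDiff p ζ ≠ 0) →
      IsMorseSmaleWithoutFixedPoints g p 0 →
      ∃ δ₀ : ℝ, 0 < δ₀ ∧ ∀ δ : ℝ, 0 < δ → δ ≤ δ₀ →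
        ∀ (ε : ℝ) (Λ : Set (Cotangent M)),
          (ε = 1 ∧ Λ = lambdaPlus g p δ) ∨ (ε = -1 ∧ Λ = lambdaMinus g p δ) →
          IsLagrangianFamily p Λ ∧
          (∃ c : ℝ, 0 < c ∧ ∀ Φ : Cotangent M → ℝ, IsPhi p Λ Φ →
            ∀ ζ ∈ Λ, c * covectorNorm g ζ ≤ ε * Φ ζ) ∧
          (∀ U e J Γ₀ F, J ⊆ Ioo (-(2 * δ)) (2 * δ) → IsGeneratingFunction p Λ U e J Γ₀ F →
            ∀ w ∈ J, ∀ ξ ∈ Γ₀, ε * derivWithin (fun w' => F w' ξ) J w < 0)) := by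
  refine ⟨fun Λ hΛ => ⟨hΛ.exists_isPhi hp, fun Φ Φ' h h' => hΛ.isPhi_unique h h',
    fun Φ hΦ U e J Γ₀ F hF w hw ξ hξ => hF.hasDerivWithinAt hp hΛ hΦ hw hξ⟩, ?_⟩
  rintro - ⟨-, φ, -, -⟩
  -- The sets `Λ^±` collect the closed trajectories on all levels `|w| < 2δ`, and the constant `c`
  -- comes from the compactness of `M` alone; so the argument does not restrict the size of `δ`.
  refine ⟨1, one_pos, fun δ _ _ ε Λ hεΛ => ?_⟩
  obtain ⟨hε, rfl⟩ : (ε = 1 ∨ ε = -1) ∧ Λ = φ.returnSet ε δ := by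
    rcases hεΛ with ⟨rfl, rfl⟩ | ⟨rfl, rfl⟩
    · exact ⟨Or.inl rfl, φ.lambdaPlus_eq hp δ⟩
    · exact ⟨Or.inr rfl, φ.lambdaMinus_eq hp δ⟩
  have hΛ := φ.isLagrangianFamily_returnSet hp ε δ
  have hflow : ∀ t, ∀ ζ ∈ φ.returnSet ε δ, φ.toFun t ζ ∈ φ.returnSet ε δ :=
    fun t ζ h => φ.apply_mem_returnSet hp h t
  refine ⟨hΛ, IsPhi.exists_le hp φ hΛ hflow hε (fun ζ h => h.2.2.2), ?_⟩
  intro U e J Γ₀ F _ hF w hw ξ hξ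
  obtain ⟨Φ, hΦ⟩ := hΛ.exists_isPhi hp
  have hmem : ofCoordinates e (gradient (F w) ξ) ξ ∈ φ.returnSet ε δ := by
    have h1 : ofCoordinates e (gradient (F w) ξ) ξ ∈ φ.returnSet ε δ ∩ p ⁻¹' {w} ∩ U := by
      rw [hF.eq_graph w hw]
      exact mem_image_of_mem _ hξ
    exact h1.1.1
  have huniq : UniqueDiffWithinAt ℝ J w :=
    uniqueDiffOn_convex hF.interval.convex hF.nondegenerate w hw
  rw [(hF.hasDerivWithinAt hp hΛ hΦ hw hξ).derivWithin huniq, mul_neg, neg_lt_zero]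
  exact hΦ.pos_of_isReturning hp φ hΛ hflow hε hmem hmem.2.2.2
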